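/- **Setting.** Let $\varepsilon>0$, $\mathcal T=(0,T)$ with $T>0$, $\mathcal D=(x_L,x_R)$ with $x_L<x_R$, $\Omega^+=(0,1)$, and write $\langle g\rangle=\int_0^1 g\,dv$. Consider the system $$\partial_t\rho+\langle v\partial_x j\rangle=0,\qquad \varepsilon^2\partial_t j+v\partial_x\rho+\varepsilon^2 v\partial_x w+j=0,\qquad \varepsilon^2\partial_t w+w+v\partial_x j-\langle v\partial_x j\rangle=0,\qquad \langle w\rangle=0$$ for $\rho=\rho(t,x)$, $j=j(t,x,v)$, $w=w(t,x,v)$, the equations being understood almost everywhere with weak derivatives. Let $\rho_{\rm IC},j_{\rm IC},w_{\rm IC}$ be the initial data and $\rho_{\rm BC},j_{\rm BC},w_{\rm BC}$ the boundary data (on $\partial\mathcal D=\{x_L,x_R\}$) of the solution, in the sense of $L^2$ traces. For weights $\lambda_1,\dots,\lambda_4\ge 0$ and a triple $(\rho_\theta,j_\theta,w_\theta)$ put, with $⨍_A f=\frac1{|A|}\int_A f$ and the counting measure on $\partial\mathcal D$, $$\begin{aligned}\mathcal R_{\rm APNN}^\varepsilon={}&⨍_{\mathcal T\times\mathcal D}|\partial_t\rho_\theta+\langle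 v\partial_xj_\theta\rangle|^2+⨍_{\mathcal T\times\mathcal D\times\Omega^+}|\varepsilon^2\partial_tj_\theta+v\partial_x\rho_\theta+\varepsilon^2v\partial_xw_\theta+j_\theta|^2\\&+⨍_{\mathcal T\times\mathcal D\times\Omega^+}|\varepsilon^2\partial_tw_\theta+w_\theta+v\partial_xj_\theta-\langle v\partial_xj_\theta\rangle|^2\\&+\lambda_1⨍_{\mathcal D}|\rho_\theta(0,\cdot)-\rho_{\rm IC}|^2+\lambda_2⨍_{\mathcal D\times\Omega^+}\big(\varepsilon^2|j_\theta(0,\cdot)-j_{\rm IC}|^2+\varepsilon^4|w_\theta(0,\cdot)-w_{\rm IC}|^2\big)\\&+\lambda_3⨍_{\mathcal T\times\partial\mathcal D}|\rho_\theta-\rho_{\rm BC}|^2+\lambda_4⨍_{\mathcal T\times\partial\mathcal D\times\Omega^+}\big(|w_\theta-w_{\rm BC}|^2+|j_\theta-j_{\rm BC}|^2\big).\end{aligned}$$ **Theorem.** There is an absolute constant $\kappa\in\mathbb N$ such that the following holds. Let $\rho\in H^2(\mathcal T\times\mathcal D)$ and $j,w\in H^2(\mathcal T\times\mathcal D\times\Omega^+)$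 solve the system above with the given initial and boundary data. Then there are a constant $C$ (independent of $N$) and, for every $N$, fully connected $\tanh$ networks $\rho_\theta=\hat\rho^N$, $j_\theta=\hat j^N$, $w_\theta=\hat w^N$ with two hidden layers, the first of width $\kappa N$ and the second of width $\kappa N^{d}$, where $d$ is the number of input variables ($d=2$ for $\hat\rho^N$, $d=3$ for $\hat j^N$ and $\hat w^N$), such that $$\mathcal R_{\rm APNN}^\varepsilon\le C(1+\ln N)^2N^{-2}\quad\text{for all integers }N>5,$$ and in particular $\mathcal R_{\rm APNN}^\varepsilon\to0$ as $N\to\infty$. -/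

import Mathlib

open MeasureTheory Set Filter Topology
open scoped ContDiff

namespace APNN

/-! ### Weak derivatives, the Sobolev spaces `H^k`, traces -/

section Sobolev

variable {E : Type*} [NormedAddCommGroup E] [NormedSpace ℝ E] [MeasureSpace E]

/-- `g` is the weak derivative of `f` on the open set `U` in the direction `e`: both are locally
integrable on `U`, and `∫_U f ∂_e φ = - ∫_U g φ` for all `φ ∈ C_c^∞(U)`. -/
def IsWeakDeriv (U : Set E) (e : E) (f g : E → ℝ) : Prop :=
  LocallyIntegrableOn f U ∧ LocallyIntegrableOn g U ∧
    ∀ φ : E → ℝ, ContDiff ℝ ∞ φ → HasCompactSupport φ → tsupport φ ⊆ U →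
      ∫ z in U, f z * fderiv ℝ φ z e = - ∫ z in U, g z * φ z

/-- `f ∈ H^k(U)`: `f` and its weak derivatives of order at most `k` exist and lie in `L²(U)`. -/
def MemH (U : Set E) : ℕ → (E → ℝ) → Prop
  | 0, f => MemLp f 2 (volume.restrict U)
  | k + 1, f => MemLp f 2 (volume.restrict U) ∧
      ∀ e : E, ∃ g : E → ℝ, IsWeakDeriv U e f g ∧ MemH U k g

/-- `g ∈ L²` is the trace of `u` on a flat face `Γ = γ '' S` of the boundary of `U` with outward
unit normal `n` (`γ` is an isometric parametrization of `Γ` by the open set `S`): Green's formula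
`∫_U (u ∂_n φ + ∂_n u φ) = ∫_Γ g φ` holds for all smooth compactly supported functions `φ` on the
whole space whose support meets the boundary of `U` only in `Γ`. For `u ∈ H¹(U)` this determines
`g` almost everywhere on `S`. -/
def IsTrace {F : Type*} [MeasureSpace F] (U : Set E) (n : E) (γ : F → E) (S : Set F)
    (u : E → ℝ) (g : F → ℝ) : Prop :=
  MemLp g 2 (volume.restrict S) ∧
    ∃ u' : E → ℝ, IsWeakDeriv U n u u' ∧
      ∀ φ : E → ℝ, ContDiff ℝ ∞ φ → HasCompactSupport φ → tsupport φ ∩ frontier U ⊆ γ '' S →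
        ∫ z in U, (u z * fderiv ℝ φ z n + u' z * φ z) = ∫ y in S, g y * φ (γ y)

end Sobolev

/-! ### Neural networks -/

/-- Parameters of a fully connected network with `d` real inputs, two hidden layers of widths
`m₁` and `m₂`, and one real output. -/
structure TanhNet (d m₁ m₂ : ℕ) where
  W₁ : Matrix (Fin m₁) (Fin d) ℝ
  b₁ : Fin m₁ → ℝ
  W₂ : Matrix (Fin m₂) (Fin m₁) ℝ
  b₂ : Fin m₂ → ℝ
  W₃ : Fin m₂ → ℝ
  b₃ : ℝ

namespace TanhNet

variable {d m₁ m₂ : ℕ}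

/-- Output of the first hidden layer; the activation is `tanh`. -/
noncomputable def hidden₁ (n : TanhNet d m₁ m₂) (z : Fin d → ℝ) : Fin m₁ → ℝ :=
  fun i => Real.tanh ((∑ k, n.W₁ i k * z k) + n.b₁ i)

/-- Output of the second hidden layer; the activation is `tanh`. -/
noncomputable def hidden₂ (n : TanhNet d m₁ m₂) (z : Fin d → ℝ) : Fin m₂ → ℝ :=
  fun i => Real.tanh ((∑ k, n.W₂ i k * n.hidden₁ z k) + n.b₂ i)

/-- The function realized by the network; the output layer is affine. -/
noncomputable def eval (n : TanhNet d m₁ m₂) (z : Fin d → ℝ) : ℝ :=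
  (∑ k, n.W₃ k * n.hidden₂ z k) + n.b₃

/-- The function of `(t, x)` realized by a network with two inputs. -/
noncomputable def toFun₂ (n : TanhNet 2 m₁ m₂) : ℝ × ℝ → ℝ :=
  fun z => n.eval ![z.1, z.2]

/-- The function of `(t, x, v)` realized by a network with three inputs. -/
noncomputable def toFun₃ (n : TanhNet 3 m₁ m₂) : ℝ × ℝ × ℝ → ℝ :=
  fun z => n.eval ![z.1, z.2.1, z.2.2]

end TanhNet

/-! ### The system and its loss function -/

/-- The domain `𝒯 × 𝒟 = (0, T) × (xL, xR)`. -/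
def domTX (T xL xR : ℝ) : Set (ℝ × ℝ) := Ioo 0 T ×ˢ Ioo xL xR

/-- The domain `𝒯 × 𝒟 × Ω⁺ = (0, T) × (xL, xR) × (0, 1)`. -/
def domTXV (T xL xR : ℝ) : Set (ℝ × ℝ × ℝ) := Ioo 0 T ×ˢ Ioo xL xR ×ˢ Ioo 0 1

/-- `(ρ, j, w)` solves the multiscale parity decomposition system
* `∂_t ρ + ⟨v ∂_x j⟩ = 0`,
* `ε² ∂_t j + v ∂_x ρ + ε² v ∂_x w + j = 0`,
* `ε² ∂_t w + w + v ∂_x j - ⟨v ∂_x j⟩ = 0`,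
* `⟨w⟩ = 0`,

almost everywhere, the derivatives being weak ones; here `⟨g⟩ = ∫_0^1 g dv`. -/
def IsSolution (ε T xL xR : ℝ) (ρ : ℝ × ℝ → ℝ) (j w : ℝ × ℝ × ℝ → ℝ) : Prop :=
  ∃ (ρt ρx : ℝ × ℝ → ℝ) (jt jx wt wx : ℝ × ℝ × ℝ → ℝ),
    IsWeakDeriv (domTX T xL xR) (1, 0) ρ ρt ∧
    IsWeakDeriv (domTX T xL xR) (0, 1) ρ ρx ∧
    IsWeakDeriv (domTXV T xL xR) (1, 0, 0) j jt ∧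
    IsWeakDeriv (domTXV T xL xR) (0, 1, 0) j jx ∧
    IsWeakDeriv (domTXV T xL xR) (1, 0, 0) w wt ∧
    IsWeakDeriv (domTXV T xL xR) (0, 1, 0) w wx ∧
    (∀ᵐ z ∂(volume.restrict (domTX T xL xR)),
      ρt z + ∫ v in Ioo (0 : ℝ) 1, v * jx (z.1, z.2, v) = 0) ∧
    (∀ᵐ z ∂(volume.restrict (domTXV T xL xR)),
      ε ^ 2 * jt z + z.2.2 * ρx (z.1, z.2.1) + ε ^ 2 * (z.2.2 * wx z) + j z = 0) ∧
    (∀ᵐ z ∂(volume.restrict (domTXV T xL xR)),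
      ε ^ 2 * wt z + w z + z.2.2 * jx z
        - ∫ v in Ioo (0 : ℝ) 1, v * jx (z.1, z.2.1, v) = 0) ∧
    (∀ᵐ z ∂(volume.restrict (domTX T xL xR)),
      ∫ v in Ioo (0 : ℝ) 1, w (z.1, z.2, v) = 0)

/-- Initial data on `𝒟` and `𝒟 × Ω⁺`, and boundary data on `𝒯 × ∂𝒟` and `𝒯 × ∂𝒟 × Ω⁺`, where
`∂𝒟 = {xL, xR}`: only the values of `ρBC (t, x)`, `jBC (t, x, v)`, `wBC (t, x, v)` at `x = xL` and
`x = xR` are ever used. -/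
structure SideData where
  ρIC : ℝ → ℝ
  jIC : ℝ × ℝ → ℝ
  wIC : ℝ × ℝ → ℝ
  ρBC : ℝ × ℝ → ℝ
  jBC : ℝ × ℝ × ℝ → ℝ
  wBC : ℝ × ℝ × ℝ → ℝ

/-- The trace of `u`, a function on `𝒯 × 𝒟 × Ω⁺`, at `t = 0` is `uIC`. -/
def HasInitial₃ (T xL xR : ℝ) (u : ℝ × ℝ × ℝ → ℝ) (uIC : ℝ × ℝ → ℝ) : Prop :=
  IsTrace (domTXV T xL xR) (-1, 0, 0) (fun y : ℝ × ℝ => (0, y)) (Ioo xL xR ×ˢ Ioo 0 1) u uIC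

/-- The traces of `u`, a function on `𝒯 × 𝒟 × Ω⁺`, at `x = xL` and at `x = xR` are given by
`uBC`. -/
def HasBoundary₃ (T xL xR : ℝ) (u uBC : ℝ × ℝ × ℝ → ℝ) : Prop :=
  IsTrace (domTXV T xL xR) (0, -1, 0) (fun y : ℝ × ℝ => (y.1, xL, y.2)) (Ioo 0 T ×ˢ Ioo 0 1)
    u (fun y => uBC (y.1, xL, y.2)) ∧
  IsTrace (domTXV T xL xR) (0, 1, 0) (fun y : ℝ × ℝ => (y.1, xR, y.2)) (Ioo 0 T ×ˢ Ioo 0 1)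
    u (fun y => uBC (y.1, xR, y.2))

/-- The functions `ρ, j, w` attain the given initial and boundary data in the sense of traces. -/
def AttainsData (T xL xR : ℝ) (δ : SideData) (ρ : ℝ × ℝ → ℝ) (j w : ℝ × ℝ × ℝ → ℝ) : Prop :=
  IsTrace (domTX T xL xR) (-1, 0) (fun x : ℝ => (0, x)) (Ioo xL xR) ρ δ.ρIC ∧
  HasInitial₃ T xL xR j δ.jIC ∧
  HasInitial₃ T xL xR w δ.wIC ∧
  IsTrace (domTX T xL xR) (0, -1) (fun t : ℝ => (t, xL)) (Ioo 0 T) ρ (fun t => δ.ρBC (t, xL)) ∧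
  IsTrace (domTX T xL xR) (0, 1) (fun t : ℝ => (t, xR)) (Ioo 0 T) ρ (fun t => δ.ρBC (t, xR)) ∧
  HasBoundary₃ T xL xR j δ.jBC ∧
  HasBoundary₃ T xL xR w δ.wBC

/-- The classical partial derivative in `t` of a function of `(t, x)`. -/
noncomputable def dt₂ (u : ℝ × ℝ → ℝ) (z : ℝ × ℝ) : ℝ := deriv (fun s => u (s, z.2)) z.1

/-- The classical partial derivative in `x` of a function of `(t, x)`. -/
noncomputable def dx₂ (u : ℝ × ℝ → ℝ) (z : ℝ × ℝ) : ℝ := deriv (fun s => u (z.1, s)) z.2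

/-- The classical partial derivative in `t` of a function of `(t, x, v)`. -/
noncomputable def dt₃ (u : ℝ × ℝ × ℝ → ℝ) (z : ℝ × ℝ × ℝ) : ℝ :=
  deriv (fun s => u (s, z.2.1, z.2.2)) z.1

/-- The classical partial derivative in `x` of a function of `(t, x, v)`. -/
noncomputable def dx₃ (u : ℝ × ℝ × ℝ → ℝ) (z : ℝ × ℝ × ℝ) : ℝ :=
  deriv (fun s => u (z.1, s, z.2.2)) z.2.1

/-- `⟨v ∂_x j⟩ (t, x)`. -/
noncomputable def flux (j : ℝ × ℝ × ℝ → ℝ) (t x : ℝ) : ℝ :=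
  ∫ v in Ioo (0 : ℝ) 1, v * dx₃ j (t, x, v)

/-- The residual part of the loss. Here and below `⨍ z in A, f z` is the mean value
`|A|⁻¹ ∫_A f`. -/
noncomputable def lossResidual (ε T xL xR : ℝ) (ρ : ℝ × ℝ → ℝ) (j w : ℝ × ℝ × ℝ → ℝ) : ℝ :=
  (⨍ z in domTX T xL xR, |dt₂ ρ z + flux j z.1 z.2| ^ 2) +
  (⨍ z in domTXV T xL xR,
    |ε ^ 2 * dt₃ j z + z.2.2 * dx₂ ρ (z.1, z.2.1) + ε ^ 2 * (z.2.2 * dx₃ w z) + j z| ^ 2) +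
  (⨍ z in domTXV T xL xR,
    |ε ^ 2 * dt₃ w z + w z + z.2.2 * dx₃ j z - flux j z.1 z.2.1| ^ 2)

/-- The initial part of the loss, with weights `l₁, l₂`. -/
noncomputable def lossInitial (ε xL xR l₁ l₂ : ℝ) (δ : SideData)
    (ρ : ℝ × ℝ → ℝ) (j w : ℝ × ℝ × ℝ → ℝ) : ℝ :=
  l₁ * (⨍ x in Ioo xL xR, |ρ (0, x) - δ.ρIC x| ^ 2) +
  l₂ * (⨍ y in Ioo xL xR ×ˢ Ioo (0 : ℝ) 1,
    (ε ^ 2 * |j (0, y) - δ.jIC y| ^ 2 + ε ^ 4 * |w (0, y) - δ.wIC y| ^ 2))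

/-- The boundary part of the loss, with weights `l₃, l₄`. The mean value over `∂𝒟 = {xL, xR}` is
half the sum of the values at the two end points. -/
noncomputable def lossBoundary (T xL xR l₃ l₄ : ℝ) (δ : SideData)
    (ρ : ℝ × ℝ → ℝ) (j w : ℝ × ℝ × ℝ → ℝ) : ℝ :=
  l₃ * (⨍ t in Ioo 0 T,
    (|ρ (t, xL) - δ.ρBC (t, xL)| ^ 2 + |ρ (t, xR) - δ.ρBC (t, xR)| ^ 2) / 2) +
  l₄ * (⨍ y in Ioo 0 T ×ˢ Ioo (0 : ℝ) 1,
    ((|w (y.1, xL, y.2) - δ.wBC (y.1, xL, y.2)| ^ 2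
        + |j (y.1, xL, y.2) - δ.jBC (y.1, xL, y.2)| ^ 2) +
      (|w (y.1, xR, y.2) - δ.wBC (y.1, xR, y.2)| ^ 2
        + |j (y.1, xR, y.2) - δ.jBC (y.1, xR, y.2)| ^ 2)) / 2)

/-- The loss `R_APNN = R_residual + R_initial + R_boundary` of a triple `(ρ, j, w)`. -/
noncomputable def loss (ε T xL xR l₁ l₂ l₃ l₄ : ℝ) (δ : SideData)
    (ρ : ℝ × ℝ → ℝ) (j w : ℝ × ℝ × ℝ → ℝ) : ℝ :=
  lossResidual ε T xL xR ρ j w + lossInitial ε xL xR l₁ l₂ δ ρ j w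
    + lossBoundary T xL xR l₃ l₄ δ ρ j w

end APNN

namespace APNN

/-! The loss is quadratic in the approximation error. The exact solution has zero residual and
attains the data as traces, so the residual of a smooth triple is a linear combination of its
errors. Hence the loss is at most a constant times the squared `L²` errors of the three functions
and of their `t`- and `x`-derivatives (`lossResidual_le`; the side conditions follow from the trace
inequality `exists_setIntegral_trace_sub_sq_le`). It remains to approximate an `H²` function on a
box with these derivatives, with squared error `O((log N / N)²)`, by tanh networks of the stated
widths.

Smooth first: average `u χ` against a kernel `K` of width `δ ~ log N / N`, evaluated at `(1 - mδ) x
+ mδ c`. The contraction towards the centre `c` keeps the `δ`-ball inside the box, so no extension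
theorem is needed. For `u ∈ H¹` the `L²` error is `O(δ)`, and applying this to the weak derivatives
of `u ∈ H²` gives the same rate for first derivatives (`exists_setIntegral_sub_smoothing_sq_le`,
`exists_setIntegral_sub_fderiv_smoothing_sq_le`).

The kernel is a product of one-dimensional Chebyshev polynomials of degree `N` in `cosh`. Such a
polynomial is a sum of `2N + 1` exponentials, yet it peaks so sharply that its tail is below `δ²`
(`exists_isPeak_width`). Smoothing with a sum of exponentials returns a sum with equally many
exponentials, here `(2N + 1)^d ≤ 27 N^d`.

Finally, an exponential sum is a `C¹` limit, on compact sets, of networks of fixed width: `tanh (h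
z) / h → z` in the first layer and `(1 + tanh (s/2 + log h / 2)) / (2h) = e^s / (1 + h e^s) → e^s`
in the second, as `h → 0` (`exists_tanhNet_approx`). The size of the weights is unrestricted, so
this step costs nothing in the rate. -/

/-- `φ ∈ C_c^∞(V)`. -/
def IsTest {E : Type*} [NormedAddCommGroup E] [NormedSpace ℝ E] (V : Set E) (φ : E → ℝ) : Prop :=
  ContDiff ℝ ∞ φ ∧ HasCompactSupport φ ∧ tsupport φ ⊆ V

/-! ### Bounding `L²` norms by duality with test functions -/

section Duality

variable {E : Type*} [NormedAddCommGroup E] [NormedSpace ℝ E] [MeasureSpace E] [BorelSpace E]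

theorem IsTest.memLp [IsLocallyFiniteMeasure (volume : Measure E)] {V : Set E} {φ : E → ℝ}
    (h : IsTest V φ) (p : ENNReal) : MemLp φ p (volume.restrict V) :=
  (h.1.continuous.memLp_of_hasCompactSupport h.2.1).restrict V

theorem integral_mul_le_sqrt_mul_sqrt {α : Type*} [MeasurableSpace α] {μ : Measure α} {f g : α → ℝ}
    (hf : MemLp f 2 μ) (hg : MemLp g 2 μ) :
    |∫ x, f x * g x ∂μ| ≤ √(∫ x, f x ^ 2 ∂μ) * √(∫ x, g x ^ 2 ∂μ) := by
  have h1 := norm_inner_le_norm (𝕜 := ℝ) (hf.toLp f) (hg.toLp g)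
  have h2 : inner ℝ (hf.toLp f) (hg.toLp g) = ∫ x, f x * g x ∂μ := by
    rw [L2.inner_def]
    refine integral_congr_ae ?_
    filter_upwards [hf.coeFn_toLp, hg.coeFn_toLp] with x h1 h2
    simp [h1, h2, mul_comm]
  have h3 : ∀ {k : α → ℝ} (hk : MemLp k 2 μ), ‖hk.toLp k‖ = √(∫ x, k x ^ 2 ∂μ) := by
    intro k hk
    rw [norm_eq_sqrt_real_inner, L2.inner_def]
    congr 1
    refine integral_congr_ae ?_
    filter_upwards [hk.coeFn_toLp] with x h1
    simp [h1, sq]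
  rwa [h2, h3, h3, Real.norm_eq_abs] at h1

/-- Test functions are dense in `L²(V)`, so the assumed bound extends by continuity to all of
`L²(V)`, in particular to `f` itself, giving `‖f‖² ≤ M ‖f‖`. Errors of smoothing and of traces are
bounded this way, because weak derivatives are only accessible through test functions. -/
theorem setIntegral_sq_le_of_forall_isTest [FiniteDimensional ℝ E]
    [IsLocallyFiniteMeasure (volume : Measure E)] {V : Set E} (hV : IsOpen V)
    {f : E → ℝ} (hf : MemLp f 2 (volume.restrict V)) {M : ℝ}
    (h : ∀ φ, IsTest V φ → ∫ x in V, f x * φ x ≤ M * √(∫ x in V, φ x ^ 2)) :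
    ∫ x in V, f x ^ 2 ≤ M ^ 2 := by
  let S : Submodule ℝ (Lp ℝ 2 (volume.restrict V)) :=
    { carrier := {g | ∃ φ, IsTest V φ ∧ g =ᵐ[volume.restrict V] φ}
      zero_mem' := ⟨0, ⟨contDiff_const, HasCompactSupport.zero, by simp⟩, Lp.coeFn_zero _ _ _⟩
      add_mem' := by
        rintro a b ⟨φ, hφ, ha⟩ ⟨ψ, hψ, hb⟩
        refine ⟨φ + ψ, ⟨hφ.1.add hψ.1, hφ.2.1.add hψ.2.1, ?_⟩, ?_⟩
        · exact (tsupport_add φ ψ).trans (union_subset hφ.2.2 hψ.2.2)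
        · exact (Lp.coeFn_add a b).trans (ha.add hb)
      smul_mem' := by
        rintro c a ⟨φ, hφ, ha⟩
        refine ⟨c • φ, ⟨contDiff_const.smul hφ.1, hφ.2.1.smul_left, ?_⟩, ?_⟩
        · exact (tsupport_smul_subset_right (fun _ => c) φ).trans hφ.2.2
        · exact (Lp.coeFn_smul c a).trans (ha.const_smul c) }
  have key : ∀ (k : Lp ℝ 2 (volume.restrict V)) (g : Lp ℝ 2 (volume.restrict V)) (φ : E → ℝ),
      g =ᵐ[volume.restrict V] φ → inner ℝ g k = ∫ x in V, k x * φ x := by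
    intro k g φ hg
    rw [L2.inner_def]
    refine integral_congr_ae ?_
    filter_upwards [hg] with x hx
    simp [hx]
  -- Density: a function orthogonal to all test functions vanishes almost everywhere.
  have hS : S.topologicalClosure = ⊤ := by
    rw [Submodule.topologicalClosure_eq_top_iff, Submodule.eq_bot_iff]
    intro k hk
    rw [Submodule.mem_orthogonal] at hk
    have : ∀ᵐ x, x ∈ V → (k : E → ℝ) x = 0 := by
      refine hV.ae_eq_zero_of_integral_contDiff_smul_eq_zero ?_ ?_
      · have := (Lp.memLp k).locallyIntegrable (by norm_num)
        exact locallyIntegrableOn_of_locallyIntegrable_restrict this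
      · intro φ h1 h2 h3
        have ht : IsTest V φ := ⟨h1, h2, h3⟩
        have := hk ((ht.memLp 2).toLp φ) ⟨φ, ht, (ht.memLp 2).coeFn_toLp⟩
        rw [key k _ φ (ht.memLp 2).coeFn_toLp] at this
        rw [← this, ← integral_indicator hV.measurableSet]
        congr 1
        ext x
        by_cases hx : x ∈ V
        · simp [hx, mul_comm]
        · have : φ x = 0 := by
            by_contra h'
            exact hx (h3 (subset_tsupport _ h'))
          simp [this, hx]
    rw [Lp.eq_zero_iff_ae_eq_zero]
    exact (ae_restrict_iff' hV.measurableSet).2 this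
  have hn : ∀ {k : E → ℝ} (hk : MemLp k 2 (volume.restrict V)),
      ‖hk.toLp k‖ = √(∫ x in V, k x ^ 2) := by
    intro k hk
    rw [norm_eq_sqrt_real_inner, key _ _ k hk.coeFn_toLp]
    congr 1
    refine integral_congr_ae ?_
    filter_upwards [hk.coeFn_toLp] with x h1
    simp [h1, sq]
  have hcl : IsClosed {g : Lp ℝ 2 (volume.restrict V) | inner ℝ g (hf.toLp f) ≤ M * ‖g‖} :=
    isClosed_le (by fun_prop) (by fun_prop)
  have hmem : hf.toLp f ∈ closure (S : Set (Lp ℝ 2 (volume.restrict V))) := by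
    rw [← Submodule.topologicalClosure_coe, hS]; trivial
  have := closure_minimal (t := {g : Lp ℝ 2 (volume.restrict V) |
    inner ℝ g (hf.toLp f) ≤ M * ‖g‖}) ?_ hcl hmem
  · rw [mem_ofPred_eq, real_inner_self_eq_norm_sq, hn hf] at this
    have h0 : 0 ≤ ∫ x in V, f x ^ 2 := integral_nonneg fun _ => sq_nonneg _
    rw [← Real.sq_sqrt h0]
    have hs := Real.sqrt_nonneg (∫ x in V, f x ^ 2)
    by_cases h00 : √(∫ x in V, f x ^ 2) = 0
    · rw [h00, zero_pow two_ne_zero]; positivity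
    · have : √(∫ x in V, f x ^ 2) ≤ M := by
        have hpos := lt_of_le_of_ne hs (Ne.symm h00)
        nlinarith
      gcongr
  · rintro g ⟨φ, hφ, hg⟩
    rw [mem_ofPred_eq, key _ _ φ hg]
    have e : g = (hφ.memLp 2).toLp φ := by
      ext1; exact hg.trans (hφ.memLp 2).coeFn_toLp.symm
    rw [e, hn (hφ.memLp 2)]
    refine le_trans (le_of_eq ?_) (h φ hφ)
    refine integral_congr_ae ?_
    filter_upwards [hf.coeFn_toLp] with x h1
    simp [h1]

end Duality

end APNN

namespace APNN

/-! ### Displacement of an `H¹` function along a homothety -/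

section Dilation

variable {E : Type*} [NormedAddCommGroup E] [NormedSpace ℝ E]

theorem mem_of_dilation {U : Set E} (hc : Convex ℝ U) {μ s : ℝ} {z : E}
    (hA : ∀ x ∈ U, x - (μ • x + z) ∈ U) (hs : s ∈ Icc (0 : ℝ) 1) {x : E} (hx : x ∈ U) :
    (1 - s * μ) • x - s • z ∈ U := by
  have := hc hx (hA x hx) (sub_nonneg.2 hs.2) hs.1 (by ring)
  convert this using 1
  module

/-- The new support is the image of the old one under `x ↦ (1 - sμ) x - s z`, which by convexity
maps `U` into itself. -/
theorem IsTest.comp_dilation {U : Set E} (hc : Convex ℝ U) {μ s : ℝ} {z : E}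
    (hA : ∀ x ∈ U, x - (μ • x + z) ∈ U) (hs : s ∈ Icc (0 : ℝ) 1) (hr : 1 - s * μ ≠ 0)
    {φ : E → ℝ} (hφ : IsTest U φ) : IsTest U (fun y => φ ((1 - s * μ)⁻¹ • (y + s • z))) := by
  let h : E ≃ₜ E := (Homeomorph.addRight (s • z)).trans (Homeomorph.smulOfNeZero _ (inv_ne_zero hr))
  have hh : (fun y => φ ((1 - s * μ)⁻¹ • (y + s • z))) = φ ∘ h := rfl
  refine ⟨hφ.1.comp (by fun_prop), ?_, ?_⟩
  · rw [hh]; exact hφ.2.1.comp_homeomorph h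
  · rw [hh, tsupport_comp_eq_preimage]
    intro y hy
    have := mem_of_dilation hc hA hs (hφ.2.2 hy)
    convert this
    change y = (1 - s * μ) • ((1 - s * μ)⁻¹ • (y + s • z)) - s • z
    rw [smul_inv_smul₀ hr]; simp

theorem IsTest.eq_zero {U : Set E} {φ : E → ℝ} (hφ : IsTest U φ) {x : E} (hx : x ∉ U) : φ x = 0 := by
  by_contra h
  exact hx (hφ.2.2 (subset_tsupport _ h))

theorem IsTest.mul_left {U : Set E} {φ g : E → ℝ} (hφ : IsTest U φ) (hg : ContDiff ℝ ∞ g) :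
    IsTest U (fun x => g x * φ x) :=
  ⟨hg.mul hφ.1, hφ.2.1.mul_left, (tsupport_mul_subset_right).trans hφ.2.2⟩

variable [MeasureSpace E]

theorem IsTest.setIntegral_eq {U : Set E} {φ g : E → ℝ} (hφ : IsTest U φ) :
    ∫ x in U, g x * φ x = ∫ x, g x * φ x :=
  setIntegral_eq_integral_of_forall_compl_eq_zero fun x hx => by simp [hφ.eq_zero hx]

variable [BorelSpace E] [FiniteDimensional ℝ E] [(volume : Measure E).IsAddHaarMeasure]

theorem integral_comp_inv_smul_add (g : E → ℝ) (a : E) {r : ℝ} (hr : 0 < r) :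
    ∫ y, g (r⁻¹ • (y + a)) = r ^ Module.finrank ℝ E * ∫ y, g y := by
  rw [integral_add_right_eq_self (fun y => g (r⁻¹ • y)) a, Measure.integral_comp_smul]
  rw [inv_pow, inv_inv, abs_of_pos (by positivity), smul_eq_mul]

/-- This is the estimate `‖u - u((1 - μ) · - z)‖ ≤ C R ‖∇u‖` in weak form, `R` bounding the
coordinates of the displacement `μ x + z`. The homothety is joined to the identity by a path and the
pairing differentiated along it. All motion is carried by the test function, so only the definition
of a weak derivative is needed and no smooth approximation of `u`. -/
theorem abs_integral_mul_sub_dilation_le {ι : Type*} [Fintype ι] (b : Module.Basis ι ℝ E)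
    {U : Set E} (hc : Convex ℝ U) [IsFiniteMeasure (volume.restrict U)]
    {u : E → ℝ} {u' : ι → E → ℝ} (hu : MemLp u 2 (volume.restrict U))
    (hu' : ∀ i, MemLp (u' i) 2 (volume.restrict U)) (hw : ∀ i, IsWeakDeriv U (b i) u (u' i))
    {μ : ℝ} (hμ₀ : 0 ≤ μ) (hμ : μ ≤ 1 / 2) {z : E} (hA : ∀ x ∈ U, x - (μ • x + z) ∈ U) {R : ℝ}
    (hR₀ : 0 ≤ R)
    (hR : ∀ x ∈ U, ∀ i, |b.coord i (μ • x + z)| ≤ R) {φ : E → ℝ} (hφ : IsTest U φ) :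
    |(∫ y in U, u y * φ y)
        - ∫ y in U, u y * ((1 - μ)⁻¹ ^ Module.finrank ℝ E * φ ((1 - μ)⁻¹ • (y + z)))|
      ≤ 2 ^ Module.finrank ℝ E * R * (∑ i, √(∫ y in U, u' i y ^ 2)) * √(∫ y in U, φ y ^ 2) := by
  set d := Module.finrank ℝ E with hd
  -- `D` is the divergence of the field `φ(x) (μ x + z)`; the functions `ψ i` below are its
  -- components.
  set D : E → ℝ := fun x => d * μ * φ x + fderiv ℝ φ x (μ • x + z) with hD
  have hφd : Differentiable ℝ φ := hφ.1.differentiable (by simp)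
  have hDc : Continuous D := by
    have h1 : Continuous (fderiv ℝ φ) := hφ.1.continuous_fderiv (by simp)
    have h2 := hφ.1.continuous
    fun_prop
  have hDs : HasCompactSupport D := by
    refine HasCompactSupport.add (hφ.2.1.mul_left) ?_
    refine HasCompactSupport.intro (hφ.2.1) fun x hx => ?_
    have : x ∉ Function.support (fderiv ℝ φ) := fun h => hx (support_fderiv_subset ℝ h)
    rw [Function.notMem_support] at this
    simp [this]
  obtain ⟨C, hC⟩ := hDc.bounded_above_of_compact_support hDs
  have hu1 : Integrable u (volume.restrict U) := hu.integrable (by norm_num)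
  let ψ : ι → E → ℝ := fun i x => b.coord i (μ • x + z) * φ x
  have hcoord : ∀ i, ContDiff ℝ ∞ (fun x : E => b.coord i (μ • x + z)) := fun i => by
    have : ContDiff ℝ ∞ (b.coord i).toContinuousLinearMap := ContinuousLinearMap.contDiff _
    exact this.comp (by fun_prop)
  have hψ : ∀ i, IsTest U (ψ i) := fun i => hφ.mul_left (hcoord i)
  have hψd : ∀ x, ∑ i, fderiv ℝ (ψ i) x (b i) = D x := by
    intro x
    have h1 : ∀ i, fderiv ℝ (ψ i) x (b i)
        = μ * φ x + b.coord i (μ • x + z) * fderiv ℝ φ x (b i) := by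
      intro i
      have h2 : HasFDerivAt (fun x : E => b.coord i (μ • x + z))
          (μ • (b.coord i).toContinuousLinearMap) x := by
        have h3 : (fun x : E => b.coord i (μ • x + z))
          = fun x => μ • (b.coord i).toContinuousLinearMap x + b.coord i z := by
          ext x; simp
        rw [h3]
        exact (((b.coord i).toContinuousLinearMap.hasFDerivAt (x := x)).const_smul μ).add_const _
      have := (h2.mul (hφd x).hasFDerivAt).fderiv
      change fderiv ℝ (fun x => b.coord i (μ • x + z) * φ x) x (b i) = _
      have e : (fun x => b.coord i (μ • x + z) * φ x)
        = (fun x : E => b.coord i (μ • x + z)) * φ := rfl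
      rw [e, this]
      simp
      ring
    simp_rw [h1, Finset.sum_add_distrib, hD, Finset.sum_const, Finset.card_univ]
    congr 1
    · rw [hd, Module.finrank_eq_card_basis b]; simp; ring
    · conv_rhs => rw [← b.sum_repr (μ • x + z)]
      simp [map_sum]
  have hr : ∀ s ∈ Ioo (-1 / 2 : ℝ) (3 / 2), 1 / 4 ≤ 1 - s * μ := by
    intro s hs; nlinarith [hs.1, hs.2]
  -- With the Jacobian `(1 - sμ)⁻¹ ^ d`, `F s` is the pairing of `φ` with `u((1 - sμ) x - s z)`; its
  -- values at `s = 0` and `s = 1` are the two integrals to compare.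
  let F : ℝ → ℝ := fun s => ∫ y in U, u y * ((1 - s * μ)⁻¹ ^ d * φ ((1 - s * μ)⁻¹ • (y + s • z)))
  have hF : ∀ s ∈ Icc (0 : ℝ) 1, HasDerivAt F
      (∫ y in U, u y * ((1 - s * μ)⁻¹ ^ (d + 1) * D ((1 - s * μ)⁻¹ • (y + s • z)))) s := by
    intro s hs
    refine (hasDerivAt_integral_of_dominated_loc_of_deriv_le (s := Ioo (-1 / 2 : ℝ) (3 / 2))
      (F' := fun s y => u y * ((1 - s * μ)⁻¹ ^ (d + 1) * D ((1 - s * μ)⁻¹ • (y + s • z))))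
      (bound := fun y => ‖u y‖ * (4 ^ (d + 1) * C))
      (Ioo_mem_nhds (by linarith [hs.1]) (by linarith [hs.2])) ?_ ?_ ?_ ?_ ?_ ?_).2
    · refine Eventually.of_forall fun s => hu1.aestronglyMeasurable.mul ?_
      have := hφ.1.continuous
      exact Continuous.aestronglyMeasurable (by fun_prop)
    · have h1 := hφ.1.continuous
      obtain ⟨C', hC'⟩ := h1.bounded_above_of_compact_support hφ.2.1
      refine hu1.mul_bdd (c := |(1 - s * μ)⁻¹ ^ d| * C') ?_ ?_
      · exact Continuous.aestronglyMeasurable (by fun_prop)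
      · refine Eventually.of_forall fun y => ?_
        rw [norm_mul, Real.norm_eq_abs]
        gcongr
        exact hC' _
    · refine hu1.aestronglyMeasurable.mul ?_
      exact Continuous.aestronglyMeasurable (by fun_prop)
    · refine Eventually.of_forall fun y t ht => ?_
      rw [norm_mul, norm_mul, norm_pow]
      have h4 := hr t ht
      have : ‖(1 - t * μ)⁻¹‖ ≤ 4 := by
        rw [Real.norm_eq_abs, abs_of_pos (by positivity)]
        exact inv_le_of_inv_le₀ (by norm_num) (by linarith)
      gcongr
      exact hC _
    · exact hu1.norm.mul_const _
    · refine Eventually.of_forall fun y t ht => ?_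
      have h4 := hr t ht
      have hne : 1 - t * μ ≠ 0 := by linarith
      have hq : HasDerivAt (fun t => (1 - t * μ)⁻¹) (μ * (1 - t * μ)⁻¹ ^ 2) t := by
        have := (((hasDerivAt_id t).mul_const μ).const_sub 1).inv hne
        refine this.congr_deriv ?_
        simp only [id_eq]
        field_simp
      have hx : HasDerivAt (fun t => (1 - t * μ)⁻¹ • (y + t • z))
          ((1 - t * μ)⁻¹ • (μ • ((1 - t * μ)⁻¹ • (y + t • z)) + z)) t := by
        have := hq.smul (((hasDerivAt_id t).smul_const z).const_add y)
        refine this.congr_deriv ?_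
        simp only [id_eq]
        module
      have := ((hq.fun_pow d).mul ((hφd _).hasFDerivAt.comp_hasDerivAt t hx)).const_mul (u y)
      refine this.congr_deriv ?_
      simp only [hD, map_smul, smul_eq_mul, Function.comp_apply]
      rcases Nat.eq_zero_or_pos d with h0 | h0
      · simp [h0]
      · obtain ⟨k, hk⟩ := Nat.exists_eq_add_of_lt h0
        simp only [zero_add] at hk
        rw [hk, Nat.add_sub_cancel]
        push_cast
        generalize (1 - t * μ)⁻¹ • (y + t • z) = x
        generalize (1 - t * μ)⁻¹ = q
        ring
  have hF' : ∀ s ∈ Icc (0 : ℝ) 1,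
      ‖∫ y in U, u y * ((1 - s * μ)⁻¹ ^ (d + 1) * D ((1 - s * μ)⁻¹ • (y + s • z)))‖
      ≤ 2 ^ d * R * (∑ i, √(∫ y in U, u' i y ^ 2)) * √(∫ y in U, φ y ^ 2) := by
    intro s hs
    have hr2 : 1 / 2 ≤ 1 - s * μ := by nlinarith [hs.1, hs.2]
    have hr1 : 1 - s * μ ≤ 1 := by nlinarith [hs.1, hs.2]
    have hne : 1 - s * μ ≠ 0 := by linarith
    set q := (1 - s * μ)⁻¹ with hq
    have hq0 : 0 < q := by positivity
    have hq2 : q ≤ 2 := inv_le_of_inv_le₀ (by norm_num) (by linarith)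
    have hT := fun i => (hψ i).comp_dilation hc hA hs hne
    have h1 : ∀ i, ∫ y in U, u y * (q * fderiv ℝ (ψ i) (q • (y + s • z)) (b i))
        = - ∫ y in U, u' i y * ψ i (q • (y + s • z)) := by
      intro i
      rw [← (hw i).2.2 _ (hT i).1 (hT i).2.1 (hT i).2.2]
      congr 1
      ext y
      congr 1
      have h3 : HasFDerivAt (fun y : E => q • (y + s • z)) (q • ContinuousLinearMap.id ℝ E) y :=
        ((hasFDerivAt_id y).add_const _).const_smul q
      have h4 := (((hψ i).1.differentiable (by simp) (q • (y + s • z))).hasFDerivAt.comp y h3).fderiv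
      change _ = fderiv ℝ (ψ i ∘ fun y => q • (y + s • z)) y (b i)
      rw [h4]
      simp
    -- One factor `q` comes from differentiating the dilated `ψ i`. The remaining `q ^ d` is at most
    -- `2 ^ d`.
    have h2 : ∫ y in U, u y * (q ^ (d + 1) * D (q • (y + s • z)))
        = - (q ^ d * ∑ i, ∫ y in U, u' i y * ψ i (q • (y + s • z))) := by
      rw [← mul_neg, ← Finset.sum_neg_distrib, ← Finset.sum_congr rfl fun i _ => h1 i,
        ← integral_finsetSum, ← integral_const_mul]
      · congr 1
        ext y
        rw [← hψd, ← Finset.mul_sum, ← Finset.mul_sum]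
        ring
      · intro i _
        have hc1 : Continuous (fderiv ℝ (ψ i)) := (hψ i).1.continuous_fderiv (by simp)
        obtain ⟨C', hC'⟩ := hc1.bounded_above_of_compact_support ((hψ i).2.1.fderiv (𝕜 := ℝ))
        refine hu1.mul_bdd (c := |q| * (C' * ‖b i‖)) ?_ ?_
        · exact Continuous.aestronglyMeasurable (by fun_prop)
        · refine Eventually.of_forall fun y => ?_
          rw [norm_mul, Real.norm_eq_abs]
          gcongr
          exact (ContinuousLinearMap.le_opNorm _ _).trans (by gcongr; exact hC' _)
    have h5 : ∀ i, √(∫ y in U, ψ i (q • (y + s • z)) ^ 2) ≤ R * √(∫ y in U, φ y ^ 2) := by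
      intro i
      have e1 : ∫ y in U, ψ i (q • (y + s • z)) ^ 2 = (1 - s * μ) ^ d * ∫ y in U, ψ i y ^ 2 := by
        simp_rw [sq]
        rw [(hT i).setIntegral_eq, (hψ i).setIntegral_eq, ← integral_comp_inv_smul_add _ (s • z)
          (by linarith)]
      have e2 : ∫ y in U, ψ i y ^ 2 ≤ R ^ 2 * ∫ y in U, φ y ^ 2 := by
        rw [← integral_const_mul]
        refine integral_mono_of_nonneg (Eventually.of_forall fun _ => sq_nonneg _)
          ((hφ.memLp 2).integrable_sq.const_mul _) (Eventually.of_forall fun y => ?_)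
        by_cases hy : y ∈ U
        · simp only [ψ, mul_pow]
          exact mul_le_mul_of_nonneg_right
            (sq_le_sq' (abs_le.1 (hR y hy i)).1 (abs_le.1 (hR y hy i)).2) (sq_nonneg _)
        · simp [ψ, hφ.eq_zero hy]
      have e3 : (0 : ℝ) ≤ ∫ y in U, ψ i y ^ 2 := integral_nonneg fun _ => sq_nonneg _
      rw [e1]
      calc √((1 - s * μ) ^ d * ∫ y in U, ψ i y ^ 2) ≤ √(R ^ 2 * ∫ y in U, φ y ^ 2) := by
            apply Real.sqrt_le_sqrt
            have : (1 - s * μ) ^ d ≤ 1 := pow_le_one₀ (by linarith) hr1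
            nlinarith
        _ = _ := by rw [Real.sqrt_mul (sq_nonneg R), Real.sqrt_sq hR₀]
    rw [h2, norm_neg, norm_mul, norm_pow, Real.norm_of_nonneg hq0.le]
    have h6 : ‖∑ i, ∫ y in U, u' i y * ψ i (q • (y + s • z))‖
        ≤ ∑ i, √(∫ y in U, u' i y ^ 2) * (R * √(∫ y in U, φ y ^ 2)) := by
      refine (norm_sum_le _ _).trans (Finset.sum_le_sum fun i _ => ?_)
      refine (integral_mul_le_sqrt_mul_sqrt (hu' i) ((hT i).memLp 2)).trans ?_
      gcongr
      exact h5 i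
    rw [← Finset.sum_mul] at h6
    calc _ ≤ 2 ^ d * ((∑ i, √(∫ y in U, u' i y ^ 2)) * (R * √(∫ y in U, φ y ^ 2))) := by gcongr
      _ = _ := by ring
  have := norm_image_sub_le_of_norm_deriv_le_segment_01'
    (fun s hs => (hF s hs).hasDerivWithinAt) (fun s hs => hF' s ⟨hs.1, hs.2.le⟩)
  rw [norm_sub_rev] at this
  simpa [F] using this

end Dilation

end APNN

namespace APNN

/-! ### Smoothing with a contraction, for a general kernel -/

section Smoothing

theorem setIntegral_abs_le_sqrt_mul_sqrt {E : Type*} [MeasureSpace E] {U : Set E} [IsFiniteMeasure (volume.restrict U)]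
    {u : E → ℝ} (hu : MemLp u 2 (volume.restrict U)) :
    ∫ x in U, |u x| ≤ √(volume.real U) * √(∫ x in U, u x ^ 2) := by
  have h := integral_mul_le_sqrt_mul_sqrt (memLp_const (μ := volume.restrict U) (p := 2) (1 : ℝ))
    hu.norm
  simp only [one_mul, one_pow, Real.norm_eq_abs, sq_abs, integral_const, smul_eq_mul, mul_one,
    measureReal_restrict_apply_univ] at h
  exact (le_abs_self _).trans h

variable {E : Type*} [NormedAddCommGroup E] [NormedSpace ℝ E] [MeasureSpace E]

/-- The average of `u * χ` against the kernel `K` near the image of `x` under the homothety with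
centre `c` and ratio `1 - μ`. -/
noncomputable def smoothing (U : Set E) (K χ : E → ℝ) (μ : ℝ) (c : E) (u : E → ℝ) (x : E) : ℝ :=
  ∫ y in U, u y * χ y * K ((1 - μ) • x + μ • c - y)

variable [BorelSpace E] [FiniteDimensional ℝ E] [(volume : Measure E).IsAddHaarMeasure]

/-- Fubini and the substitution `z = (1 - μ) x + μ c - y`. The pairing of the smoothed function with
`φ` becomes a `k`-average of pairings with dilated test functions, to which the displacement
estimate applies for each `z`. -/
theorem setIntegral_kernel_dilation {U : Set E} 
    [IsFiniteMeasure (volume.restrict U)] {v : E → ℝ} (hv : Integrable v (volume.restrict U))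
    {μ : ℝ} (hμ : μ ≤ 1 / 2) {c : E} {k : E → ℝ} (hkm : Measurable k) (hki : Integrable k)
    {Ck : ℝ} (hkb : ∀ z, ‖k z‖ ≤ Ck) {φ : E → ℝ} (hφ : IsTest U φ) :
    Integrable (fun x => (∫ y in U, v y * k ((1 - μ) • x + μ • c - y)) * φ x)
        (volume.restrict U) ∧
    Integrable (fun z => k z * ∫ y in U, v y *
        ((1 - μ)⁻¹ ^ Module.finrank ℝ E * φ ((1 - μ)⁻¹ • (y + (z - μ • c))))) ∧
    ∫ x in U, (∫ y in U, v y * k ((1 - μ) • x + μ • c - y)) * φ x =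
      ∫ z, k z * ∫ y in U, v y *
        ((1 - μ)⁻¹ ^ Module.finrank ℝ E * φ ((1 - μ)⁻¹ • (y + (z - μ • c)))) := by
  have hr : 0 < 1 - μ := by linarith
  have hφc := hφ.1.continuous
  have hφi : Integrable φ := hφc.integrable_of_hasCompactSupport hφ.2.1
  obtain ⟨C, hC⟩ := hφc.bounded_above_of_compact_support hφ.2.1
  have h1 : Integrable (fun p : E × E => v p.1 * φ p.2 * k ((1 - μ) • p.2 + μ • c - p.1))
      ((volume.restrict U).prod volume) := by
    refine (hv.mul_prod hφi).mul_bdd (c := Ck) ?_ (Eventually.of_forall fun _ => hkb _)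
    exact (hkm.comp (by fun_prop)).aestronglyMeasurable
  have h2 : Integrable (fun p : E × E => v p.1 * k p.2 *
      ((1 - μ)⁻¹ ^ Module.finrank ℝ E * φ ((1 - μ)⁻¹ • (p.1 + (p.2 - μ • c)))))
      ((volume.restrict U).prod volume) := by
    refine (hv.mul_prod hki).mul_bdd (c := |(1 - μ)⁻¹ ^ Module.finrank ℝ E| * C) ?_ 
      (Eventually.of_forall fun _ => ?_)
    · exact Continuous.aestronglyMeasurable (by fun_prop)
    · rw [norm_mul, Real.norm_eq_abs]
      gcongr
      exact hC _
  have e1 : ∀ x, ∫ y in U, v y * φ x * k ((1 - μ) • x + μ • c - y)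
      = (∫ y in U, v y * k ((1 - μ) • x + μ • c - y)) * φ x := by
    intro x
    rw [← integral_mul_const]
    congr 1; ext y; ring
  have e2 : ∀ z, ∫ y in U, v y * k z *
      ((1 - μ)⁻¹ ^ Module.finrank ℝ E * φ ((1 - μ)⁻¹ • (y + (z - μ • c))))
      = k z * ∫ y in U, v y *
      ((1 - μ)⁻¹ ^ Module.finrank ℝ E * φ ((1 - μ)⁻¹ • (y + (z - μ • c)))) := by
    intro z
    rw [← integral_const_mul]
    congr 1; ext y; ring
  refine ⟨?_, ?_, ?_⟩
  · have := h1.integral_prod_right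
    simp only [e1] at this
    exact this.integrableOn
  · have := h2.integral_prod_right
    simpa only [e2] using this
  · rw [hφ.setIntegral_eq]
    simp_rw [← e1, ← e2]
    refine (integral_integral_swap
      (f := fun y x => v y * φ x * k ((1 - μ) • x + μ • c - y)) h1).symm.trans (Eq.trans ?_
      (integral_integral_swap (f := fun y z => v y * k z *
        ((1 - μ)⁻¹ ^ Module.finrank ℝ E * φ ((1 - μ)⁻¹ • (y + (z - μ • c))))) h2))
    congr 1
    ext y
    have e3 := integral_comp_inv_smul_add
      (fun x => v y * φ x * k ((1 - μ) • x + μ • c - y)) (y - μ • c) hr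
    have hne : (1 - μ) ^ Module.finrank ℝ E ≠ 0 := by positivity
    rw [← inv_mul_eq_iff_eq_mul₀ hne] at e3
    rw [← e3, ← integral_const_mul]
    congr 1
    ext z
    rw [smul_inv_smul₀ hr.ne', inv_pow]
    have e4 : z + (y - μ • c) + μ • c - y = z := by abel
    have e5 : z + (y - μ • c) = y + (z - μ • c) := by abel
    rw [e4, e5]
    ring

/-- The kernel is cut at radius `δ`. The inner part `k` is nonnegative of unit mass, so its error is
an average of displacement errors; the outer part is at most `η` and contributes at most `η ‖u‖₁`
pointwise. The two errors are the two summands of the bound. -/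
theorem setIntegral_sub_smoothing_sq_le {ι : Type*} [Fintype ι] (b : Module.Basis ι ℝ E)
    {U : Set E} (hU : IsOpen U) (hc : Convex ℝ U) [IsFiniteMeasure (volume.restrict U)]
    {u : E → ℝ} {u' : ι → E → ℝ} (hu : MemLp u 2 (volume.restrict U))
    (hu' : ∀ i, MemLp (u' i) 2 (volume.restrict U)) (hw : ∀ i, IsWeakDeriv U (b i) u (u' i))
    {μ : ℝ} (hμ₀ : 0 ≤ μ) (hμ : μ ≤ 1 / 2) {c : E} {δ R η : ℝ} (hR₀ : 0 ≤ R) (hη : 0 ≤ η)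
    {K χ : E → ℝ} (hK : Continuous K) (hχ : Continuous χ) (hχ1 : ∀ y, |χ y| ≤ 1)
    (hA : ∀ x ∈ U, ∀ z, ‖z‖ ≤ δ → (1 - μ) • x + μ • c - z ∈ U ∧ χ ((1 - μ) • x + μ • c - z) = 1)
    (hR : ∀ x ∈ U, ∀ z, ‖z‖ ≤ δ → ∀ i, |b.coord i (μ • x + (z - μ • c))| ≤ R)
    (hK0 : ∀ z, ‖z‖ ≤ δ → 0 ≤ K z) (hK1 : ∫ z in Metric.closedBall 0 δ, K z = 1)
    (hK2 : ∀ x ∈ U, ∀ y ∈ U, δ < ‖(1 - μ) • x + μ • c - y‖ → |K ((1 - μ) • x + μ • c - y)| ≤ η)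
    (hP : MemLp (smoothing U K χ μ c u) 2 (volume.restrict U)) :
    ∫ x in U, (u x - smoothing U K χ μ c u x) ^ 2 ≤
      (2 ^ Module.finrank ℝ E * R * (∑ i, √(∫ y in U, u' i y ^ 2))
        + η * (∫ y in U, |u y|) * √(volume.real U)) ^ 2 := by
  refine setIntegral_sq_le_of_forall_isTest hU (hu.sub hP) fun φ hφ => ?_
  set k : E → ℝ := (Metric.closedBall (0 : E) δ).indicator K with hk
  have hball : MeasurableSet (Metric.closedBall (0 : E) δ) := Metric.isClosed_closedBall.measurableSet
  have hcomp : IsCompact (Metric.closedBall (0 : E) δ) := isCompact_closedBall _ _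
  have hkm : Measurable k := hK.measurable.indicator hball
  have hki : Integrable k := (integrable_indicator_iff hball).2 (hK.continuousOn.integrableOn_compact hcomp)
  obtain ⟨Ck, hCk⟩ := hcomp.exists_bound_of_continuousOn hK.continuousOn
  have hkb : ∀ z, ‖k z‖ ≤ max Ck 0 := by
    intro z
    by_cases hz : z ∈ Metric.closedBall (0 : E) δ
    · rw [hk, indicator_of_mem hz]; exact (hCk z hz).trans (le_max_left _ _)
    · rw [hk, indicator_of_notMem hz]; simp
  have hk0 : ∀ z, 0 ≤ k z := fun z =>
    indicator_nonneg (fun z hz => hK0 z (by simpa using hz)) z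
  have hu1 : Integrable u (volume.restrict U) := hu.integrable (by norm_num)
  set v : E → ℝ := fun y => u y * χ y with hv
  have hvi : Integrable v (volume.restrict U) :=
    hu1.mul_bdd (c := 1) hχ.aestronglyMeasurable (Eventually.of_forall hχ1)
  obtain ⟨i1, i2, e⟩ := setIntegral_kernel_dilation (c := c) hvi hμ hkm hki hkb hφ
  set N : E → ℝ := fun x => ∫ y in U, v y * k ((1 - μ) • x + μ • c - y) with hN
  set P := smoothing U K χ μ c u with hPdef
  set M := 2 ^ Module.finrank ℝ E * R * (∑ i, √(∫ y in U, u' i y ^ 2)) with hM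
  have hφ2 := hφ.memLp 2
  have hφ1 : Integrable φ (volume.restrict U) := hφ2.integrable (by norm_num)
  have far : ∀ x ∈ U, |P x - N x| ≤ η * ∫ y in U, |u y| := by
    intro x hx
    have : P x - N x = ∫ y in U, v y * (K - k) ((1 - μ) • x + μ • c - y) := by
      rw [hPdef, hN, smoothing, ← integral_sub]
      · congr 1; ext y; simp [hv]; ring
      · have hUb : AEStronglyMeasurable (fun y => K ((1 - μ) • x + μ • c - y)) (volume.restrict U) :=
          Continuous.aestronglyMeasurable (by fun_prop)
        refine (hvi.mul_bdd (c := max (max Ck 0) η) hUb ?_)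
        filter_upwards [ae_restrict_mem hU.measurableSet] with y hy
        by_cases hz : ‖(1 - μ) • x + μ • c - y‖ ≤ δ
        · exact (hCk _ (by simpa using hz)).trans ((le_max_left _ _).trans (le_max_left _ _))
        · exact (hK2 x hx y hy (not_le.1 hz)).trans (le_max_right _ _)
      · refine hvi.mul_bdd (c := max Ck 0) ?_ (Eventually.of_forall fun _ => hkb _)
        exact (hkm.comp (by fun_prop)).aestronglyMeasurable
    rw [this, ← integral_const_mul, ← Real.norm_eq_abs]
    refine norm_integral_le_of_norm_le (hu1.abs.const_mul _) ?_
    filter_upwards [ae_restrict_mem hU.measurableSet] with y hy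
    rw [norm_mul, mul_comm]
    have h1 : ‖v y‖ ≤ |u y| := by
      rw [hv, norm_mul]
      exact mul_le_of_le_one_right (norm_nonneg _) (hχ1 y)
    gcongr
    by_cases hz : (1 - μ) • x + μ • c - y ∈ Metric.closedBall (0 : E) δ
    · simp only [Pi.sub_apply, hk, indicator_of_mem hz]; simpa using hη
    · simp only [Pi.sub_apply, hk, indicator_of_notMem hz, sub_zero]
      exact hK2 x hx y hy (by simpa using hz)
  have near : |(∫ y in U, u y * φ y) - ∫ x in U, N x * φ x| ≤ M * √(∫ x in U, φ x ^ 2) := by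
    rw [e]
    have hone : ∫ z, k z = 1 := by rw [hk, integral_indicator hball, hK1]
    have : (∫ y in U, u y * φ y) = ∫ z, k z * ∫ y in U, u y * φ y := by
      rw [integral_mul_const, hone, one_mul]
    rw [this, ← integral_sub (hki.mul_const _) i2]
    have hb := norm_integral_le_of_norm_le (f := fun z => k z * (∫ y in U, u y * φ y) - k z *
      ∫ y in U, v y * ((1 - μ)⁻¹ ^ Module.finrank ℝ E * φ ((1 - μ)⁻¹ • (y + (z - μ • c)))))
      (hki.mul_const (M * √(∫ x in U, φ x ^ 2))) (Eventually.of_forall fun z => ?_)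
    · rwa [integral_mul_const, hone, one_mul] at hb
    by_cases hz : z ∈ Metric.closedBall (0 : E) δ
    · have hz' : ‖z‖ ≤ δ := by simpa using hz
      rw [← mul_sub, norm_mul, Real.norm_of_nonneg (hk0 z)]
      refine mul_le_mul_of_nonneg_left ?_ (hk0 z)
      have hA' : ∀ x ∈ U, x - (μ • x + (z - μ • c)) ∈ U := fun x hx => by
        convert (hA x hx z hz').1 using 1; module
      have := abs_integral_mul_sub_dilation_le b hc hu hu' hw hμ₀ hμ hA' hR₀
        (fun x hx i => hR x hx z hz' i) hφ
      refine le_trans (le_of_eq ?_) this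
      rw [Real.norm_eq_abs]
      congr 3
      ext y
      simp only [hv]
      -- The cutoff is invisible here: where the dilated `φ` does not vanish, `y` is a contracted
      -- point of `U` displaced by `z`, and there `χ = 1`.
      by_cases hy : (1 - μ)⁻¹ • (y + (z - μ • c)) ∈ U
      · have h2 := (hA _ hy z hz').2
        rw [smul_inv_smul₀ (by linarith)] at h2
        rw [show y + (z - μ • c) + μ • c - z = y by abel] at h2
        rw [h2, mul_one]
      · rw [hφ.eq_zero hy]; simp
    · rw [hk, indicator_of_notMem hz]; simp
  have split : ∫ x in U, (u x - P x) * φ x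
      = ((∫ y in U, u y * φ y) - ∫ x in U, N x * φ x) - ∫ x in U, (P x - N x) * φ x := by
    have j1 : Integrable (fun x => u x * φ x) (volume.restrict U) := hu.integrable_mul hφ2
    have j2 : Integrable (fun x => P x * φ x) (volume.restrict U) := hP.integrable_mul hφ2
    have j3 : Integrable (fun x => N x * φ x) (volume.restrict U) := i1
    simp_rw [sub_mul]
    rw [integral_sub j1 j2, integral_sub j2 j3]
    ring
  have farint : |∫ x in U, (P x - N x) * φ x| ≤
      η * (∫ y in U, |u y|) * (√(volume.real U) * √(∫ x in U, φ x ^ 2)) := by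
    refine le_trans ?_ (mul_le_mul_of_nonneg_left (setIntegral_abs_le_sqrt_mul_sqrt hφ2)
      (mul_nonneg hη (integral_nonneg fun _ => abs_nonneg _)))
    rw [← integral_const_mul, ← Real.norm_eq_abs]
    refine norm_integral_le_of_norm_le (hφ1.abs.const_mul (η * ∫ y in U, |u y|)) ?_
    filter_upwards [ae_restrict_mem hU.measurableSet] with x hx
    rw [norm_mul]
    exact mul_le_mul_of_nonneg_right (far x hx) (norm_nonneg _)
  change ∫ x in U, (u x - P x) * φ x ≤ _
  rw [split]
  have h1 := (abs_le.1 near).2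
  have h2 := (abs_le.1 farint).1
  linarith

end Smoothing

end APNN

namespace APNN

/-! ### Kernels that are sums of exponentials -/

section ExpSum

theorem integrable_mul_of_isBounded {E : Type*} [NormedAddCommGroup E]
    [MeasureSpace E] [BorelSpace E] [ProperSpace E] {U : Set E} (hUm : MeasurableSet U)
    (hb : Bornology.IsBounded U) {v : E → ℝ}
    (hv : Integrable v (volume.restrict U)) {g : E → ℝ} (hg : Continuous g) :
    Integrable (fun y => v y * g y) (volume.restrict U) := by
  obtain ⟨C, hC⟩ := hb.isCompact_closure.exists_bound_of_continuousOn hg.continuousOn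
  refine hv.mul_bdd (c := C) hg.aestronglyMeasurable ?_
  filter_upwards [ae_restrict_mem hUm] with y hy
  exact hC y (subset_closure hy)

variable {E : Type*} [NormedAddCommGroup E] [NormedSpace ℝ E]

/-- A finite linear combination of exponentials of linear functionals. -/
noncomputable def expSum {J : Type*} [Fintype J] (w : J → ℝ) (a : J → E →L[ℝ] ℝ) (z : E) : ℝ :=
  ∑ k, w k * Real.exp (a k z)

variable {J : Type*} [Fintype J] (w : J → ℝ) (a : J → E →L[ℝ] ℝ)

theorem contDiff_expSum : ContDiff ℝ ∞ (expSum w a) := by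
  unfold expSum
  fun_prop

theorem fderiv_expSum (z e : E) :
    fderiv ℝ (expSum w a) z e = expSum (fun k => w k * a k e) a z := by
  have : HasFDerivAt (expSum w a) (∑ k, w k • (Real.exp (a k z) • a k)) z := by
    unfold expSum
    refine HasFDerivAt.fun_sum fun k _ => ?_
    exact ((a k).hasFDerivAt.exp).const_mul _
  rw [this.fderiv]
  simp only [expSum, sum_apply, smul_apply, smul_eq_mul]
  refine Finset.sum_congr rfl fun k _ => by ring

variable [MeasureSpace E]

theorem smoothing_congr_ae {U : Set E} {K χ : E → ℝ} {μ : ℝ} {c : E} {u v : E → ℝ}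
    (h : u =ᵐ[volume.restrict U] v) : smoothing U K χ μ c u = smoothing U K χ μ c v := by
  ext x
  refine integral_congr_ae ?_
  filter_upwards [h] with y hy
  rw [hy]

variable [BorelSpace E]

/-- Each exponential of `(1 - μ) x + μ c - y` factors into a function of `x` and a function of `y`.
The exponents and the number of terms therefore do not depend on `u`, which fixes the network width
in advance. -/
theorem smoothing_expSum [ProperSpace E] {U : Set E} (hUm : MeasurableSet U)
    (hb : Bornology.IsBounded U) {u χ : E → ℝ}
    (hv : Integrable (fun y => u y * χ y) (volume.restrict U)) (μ : ℝ) (c : E) :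
    smoothing U (expSum w a) χ μ c u =
      expSum (fun k => w k * ∫ y in U, u y * χ y * Real.exp (a k (μ • c - y)))
        (fun k => (1 - μ) • a k) := by
  ext x
  simp only [smoothing, expSum, Finset.mul_sum]
  rw [integral_finsetSum]
  · refine Finset.sum_congr rfl fun k _ => ?_
    rw [mul_right_comm, ← integral_const_mul]
    congr 1
    ext y
    have : a k ((1 - μ) • x + μ • c - y) = ((1 - μ) • a k) x + a k (μ • c - y) := by
      simp; ring
    rw [this, Real.exp_add]
    ring
  · intro k _
    have := integrable_mul_of_isBounded hUm hb hv
      (g := fun y => w k * Real.exp (a k ((1 - μ) • x + μ • c - y))) (by fun_prop)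
    exact this

theorem fderiv_smoothing_expSum [ProperSpace E] {U : Set E} (hUm : MeasurableSet U)
    (hb : Bornology.IsBounded U) {u χ : E → ℝ}
    (hv : Integrable (fun y => u y * χ y) (volume.restrict U)) (μ : ℝ) (c x e : E) :
    fderiv ℝ (smoothing U (expSum w a) χ μ c u) x e =
      (1 - μ) * smoothing U (fun z => fderiv ℝ (expSum w a) z e) χ μ c u x := by
  have h : (fun z => fderiv ℝ (expSum w a) z e) = expSum (fun k => w k * a k e) a := by
    ext z; rw [fderiv_expSum]
  rw [h, smoothing_expSum w a hUm hb hv, smoothing_expSum _ a hUm hb hv, fderiv_expSum]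
  simp only [expSum, Finset.mul_sum]
  refine Finset.sum_congr rfl fun k _ => ?_
  simp only [smul_apply, smul_eq_mul]
  ring

/-- Integration by parts against the test function `K(p - y) χ(y)`, with `p = (1 - μ) x + μ c`. The
exponential kernel has no compact support; the cutoff makes it admissible at the price of the term
with the derivative of `χ`. -/
theorem smoothing_fderiv [FiniteDimensional ℝ E] {U : Set E} (hUm : MeasurableSet U)
    (hb : Bornology.IsBounded U) {u u' χ : E → ℝ}
    {e : E} (hu : Integrable u (volume.restrict U))
    (hw : IsWeakDeriv U e u u') (hχ : IsTest U χ) (μ : ℝ) (c x : E) :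
    smoothing U (fun z => fderiv ℝ (expSum w a) z e) χ μ c u x =
      smoothing U (expSum w a) χ μ c u' x
        + smoothing U (expSum w a) (fun y => fderiv ℝ χ y e) μ c u x := by
  set K := expSum w a with hKdef
  have hK : ContDiff ℝ ∞ K := contDiff_expSum w a
  set p := (1 - μ) • x + μ • c with hp
  have hg : ContDiff ℝ ∞ (fun y => K (p - y)) := hK.comp (by fun_prop)
  have ht := hχ.mul_left hg
  have h := hw.2.2 _ ht.1 ht.2.1 ht.2.2
  have hd : ∀ y, fderiv ℝ (fun y => K (p - y) * χ y) y e
      = K (p - y) * fderiv ℝ χ y e - χ y * fderiv ℝ K (p - y) e := by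
    intro y
    have h1 : HasFDerivAt (fun y => K (p - y)) (-(fderiv ℝ K (p - y))) y := by
      have := ((hK.differentiable (by simp) (p - y)).hasFDerivAt.comp y
        ((hasFDerivAt_id y).const_sub p))
      refine this.congr_fderiv ?_
      ext; simp
    have h2 := (hχ.1.differentiable (by simp) y).hasFDerivAt
    have := (h1.mul h2).fderiv
    change fderiv ℝ ((fun y => K (p - y)) * χ) y e = _
    rw [this]
    simp
    ring
  simp_rw [hd] at h
  have c1 : Continuous (fderiv ℝ χ) := hχ.1.continuous_fderiv (by simp)
  have c2 : Continuous (fderiv ℝ K) := hK.continuous_fderiv (by simp)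
  have c3 := hχ.1.continuous
  have c4 := hK.continuous
  have i1 := integrable_mul_of_isBounded hUm hb hu (g := fun y => K (p - y) * fderiv ℝ χ y e)
    (by fun_prop)
  have i2 := integrable_mul_of_isBounded hUm hb hu (g := fun y => χ y * fderiv ℝ K (p - y) e)
    (by fun_prop)
  simp_rw [mul_sub] at h
  rw [integral_sub i1 i2] at h
  simp only [smoothing]
  have e1 : ∫ y in U, u y * χ y * fderiv ℝ K (p - y) e
      = ∫ y in U, u y * (χ y * fderiv ℝ K (p - y) e) := by
    congr 1; ext y; ring
  have e2 : ∫ y in U, u' y * χ y * K (p - y) = ∫ y in U, u' y * (K (p - y) * χ y) := by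
    congr 1; ext y; ring
  have e3 : ∫ y in U, u y * fderiv ℝ χ y e * K (p - y)
      = ∫ y in U, u y * (K (p - y) * fderiv ℝ χ y e) := by
    congr 1; ext y; ring
  rw [e1, e2, e3]
  linarith

/-- The system, membership in `H²` and the traces each supply their own weak derivative; uniqueness
identifies them. -/
theorem IsWeakDeriv.ae_eq [FiniteDimensional ℝ E] {U : Set E} (hU : IsOpen U) {e : E}
    {f g g' : E → ℝ} (h : IsWeakDeriv U e f g) (h' : IsWeakDeriv U e f g') :
    g =ᵐ[volume.restrict U] g' := by
  have := hU.ae_eq_zero_of_integral_contDiff_smul_eq_zero (f := fun x => g x - g' x) (μ := volume)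
    (h.2.1.sub h'.2.1) fun φ h1 h2 h3 => by
      have ht : IsTest U φ := ⟨h1, h2, h3⟩
      have e := (h.2.2 φ h1 h2 h3).symm.trans (h'.2.2 φ h1 h2 h3)
      rw [neg_inj] at e
      have hi : ∀ {k : E → ℝ}, LocallyIntegrableOn k U → Integrable (fun x => k x * φ x) := by
        intro k hk
        have h4 : IntegrableOn k (tsupport φ) := hk.integrableOn_compact_subset h3 h2
        have h5 : IntegrableOn (fun x => k x * φ x) (tsupport φ) :=
          h4.mul_continuousOn h1.continuous.continuousOn h2
        rwa [integrableOn_iff_integrable_of_support_subset] at h5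
        intro x hx
        exact subset_tsupport _ (right_ne_zero_of_mul hx)
      rw [ht.setIntegral_eq, ht.setIntegral_eq] at e
      simp only [smul_eq_mul, mul_comm (φ _), sub_mul]
      rw [integral_sub (hi h.2.1) (hi h'.2.1), e, sub_self]
  filter_upwards [(ae_restrict_iff' hU.measurableSet).2 this] with x hx
  linarith

end ExpSum

end APNN

namespace APNN

/-! ### First-order accuracy of smoothing, for functions and first derivatives -/

section SmoothingKernel

variable {E : Type*} [NormedAddCommGroup E] [NormedSpace ℝ E] [MeasureSpace E]

/-- Kernels `K` of width `δ`, together with cutoffs `χ` and homotheties with centre `c` and ratio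
`1 - m δ`, for which smoothing is accurate of order `δ` on `U`. -/
structure IsSmoothingKernel (U : Set E) (c : E) (m δ : ℝ) (K χ : E → ℝ) : Prop where
  pos : 0 < δ
  le_one : δ ≤ 1
  mul_le : m * δ ≤ 1 / 2
  isTest : IsTest U χ
  abs_le : ∀ y, |χ y| ≤ 1
  fderiv_le : ∀ y, ‖fderiv ℝ χ y‖ ≤ m / δ
  eq_one : ∀ x ∈ U, ∀ z, ‖z‖ ≤ δ → χ ((1 - m * δ) • x + (m * δ) • c - z) = 1
  nonneg : ∀ z, ‖z‖ ≤ δ → 0 ≤ K z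
  integral_eq : ∫ z in Metric.closedBall 0 δ, K z = 1
  tail : ∀ x ∈ U, ∀ y ∈ U, δ < ‖(1 - m * δ) • x + (m * δ) • c - y‖ →
    |K ((1 - m * δ) • x + (m * δ) • c - y)| ≤ δ ^ 2

theorem MemH.of_succ {U : Set E} {u : E → ℝ} (hu : MemH U 2 u) : MemH U 1 u :=
  ⟨hu.1, fun e => let ⟨g, h1, h2⟩ := hu.2 e; ⟨g, h1, h2.1⟩⟩

variable [BorelSpace E] [FiniteDimensional ℝ E] [(volume : Measure E).IsAddHaarMeasure]

theorem Continuous.memLp_of_isBounded {U : Set E} (hUm : MeasurableSet U)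
    (hb : Bornology.IsBounded U) {f : E → ℝ} (hf : Continuous f) :
    MemLp f 2 (volume.restrict U) := by
  have hfin : IsFiniteMeasure (volume.restrict U) := ⟨by
    rw [Measure.restrict_apply_univ]; exact hb.measure_lt_top⟩
  obtain ⟨C, hC⟩ := hb.isCompact_closure.exists_bound_of_continuousOn hf.continuousOn
  refine MemLp.of_bound hf.aestronglyMeasurable C ?_
  filter_upwards [ae_restrict_mem hUm] with y hy
  exact hC y (subset_closure hy)

/-- The displacement `mδ (x - c) + z` is `O(δ)` on a bounded set and the tail `δ²` is at most `δ`.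
The constant precedes the kernel, so it is uniform in the number of exponentials. -/
theorem exists_setIntegral_sub_smoothing_sq_le {U : Set E} (hU : IsOpen U) (hc : Convex ℝ U)
    (hb : Bornology.IsBounded U) (c : E) {m : ℝ} (hm : 0 ≤ m) {u : E → ℝ} (hu : MemH U 1 u) :
    ∃ C : ℝ, ∀ (J : Type) [Fintype J] (w : J → ℝ) (a : J → E →L[ℝ] ℝ) (δ : ℝ) (χ : E → ℝ),
      IsSmoothingKernel U c m δ (expSum w a) χ →
      ∫ x in U, (u x - smoothing U (expSum w a) χ (m * δ) c u x) ^ 2 ≤ C * δ ^ 2 := by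
  have hfin : IsFiniteMeasure (volume.restrict U) := ⟨by
    rw [Measure.restrict_apply_univ]; exact hb.measure_lt_top⟩
  set b := Module.finBasis ℝ E with hbdef
  choose u' hw hu' using hu.2
  obtain ⟨ρ, hρ⟩ := hb.subset_closedBall c
  set B := ∑ i, ‖(b.coord i).toContinuousLinearMap‖ with hB
  have hB0 : 0 ≤ B := Finset.sum_nonneg fun _ _ => norm_nonneg _
  have hcoord : ∀ i w, |b.coord i w| ≤ B * ‖w‖ := by
    intro i w
    refine ((b.coord i).toContinuousLinearMap.le_opNorm w).trans ?_
    gcongr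
    exact Finset.single_le_sum (f := fun i => ‖(b.coord i).toContinuousLinearMap‖)
      (fun _ _ => norm_nonneg _) (Finset.mem_univ i)
  refine ⟨(2 ^ Module.finrank ℝ E * (B * (m * max ρ 0 + 1)) *
    (∑ i, √(∫ y in U, u' (b i) y ^ 2)) + (∫ y in U, |u y|) * √(volume.real U)) ^ 2, ?_⟩
  intro J _ w a δ χ h
  have hδ := h.pos
  have hv : Integrable (fun y => u y * χ y) (volume.restrict U) :=
    (hu.1.integrable (by norm_num)).mul_bdd (c := 1) h.isTest.1.continuous.aestronglyMeasurable
      (Eventually.of_forall h.abs_le)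
  refine (setIntegral_sub_smoothing_sq_le (c := c) (δ := δ) b hU hc hu.1
    (fun i => (hu' (b i))) (fun i => hw (b i)) (by positivity) h.mul_le
    (R := B * ((m * max ρ 0 + 1) * δ)) (by positivity) (sq_nonneg δ)
    (contDiff_expSum w a).continuous h.isTest.1.continuous h.abs_le ?_ ?_ h.nonneg h.integral_eq
    h.tail ?_).trans ?_
  · intro x hx z hz
    have h1 := h.eq_one x hx z hz
    refine ⟨?_, h1⟩
    -- `χ` equals one at the displaced point and vanishes off `U`, so the point lies in `U`.
    by_contra h2
    rw [h.isTest.eq_zero h2] at h1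
    exact zero_ne_one h1
  · intro x hx z hz i
    refine (hcoord i _).trans ?_
    gcongr
    have h1 : ‖x - c‖ ≤ max ρ 0 := (mem_closedBall_iff_norm.1 (hρ hx)).trans (le_max_left _ _)
    calc ‖(m * δ) • x + (z - (m * δ) • c)‖ = ‖(m * δ) • (x - c) + z‖ := by congr 1; module
      _ ≤ m * δ * ‖x - c‖ + ‖z‖ := by
          refine (norm_add_le _ _).trans ?_
          rw [norm_smul, Real.norm_of_nonneg (by positivity)]
      _ ≤ m * δ * max ρ 0 + δ := by gcongr
      _ = _ := by ring
  · rw [smoothing_expSum w a hU.measurableSet hb hv]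
    exact Continuous.memLp_of_isBounded hU.measurableSet hb (contDiff_expSum _ _).continuous
  · rw [← mul_pow]
    have h1 : 0 ≤ ∫ y in U, |u y| := integral_nonneg fun _ => abs_nonneg _
    have h2 : 0 ≤ ∑ i, √(∫ y in U, u' (b i) y ^ 2) :=
      Finset.sum_nonneg fun _ _ => Real.sqrt_nonneg _
    have h3 : δ ^ 2 ≤ δ := by nlinarith [h.le_one]
    refine pow_le_pow_left₀ (by positivity) ?_ 2
    calc _ ≤ 2 ^ Module.finrank ℝ E * (B * ((m * max ρ 0 + 1) * δ)) *
          (∑ i, √(∫ y in U, u' (b i) y ^ 2)) + δ * (∫ y in U, |u y|) * √(volume.real U) := by gcongr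
      _ = _ := by ring

/-- The derivative of the smoothed function is `(1 - mδ)(S + Q)`, where `S` smooths `u'` and `Q`
carries the gradient of `χ`. The `H¹` estimate applies to `u'` because `u ∈ H²`. In `Q` the
gradient, of size `m / δ`, only meets the tail of the kernel, of size `δ²`, so `Q = O(δ)`; the
factor `1 - mδ` costs another `O(δ)`. -/
theorem exists_setIntegral_sub_fderiv_smoothing_sq_le {U : Set E} (hU : IsOpen U) (hc : Convex ℝ U)
    (hb : Bornology.IsBounded U) (c : E) {m : ℝ} (hm : 0 ≤ m) {u u' : E → ℝ} (hu : MemH U 2 u)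
    {e : E} (hw : IsWeakDeriv U e u u') :
    MemLp u' 2 (volume.restrict U) ∧
    ∃ C : ℝ, ∀ (J : Type) [Fintype J] (w : J → ℝ) (a : J → E →L[ℝ] ℝ) (δ : ℝ) (χ : E → ℝ),
      IsSmoothingKernel U c m δ (expSum w a) χ →
      ∫ x in U, (u' x - fderiv ℝ (smoothing U (expSum w a) χ (m * δ) c u) x e) ^ 2 ≤
        C * δ ^ 2 := by
  have hfin : IsFiniteMeasure (volume.restrict U) := ⟨by
    rw [Measure.restrict_apply_univ]; exact hb.measure_lt_top⟩
  obtain ⟨g, hg, hgH⟩ := hu.2 e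
  have hae := hw.ae_eq hU hg
  obtain ⟨C, hC⟩ := exists_setIntegral_sub_smoothing_sq_le hU hc hb c hm hgH
  have hu'2 : MemLp u' 2 (volume.restrict U) := (memLp_congr_ae hae).2 hgH.1
  have hu1 : Integrable u (volume.restrict U) := hu.1.integrable (by norm_num)
  set A := (∫ y in U, |u y|) with hA
  have hA0 : 0 ≤ A := integral_nonneg fun _ => abs_nonneg _
  refine ⟨hu'2, 9 * C + 6 * m ^ 2 * (∫ x in U, u' x ^ 2)
    + 3 * (m * ‖e‖ * A) ^ 2 * volume.real U, ?_⟩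
  intro J _ w a δ χ h
  have hδ := h.pos
  have hδ1 := h.le_one
  have h0 := h.mul_le
  have hv : ∀ {f : E → ℝ}, MemLp f 2 (volume.restrict U) →
      Integrable (fun y => f y * χ y) (volume.restrict U) := fun hf =>
    (hf.integrable (by norm_num)).mul_bdd (c := 1) h.isTest.1.continuous.aestronglyMeasurable
      (Eventually.of_forall h.abs_le)
  set S := smoothing U (expSum w a) χ (m * δ) c u' with hS
  set Q := smoothing U (expSum w a) (fun y => fderiv ℝ χ y e) (m * δ) c u with hQ
  have hSc : MemLp S 2 (volume.restrict U) := by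
    rw [hS, smoothing_expSum w a hU.measurableSet hb (hv hu'2)]
    exact Continuous.memLp_of_isBounded hU.measurableSet hb (contDiff_expSum _ _).continuous
  have hI : ∫ x in U, (u' x - S x) ^ 2 ≤ C * δ ^ 2 := by
    refine le_trans (le_of_eq ?_) (hC J w a δ χ h)
    refine integral_congr_ae ?_
    filter_upwards [hae] with x hx
    rw [hx, hS, smoothing_congr_ae hae]
  have hQb : ∀ x ∈ U, |Q x| ≤ m * ‖e‖ * A * δ := by
    intro x hx
    have : m * ‖e‖ * A * δ = ∫ y in U, (m / δ * ‖e‖ * δ ^ 2) * |u y| := by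
      rw [integral_const_mul, ← hA]; field_simp
    rw [this, hQ, smoothing, ← Real.norm_eq_abs]
    refine norm_integral_le_of_norm_le (hu1.abs.const_mul _) ?_
    filter_upwards [ae_restrict_mem hU.measurableSet] with y hy
    have hm' : 0 ≤ m / δ := by positivity
    by_cases hz : δ < ‖(1 - m * δ) • x + (m * δ) • c - y‖
    · rw [norm_mul, norm_mul, Real.norm_eq_abs (u y)]
      have h1 : ‖fderiv ℝ χ y e‖ ≤ m / δ * ‖e‖ :=
        (ContinuousLinearMap.le_opNorm _ _).trans (by gcongr; exact h.fderiv_le y)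
      calc _ ≤ |u y| * (m / δ * ‖e‖) * δ ^ 2 := by
            gcongr
            exact h.tail x hx y hy hz
        _ = _ := by ring
    · have h1 := h.eq_one x hx _ (not_lt.1 hz)
      rw [sub_sub_cancel] at h1
      -- Within distance `δ` of the contracted point, `χ` attains its maximum one, so its gradient
      -- vanishes.
      have h2 : IsLocalMax χ y := Eventually.of_forall fun t => by
        change χ t ≤ χ y
        rw [h1]; exact (abs_le.1 (h.abs_le t)).2
      rw [h2.fderiv_eq_zero]
      simp
      positivity
  have hpt : ∀ x ∈ U, (u' x - fderiv ℝ (smoothing U (expSum w a) χ (m * δ) c u) x e) ^ 2 ≤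
      9 * (u' x - S x) ^ 2 + (6 * (m * δ) ^ 2 * u' x ^ 2 + 3 * (m * ‖e‖ * A * δ) ^ 2) := by
    intro x hx
    rw [fderiv_smoothing_expSum w a hU.measurableSet hb (hv hu.1),
      smoothing_fderiv w a hU.measurableSet hb hu1 hw h.isTest]
    rw [← hS, ← hQ]
    have h1 : Q x ^ 2 ≤ (m * ‖e‖ * A * δ) ^ 2 :=
      sq_le_sq' (abs_le.1 (hQb x hx)).1 (abs_le.1 (hQb x hx)).2
    have h2 : (m * δ) ^ 2 ≤ 1 / 4 := by
      have : 0 ≤ m * δ := by positivity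
      nlinarith
    have h3 : ((1 - m * δ) * Q x) ^ 2 ≤ Q x ^ 2 := by
      rw [mul_pow]
      have : 0 ≤ m * δ := by positivity
      exact mul_le_of_le_one_left (sq_nonneg _) (by nlinarith)
    have h4 : (m * δ * S x) ^ 2 ≤ 2 * (m * δ) ^ 2 * u' x ^ 2 + 2 * (u' x - S x) ^ 2 := by
      rw [mul_pow]
      have e1 : S x ^ 2 ≤ 2 * u' x ^ 2 + 2 * (u' x - S x) ^ 2 := by
        nlinarith [sq_nonneg (2 * u' x - S x)]
      have := mul_le_mul_of_nonneg_left e1 (sq_nonneg (m * δ))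
      nlinarith [sq_nonneg (u' x - S x)]
    have h5 : ∀ p q r : ℝ, (p + q - r) ^ 2 ≤ 3 * (p ^ 2 + q ^ 2 + r ^ 2) := by
      intro p q r
      nlinarith [sq_nonneg (p - q), sq_nonneg (p + r), sq_nonneg (q + r)]
    have h6 := h5 (u' x - S x) (m * δ * S x) ((1 - m * δ) * Q x)
    calc _ = (u' x - S x + m * δ * S x - (1 - m * δ) * Q x) ^ 2 := by ring
      _ ≤ _ := by linarith
  have i1 : Integrable (fun x => 9 * (u' x - S x) ^ 2) (volume.restrict U) :=
    (hu'2.sub hSc).integrable_sq.const_mul 9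
  have i2 : Integrable (fun x => 6 * (m * δ) ^ 2 * u' x ^ 2) (volume.restrict U) :=
    hu'2.integrable_sq.const_mul _
  refine (integral_mono_of_nonneg (Eventually.of_forall fun _ => sq_nonneg _)
    (i1.add (i2.add (integrable_const _)))
    ((ae_restrict_iff' hU.measurableSet).2 (Eventually.of_forall hpt))).trans ?_
  have e0 : ∫ x in U, (9 * (u' x - S x) ^ 2 + (6 * (m * δ) ^ 2 * u' x ^ 2
      + 3 * (m * ‖e‖ * A * δ) ^ 2))
      = 9 * (∫ x in U, (u' x - S x) ^ 2) + (6 * (m * δ) ^ 2 * (∫ x in U, u' x ^ 2)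
        + 3 * (m * ‖e‖ * A * δ) ^ 2 * volume.real U) := by
    have e1 := integral_add i1 (i2.add (integrable_const (3 * (m * ‖e‖ * A * δ) ^ 2)))
    have e2 := integral_add i2 (integrable_const (μ := volume.restrict U)
      (3 * (m * ‖e‖ * A * δ) ^ 2))
    simp only [Pi.add_apply] at e1
    rw [e1, e2, integral_const_mul, integral_const_mul, integral_const,
      measureReal_restrict_apply_univ, smul_eq_mul]
    ring
  refine (le_of_eq e0).trans ?_
  calc _ ≤ 9 * (C * δ ^ 2) + (6 * (m * δ) ^ 2 * (∫ x in U, u' x ^ 2)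
        + 3 * (m * ‖e‖ * A * δ) ^ 2 * volume.real U) := by gcongr
    _ = _ := by ring

end SmoothingKernel

end APNN

namespace APNN

/-! ### Peaked kernels from Chebyshev polynomials in `cosh` -/

section Peak

/-- With `t = e^{σz}`, the product `t (A - cosh (σz))` is a quadratic polynomial `q` in `t`. Hence
`t ^ n` times the left side is a polynomial `G` of degree at most `2n` in `t`, and dividing by `t ^
n` leaves the exponents `-nσ, …, nσ`. -/
theorem exists_expSum_eq_eval_cosh (p : Polynomial ℝ) {n : ℕ} (hp : p.natDegree ≤ n) (A σ : ℝ) :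
    ∃ (w : Fin (2 * n + 1) → ℝ) (a : Fin (2 * n + 1) → ℝ →L[ℝ] ℝ),
      ∀ z, p.eval (A - Real.cosh (σ * z)) = expSum w a z := by
  open Polynomial in
  set q : ℝ[X] := C A * X - C (1 / 2) * (X ^ 2 + 1) with hq
  open Polynomial in
  set G : ℝ[X] := ∑ k ∈ Finset.range (n + 1), C (p.coeff k) * q ^ k * X ^ (n - k) with hG
  have hqd : q.natDegree ≤ 2 := by
    rw [hq]; compute_degree
  have hGd : G.natDegree < 2 * n + 1 := by
    rw [Nat.lt_succ_iff]
    refine Polynomial.natDegree_sum_le_of_forall_le _ _ fun k hk => ?_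
    have hk' : k ≤ n := Nat.lt_succ_iff.1 (Finset.mem_range.1 hk)
    refine (Polynomial.natDegree_mul_le_of_le (Polynomial.natDegree_mul_le_of_le
      (Polynomial.natDegree_C _).le (Polynomial.natDegree_pow_le_of_le k hqd))
      (Polynomial.natDegree_X_pow_le _)).trans ?_
    omega
  refine ⟨fun i => G.coeff i, fun i => ((i - n) * σ : ℝ) • ContinuousLinearMap.id ℝ ℝ, fun z => ?_⟩
  set t := Real.exp (σ * z) with ht
  have ht0 : t ≠ 0 := (Real.exp_pos _).ne'
  have hqe : q.eval t = t * (A - Real.cosh (σ * z)) := by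
    rw [Real.cosh_eq, Real.exp_neg, ← ht, hq]
    simp
    field_simp
  have hGe : G.eval t = t ^ n * p.eval (A - Real.cosh (σ * z)) := by
    rw [hG, Polynomial.eval_finsetSum, Polynomial.eval_eq_sum_range' (Nat.lt_succ_iff.2 hp),
      Finset.mul_sum]
    refine Finset.sum_congr rfl fun k hk => ?_
    have hk' : k ≤ n := Nat.lt_succ_iff.1 (Finset.mem_range.1 hk)
    simp only [Polynomial.eval_mul, Polynomial.eval_C, Polynomial.eval_pow, Polynomial.eval_X, hqe]
    rw [mul_pow]
    have : t ^ n = t ^ k * t ^ (n - k) := by rw [← pow_add]; congr 1; omega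
    rw [this]; ring
  have h1 : p.eval (A - Real.cosh (σ * z)) = (t ^ n)⁻¹ * G.eval t := by
    rw [hGe]; field_simp
  rw [h1, Polynomial.eval_eq_sum_range' hGd, Finset.mul_sum, expSum, Finset.sum_range]
  refine Finset.sum_congr rfl fun i _ => ?_
  have : Real.exp (((((i : ℕ) : ℝ) - n) * σ) * z) = t ^ (i : ℕ) * (t ^ n)⁻¹ := by
    rw [ht, ← Real.exp_nat_mul, ← Real.exp_nat_mul, ← Real.exp_neg, ← Real.exp_add]
    congr 1; ring
  simp only [smul_apply, ContinuousLinearMap.id_apply, smul_eq_mul]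
  rw [this]; ring

/-- Writing `y = cosh s`, this is `T_n(cosh s) = cosh (ns)` and the monotonicity of `cosh`. -/
theorem eval_T_mem_Icc (n : ℕ) {α β y : ℝ} (hα : 0 ≤ α) (hβ : 0 ≤ β) (h1 : Real.cosh α ≤ y)
    (h2 : y ≤ Real.cosh β) :
    (Polynomial.Chebyshev.T ℝ n).eval y ∈ Icc (Real.cosh (n * α)) (Real.cosh (n * β)) := by
  have hy : 1 ≤ y := (Real.one_le_cosh α).trans h1
  have h0 : 0 ≤ Real.arcosh y := Real.arcosh_nonneg hy
  have e : Real.cosh (Real.arcosh y) = y := Real.cosh_arcosh hy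
  have hT : (Polynomial.Chebyshev.T ℝ n).eval y = Real.cosh (n * Real.arcosh y) := by
    conv_lhs => rw [← e]
    exact_mod_cast Polynomial.Chebyshev.T_real_cosh (Real.arcosh y) n
  rw [← e, Real.cosh_le_cosh, abs_of_nonneg hα, abs_of_nonneg h0] at h1
  rw [← e, Real.cosh_le_cosh, abs_of_nonneg hβ, abs_of_nonneg h0] at h2
  rw [hT, mem_Icc, Real.cosh_le_cosh, Real.cosh_le_cosh, abs_of_nonneg (by positivity),
    abs_of_nonneg (by positivity), abs_of_nonneg (by positivity)]
  constructor <;> gcongr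

variable {E F : Type*} [NormedAddCommGroup E] [MeasureSpace E] [NormedAddCommGroup F]
  [MeasureSpace F]

/-- `k` is a nonnegative kernel of unit mass on the ball of radius `δ`, bounded by `M` on the ball
of radius `L` and by `η` outside the ball of radius `δ`. -/
structure IsPeak (δ L M η : ℝ) (k : E → ℝ) : Prop where
  nonneg : ∀ z, ‖z‖ ≤ δ → 0 ≤ k z
  integral_eq : ∫ z in Metric.closedBall 0 δ, k z = 1
  abs_le : ∀ z, ‖z‖ ≤ L → |k z| ≤ M
  tail : ∀ z, δ < ‖z‖ → ‖z‖ ≤ L → |k z| ≤ η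

/-- Put `θ = δ / L` and evaluate `T_n` at `1 + cosh θ - cosh (z / L)`. For `|z| ≤ δ` the argument
lies in `[1, cosh θ]`, where `T_n` grows like `cosh (nθ)`; for `δ < |z| ≤ L` it lies in `[-1, 1]`,
where `|T_n| ≤ 1`. With `Y = e^{nθ/4}` the height before normalization is at most `2 Y⁴` and the
mass at least `δ Y³ / 4`; dividing gives the two bounds. -/
theorem exists_isPeak_real (n : ℕ) {L δ : ℝ} (hδ : 0 < δ) (hL : δ ≤ L) :
    ∃ (w : Fin (2 * n + 1) → ℝ) (a : Fin (2 * n + 1) → ℝ →L[ℝ] ℝ),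
      IsPeak δ L (8 * Real.exp (n * (δ / L) / 4) / δ) (8 / (δ * Real.exp (n * (δ / L) / 4) ^ 3))
        (expSum w a) := by
  have hL0 : 0 < L := hδ.trans_le hL
  set θ := δ / L with hθ
  have hθ0 : 0 < θ := by positivity
  set T := Polynomial.Chebyshev.T ℝ n with hT
  set k₀ : ℝ → ℝ := fun z => T.eval (1 + Real.cosh θ - Real.cosh (L⁻¹ * z)) + 1 with hk₀
  set Y := Real.exp (n * θ / 4) with hY
  have hY1 : 1 ≤ Y := Real.one_le_exp (by positivity)
  have hk₀c : Continuous k₀ := by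
    have := Real.continuous_cosh
    exact (T.continuous.comp (by fun_prop)).add continuous_const
  have hcosh : ∀ z : ℝ, ∀ r, 0 ≤ r → (Real.cosh (L⁻¹ * z) ≤ Real.cosh (r / L) ↔ |z| ≤ r) := by
    intro z r hr
    rw [Real.cosh_le_cosh, abs_mul, abs_of_pos (inv_pos.2 hL0),
      abs_of_nonneg (show 0 ≤ r / L by positivity), inv_mul_eq_div, div_le_div_iff_of_pos_right hL0]
  have hin : ∀ z, |z| ≤ δ → k₀ z ∈ Icc 2 (2 * Y ^ 4) := by
    intro z hz
    have h1 := (hcosh z δ hδ.le).2 hz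
    have h2 := Real.one_le_cosh (L⁻¹ * z)
    have := eval_T_mem_Icc n (α := 0) (β := θ) (y := 1 + Real.cosh θ - Real.cosh (L⁻¹ * z))
      le_rfl hθ0.le (by rw [Real.cosh_zero]; linarith) (by linarith)
    rw [mul_zero, Real.cosh_zero] at this
    have h3 : Real.cosh (n * θ) ≤ Y ^ 4 := by
      rw [hY, ← Real.exp_nat_mul, Real.cosh_eq]
      have : Real.exp (-(n * θ)) ≤ Real.exp (n * θ) :=
        Real.exp_le_exp.2 (by have : 0 ≤ n * θ := by positivity
                              linarith)
      have e : ((4 : ℕ) : ℝ) * (n * θ / 4) = n * θ := by push_cast; ring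
      rw [e]; linarith
    have h4 : 1 ≤ Y ^ 4 := one_le_pow₀ hY1
    exact ⟨by linarith [this.1], by linarith [this.2]⟩
  have hout : ∀ z, δ < |z| → |z| ≤ L → |k₀ z| ≤ 2 := by
    intro z hz hz'
    have h1 : Real.cosh θ < Real.cosh (L⁻¹ * z) := not_le.1 fun h => not_le.2 hz ((hcosh z δ hδ.le).1 h)
    have h2 := (hcosh z L hL0.le).2 hz'
    rw [div_self hL0.ne'] at h2
    -- This keeps the argument of `T_n` above `-1` up to `|z| = L`, as `1 + cosh θ ≥ 2`.
    have h3 : Real.cosh 1 ≤ 3 := by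
      rw [Real.cosh_eq]
      have : Real.exp (-1) ≤ 1 := Real.exp_le_one_iff.2 (by norm_num)
      linarith [Real.exp_one_lt_d9]
    have h4 := Real.one_le_cosh θ
    have := Polynomial.Chebyshev.abs_eval_T_real_le_one n
      (x := 1 + Real.cosh θ - Real.cosh (L⁻¹ * z)) (abs_le.2 ⟨by linarith, by linarith⟩)
    have h5 := abs_le.1 this
    rw [abs_le]
    exact ⟨by linarith [h5.1], by linarith [h5.2]⟩
  have hpeak : ∀ z, |z| ≤ δ / 4 → Y ^ 3 / 2 ≤ k₀ z := by
    intro z hz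
    have h1 := (hcosh z (δ / 4) (by positivity)).2 hz
    have e4 : δ / 4 / L = θ / 4 := by rw [hθ]; ring
    rw [e4] at h1
    have h2 := Real.one_le_cosh (L⁻¹ * z)
    -- By the addition formula and `(cosh a - 1)(cosh b - 1) ≥ 0`. So on the ball of radius `δ/4`
    -- the argument is at least `cosh (3θ/4)`, whence the lower bound `Y³ / 2`.
    have h3 : Real.cosh (θ / 4) + Real.cosh (3 * θ / 4) ≤ 1 + Real.cosh θ := by
      have e : θ = θ / 4 + 3 * θ / 4 := by ring
      conv_rhs => rw [e, Real.cosh_add]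
      have a1 := Real.one_le_cosh (θ / 4)
      have a2 := Real.one_le_cosh (3 * θ / 4)
      have a3 : 0 ≤ Real.sinh (θ / 4) := Real.sinh_nonneg_iff.2 (by positivity)
      have a4 : 0 ≤ Real.sinh (3 * θ / 4) := Real.sinh_nonneg_iff.2 (by positivity)
      nlinarith [mul_nonneg a3 a4, mul_nonneg (sub_nonneg.2 a1) (sub_nonneg.2 a2)]
    have := (eval_T_mem_Icc n (α := 3 * θ / 4) (β := θ)
      (y := 1 + Real.cosh θ - Real.cosh (L⁻¹ * z)) (by positivity) hθ0.le (by linarith)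
      (by linarith)).1
    have h5 : Y ^ 3 / 2 ≤ Real.cosh (n * (3 * θ / 4)) := by
      rw [hY, ← Real.exp_nat_mul, Real.cosh_eq]
      have e : ((3 : ℕ) : ℝ) * (n * θ / 4) = n * (3 * θ / 4) := by push_cast; ring
      rw [e]
      linarith [Real.exp_pos (-(n * (3 * θ / 4)))]
    change _ ≤ T.eval _ + 1
    linarith
  set I := ∫ z in Metric.closedBall 0 δ, k₀ z with hI
  have hIle : δ * Y ^ 3 / 4 ≤ I := by
    have hi : IntegrableOn k₀ (Metric.closedBall 0 δ) :=
      hk₀c.continuousOn.integrableOn_compact (isCompact_closedBall _ _)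
    have hsub : Metric.closedBall (0 : ℝ) (δ / 4) ⊆ Metric.closedBall 0 δ :=
      Metric.closedBall_subset_closedBall (by linarith)
    have h1 : ∫ z in Metric.closedBall (0 : ℝ) (δ / 4), k₀ z ≤ I := by
      refine setIntegral_mono_set hi ?_ hsub.eventuallyLE
      filter_upwards [ae_restrict_mem Metric.isClosed_closedBall.measurableSet] with z hz
      have := (hin z (by simpa using hz)).1
      simp only [Pi.zero_apply]; linarith
    have h2 : ∫ z in Metric.closedBall (0 : ℝ) (δ / 4), Y ^ 3 / 2
        ≤ ∫ z in Metric.closedBall (0 : ℝ) (δ / 4), k₀ z := by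
      refine setIntegral_mono_on ?_ (hi.mono_set hsub) Metric.isClosed_closedBall.measurableSet ?_
      · exact continuousOn_const.integrableOn_compact (isCompact_closedBall _ _)
      · intro z hz
        exact hpeak z (by simpa using hz)
    rw [setIntegral_const, Measure.real, Real.volume_closedBall, smul_eq_mul,
      ENNReal.toReal_ofReal (by positivity)] at h2
    linarith
  have hI0 : 0 < I := lt_of_lt_of_le (by positivity) hIle
  obtain ⟨w, a, hwa⟩ := exists_expSum_eq_eval_cosh (Polynomial.C I⁻¹ * (T + 1)) (n := n)
    (by
      refine (Polynomial.natDegree_C_mul_le _ _).trans ?_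
      refine (Polynomial.natDegree_add_le _ _).trans ?_
      simp [hT, Polynomial.Chebyshev.natDegree_T]) (1 + Real.cosh θ) L⁻¹
  have hk : ∀ z, expSum w a z = I⁻¹ * k₀ z := by
    intro z
    rw [← hwa]; simp [hk₀]
  have hk' : ∀ z C, |k₀ z| ≤ C → |expSum w a z| ≤ C / (δ * Y ^ 3 / 4) := by
    intro z C hC
    rw [hk, abs_mul, abs_of_pos (inv_pos.2 hI0), inv_mul_eq_div]
    have : 0 ≤ C := (abs_nonneg _).trans hC
    gcongr
  have hin' : ∀ z, |z| ≤ δ → |k₀ z| ≤ 2 * Y ^ 4 := fun z hz => by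
    rw [abs_of_nonneg (by linarith [(hin z hz).1])]; exact (hin z hz).2
  have e2 : (2 : ℝ) / (δ * Y ^ 3 / 4) = 8 / (δ * Y ^ 3) := by field_simp; norm_num
  refine ⟨w, a, ⟨fun z hz => ?_, ?_, fun z hz => ?_, fun z hz hz' => ?_⟩⟩
  · rw [hk]
    have := (hin z hz).1
    have : 0 ≤ k₀ z := by linarith
    positivity
  · simp_rw [hk]
    rw [integral_const_mul, ← hI, inv_mul_cancel₀ hI0.ne']
  · have : |k₀ z| ≤ 2 * Y ^ 4 := by
      rcases le_or_gt |z| δ with h | h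
      · exact hin' z h
      · have h4 : 1 ≤ Y ^ 4 := one_le_pow₀ hY1
        linarith [hout z h hz]
    refine (hk' z _ this).trans (le_of_eq ?_)
    field_simp; norm_num
  · exact (hk' z _ (hout z hz hz')).trans e2.le

/-- Outside the ball of the sup norm one coordinate may be in its tail while the other is at its
peak, so the tail of the product is governed by the mixed products `η M'` and `M η'`. The sup bounds
are recorded for this purpose. -/
theorem IsPeak.prod [SFinite (volume : Measure E)] [SFinite (volume : Measure F)]
    {δ L M η M' η' τ : ℝ} {k : E → ℝ} {k' : F → ℝ}
    (h : IsPeak δ L M η k) (h' : IsPeak δ L M' η' k') (hM : 0 ≤ M) (hη : 0 ≤ η)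
    (h1 : η * M' ≤ τ) (h2 : M * η' ≤ τ) :
    IsPeak δ L (M * M') τ (fun z : E × F => k z.1 * k' z.2) := by
  have hle : ∀ {r : ℝ} {z : E × F}, ‖z‖ ≤ r ↔ ‖z.1‖ ≤ r ∧ ‖z.2‖ ≤ r := by
    intro r z; rw [Prod.norm_def, max_le_iff]
  refine ⟨fun z hz => ?_, ?_, fun z hz => ?_, fun z hz hz' => ?_⟩
  · rw [hle] at hz
    exact mul_nonneg (h.nonneg _ hz.1) (h'.nonneg _ hz.2)
  · rw [← Prod.mk_zero_zero, ← closedBall_prod_same, Measure.volume_eq_prod, setIntegral_prod_mul,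
      h.integral_eq, h'.integral_eq, one_mul]
  · rw [hle] at hz
    rw [abs_mul]
    exact mul_le_mul (h.abs_le _ hz.1) (h'.abs_le _ hz.2) (abs_nonneg _) hM
  · rw [hle] at hz'
    rw [Prod.norm_def, lt_max_iff] at hz
    rw [abs_mul]
    rcases hz with hz | hz
    · exact (mul_le_mul (h.tail _ hz hz'.1) (h'.abs_le _ hz'.2) (abs_nonneg _) hη).trans h1
    · exact (mul_le_mul (h.abs_le _ hz'.1) (h'.tail _ hz hz'.2) (abs_nonneg _) hM).trans h2

theorem expSum_mul_expSum {E F : Type*} [NormedAddCommGroup E] [NormedSpace ℝ E]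
    [NormedAddCommGroup F] [NormedSpace ℝ F] {J J' : Type*} [Fintype J] [Fintype J'] (w : J → ℝ)
    (a : J → E →L[ℝ] ℝ) (w' : J' → ℝ) (a' : J' → F →L[ℝ] ℝ) (z : E × F) :
    expSum w a z.1 * expSum w' a' z.2 =
      expSum (fun p : J × J' => w p.1 * w' p.2)
        (fun p => (a p.1).comp (ContinuousLinearMap.fst ℝ E F)
          + (a' p.2).comp (ContinuousLinearMap.snd ℝ E F)) z := by
  simp only [expSum]
  rw [Finset.sum_mul_sum, ← Finset.univ_product_univ, Finset.sum_product]
  refine Finset.sum_congr rfl fun i _ => Finset.sum_congr rfl fun j _ => ?_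
  simp [Real.exp_add]
  ring

end Peak

end APNN

namespace APNN

/-! ### Cutoff functions -/

section Cutoff

variable {E F : Type*} [NormedAddCommGroup E] [NormedSpace ℝ E] [NormedAddCommGroup F]
  [NormedSpace ℝ F]

/-- `χ ∈ C_c^∞(U)` equals one near the image of `U` under the homothety with centre `c` and ratio
`1 - m δ`, and its gradient is bounded by `D / δ`. -/
structure IsCutoff (U : Set E) (c : E) (m δ D : ℝ) (χ : E → ℝ) : Prop where
  isTest : IsTest U χ
  abs_le : ∀ y, |χ y| ≤ 1
  fderiv_le : ∀ y, ‖fderiv ℝ χ y‖ ≤ D / δ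
  eq_one : ∀ x ∈ U, ∀ z, ‖z‖ ≤ δ → χ ((1 - m * δ) • x + (m * δ) • c - z) = 1

theorem exists_abs_deriv_smoothTransition_le : ∃ S, ∀ x, |deriv Real.smoothTransition x| ≤ S := by
  have hc : Continuous (deriv Real.smoothTransition) :=
    (Real.smoothTransition.contDiff (n := 1)).continuous_deriv le_rfl
  obtain ⟨S, hS⟩ := (isCompact_Icc (a := (0 : ℝ)) (b := 1)).exists_bound_of_continuousOn
    hc.continuousOn
  refine ⟨max S 0, fun x => ?_⟩
  by_cases hx : x ∈ Icc (0 : ℝ) 1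
  · exact (hS x hx).trans (le_max_left _ _)
  · have : deriv Real.smoothTransition x = 0 := by
      rw [mem_Icc, not_and_or, not_le, not_le] at hx
      rcases hx with hx | hx
      · have : Real.smoothTransition =ᶠ[𝓝 x] fun _ => 0 := by
          filter_upwards [Iio_mem_nhds hx] with y hy
          exact Real.smoothTransition.zero_of_nonpos (le_of_lt hy)
        rw [this.deriv_eq]; simp
      · have : Real.smoothTransition =ᶠ[𝓝 x] fun _ => 1 := by
          filter_upwards [Ioi_mem_nhds hx] with y hy
          exact Real.smoothTransition.one_of_one_le (le_of_lt hy)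
        rw [this.deriv_eq]; simp
    rw [this, abs_zero]
    exact le_max_right _ _

/-- The cutoff rises from zero to one between the distances `δ/2` and `δ` from the end points. Since
`m (b - a) ≥ 4`, the contraction moves every point at least `2δ` away from the ends, which leaves
`δ` after the displacement by `z`. Each of the two transitions has slope at most `2S / δ`, hence `D
= 4S`. -/
theorem exists_isCutoff_Ioo {a b : ℝ} (hab : a < b) :
    ∃ D m₀ : ℝ, 0 ≤ D ∧ ∀ m δ, m₀ ≤ m → 0 < δ → m * δ ≤ 1 / 2 →
      ∃ χ : ℝ → ℝ, IsCutoff (Ioo a b) ((a + b) / 2) m δ D χ := by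
  obtain ⟨S, hS⟩ := exists_abs_deriv_smoothTransition_le
  have hS0 : 0 ≤ S := (abs_nonneg _).trans (hS 0)
  refine ⟨4 * S, 4 / (b - a), by positivity, fun m δ hm hδ hmδ => ?_⟩
  have hba : 0 < b - a := sub_pos.2 hab
  have hm' : 4 ≤ m * (b - a) := (div_le_iff₀ hba).1 hm
  let f : ℝ → ℝ := fun y => Real.smoothTransition (2 / δ * (y - a) - 1)
  let g : ℝ → ℝ := fun y => Real.smoothTransition (2 / δ * (b - y) - 1)
  have hS1 : ∀ x, |Real.smoothTransition x| ≤ 1 := fun x => by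
    rw [abs_of_nonneg (Real.smoothTransition.nonneg x)]; exact Real.smoothTransition.le_one x
  have hfs : ContDiff ℝ ∞ f := Real.smoothTransition.contDiff.comp (by fun_prop)
  have hgs : ContDiff ℝ ∞ g := Real.smoothTransition.contDiff.comp (by fun_prop)
  have hsupp : tsupport (fun y => f y * g y) ⊆ Icc (a + δ / 2) (b - δ / 2) := by
    refine closure_minimal (fun y hy => ?_) isClosed_Icc
    by_contra h
    refine hy ?_
    rw [mem_Icc, not_and_or, not_le, not_le] at h
    rcases h with h | h
    · have : f y = 0 := Real.smoothTransition.zero_of_nonpos (by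
        rw [sub_nonpos, div_mul_eq_mul_div, div_le_one hδ]; linarith)
      simp [this]
    · have : g y = 0 := Real.smoothTransition.zero_of_nonpos (by
        rw [sub_nonpos, div_mul_eq_mul_div, div_le_one hδ]; linarith)
      simp [this]
  have hS' : ∀ x, HasDerivAt Real.smoothTransition (deriv Real.smoothTransition x) x := fun x =>
    ((Real.smoothTransition.contDiff (n := 1)).differentiable (by simp) x).hasDerivAt
  refine ⟨fun y => f y * g y, ⟨hfs.mul hgs, ?_, ?_⟩, fun y => ?_, fun y => ?_, fun x hx z hz => ?_⟩
  · exact HasCompactSupport.of_support_subset_isCompact isCompact_Icc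
      ((subset_tsupport _).trans hsupp)
  · exact hsupp.trans fun y hy => ⟨by linarith [hy.1], by linarith [hy.2]⟩
  · rw [abs_mul]
    exact mul_le_one₀ (hS1 _) (abs_nonneg _) (hS1 _)
  · have h1 : HasDerivAt f (deriv Real.smoothTransition (2 / δ * (y - a) - 1) * (2 / δ)) y := by
      have := (hS' _).comp y ((((hasDerivAt_id y).sub_const a).const_mul (2 / δ)).sub_const 1)
      exact this.congr_deriv (by simp)
    have h2 : HasDerivAt g (deriv Real.smoothTransition (2 / δ * (b - y) - 1) * (-(2 / δ))) y := by
      have := (hS' _).comp y ((((hasDerivAt_id y).const_sub b).const_mul (2 / δ)).sub_const 1)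
      exact this.congr_deriv (by simp)
    rw [← norm_deriv_eq_norm_fderiv, (h1.fun_mul h2).deriv]
    refine (norm_add_le _ _).trans ?_
    simp only [norm_mul, norm_neg, Real.norm_eq_abs]
    have h3 : |2 / δ| = 2 / δ := abs_of_pos (by positivity)
    rw [h3]
    calc _ ≤ S * (2 / δ) * 1 + 1 * (S * (2 / δ)) := by
          gcongr
          · exact hS _
          · exact hS1 _
          · exact hS1 _
          · exact hS _
      _ = _ := by ring
  · have hz' := abs_le.1 hz
    simp only [smul_eq_mul]
    set y := (1 - m * δ) * x + m * δ * ((a + b) / 2) - z with hy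
    have k1 : 4 * δ ≤ m * δ * (b - a) := by nlinarith
    have h1 : a + δ ≤ y := by
      have : a - x ≤ 0 := by linarith [hx.1]
      have : (1 - m * δ) * a ≤ (1 - m * δ) * x :=
        mul_le_mul_of_nonneg_left hx.1.le (by linarith)
      nlinarith
    have h2 : y ≤ b - δ := by
      have : (1 - m * δ) * x ≤ (1 - m * δ) * b :=
        mul_le_mul_of_nonneg_left hx.2.le (by linarith)
      nlinarith
    have e1 : f y = 1 := Real.smoothTransition.one_of_one_le (by
      rw [le_sub_iff_add_le, div_mul_eq_mul_div, le_div_iff₀ hδ]; linarith)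
    have e2 : g y = 1 := Real.smoothTransition.one_of_one_le (by
      rw [le_sub_iff_add_le, div_mul_eq_mul_div, le_div_iff₀ hδ]; linarith)
    rw [e1, e2, one_mul]

theorem IsTest.prod {U : Set E} {V : Set F} {χ : E → ℝ} {χ' : F → ℝ} (h : IsTest U χ)
    (h' : IsTest V χ') : IsTest (U ×ˢ V) (fun y : E × F => χ y.1 * χ' y.2) := by
  have hs : tsupport (fun y : E × F => χ y.1 * χ' y.2) ⊆ tsupport χ ×ˢ tsupport χ' := by
    refine closure_minimal (fun y hy => ?_) ((isClosed_tsupport _).prod (isClosed_tsupport _))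
    exact ⟨subset_tsupport _ (left_ne_zero_of_mul hy), subset_tsupport _ (right_ne_zero_of_mul hy)⟩
  refine ⟨(h.1.comp contDiff_fst).mul (h'.1.comp contDiff_snd), ?_,
    hs.trans (prod_mono h.2.2 h'.2.2)⟩
  exact HasCompactSupport.of_support_subset_isCompact (h.2.1.isCompact.prod h'.2.1.isCompact)
    ((subset_tsupport _).trans hs)

theorem IsCutoff.prod {U : Set E} {V : Set F} {c : E} {c' : F} {m δ D D' : ℝ} {χ : E → ℝ}
    {χ' : F → ℝ} (h : IsCutoff U c m δ D χ) (h' : IsCutoff V c' m δ D' χ') :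
    IsCutoff (U ×ˢ V) (c, c') m δ (D + D') (fun y : E × F => χ y.1 * χ' y.2) := by
  refine ⟨h.isTest.prod h'.isTest, fun y => ?_, fun y => ?_, fun x hx z hz => ?_⟩
  · rw [abs_mul]
    exact mul_le_one₀ (h.abs_le _) (abs_nonneg _) (h'.abs_le _)
  · have h1 : HasFDerivAt (fun y : E × F => χ y.1)
        ((fderiv ℝ χ y.1).comp (ContinuousLinearMap.fst ℝ E F)) y :=
      ((h.isTest.1.differentiable (by simp) y.1).hasFDerivAt).comp y hasFDerivAt_fst
    have h2 : HasFDerivAt (fun y : E × F => χ' y.2)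
        ((fderiv ℝ χ' y.2).comp (ContinuousLinearMap.snd ℝ E F)) y :=
      ((h'.isTest.1.differentiable (by simp) y.2).hasFDerivAt).comp y hasFDerivAt_snd
    rw [(h1.fun_mul h2).fderiv]
    refine (norm_add_le _ _).trans ?_
    rw [norm_smul, norm_smul]
    have n1 : ‖(fderiv ℝ χ y.1).comp (ContinuousLinearMap.fst ℝ E F)‖ ≤ D / δ :=
      (ContinuousLinearMap.opNorm_comp_le _ _).trans
        ((mul_le_of_le_one_right (norm_nonneg _) (ContinuousLinearMap.norm_fst_le _ _ _)).trans
          (h.fderiv_le _))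
    have n2 : ‖(fderiv ℝ χ' y.2).comp (ContinuousLinearMap.snd ℝ E F)‖ ≤ D' / δ :=
      (ContinuousLinearMap.opNorm_comp_le _ _).trans
        ((mul_le_of_le_one_right (norm_nonneg _) (ContinuousLinearMap.norm_snd_le _ _ _)).trans
          (h'.fderiv_le _))
    have m1 := mul_le_mul (h.abs_le y.1) n2 (norm_nonneg _) zero_le_one
    have m2 := mul_le_mul (h'.abs_le y.2) n1 (norm_nonneg _) zero_le_one
    rw [Real.norm_eq_abs, Real.norm_eq_abs]
    rw [add_div]
    linarith
  · rw [Prod.norm_def, max_le_iff] at hz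
    have h1 := h.eq_one x.1 hx.1 z.1 hz.1
    have h2 := h'.eq_one x.2 hx.2 z.2 hz.2
    change χ ((1 - m * δ) • x.1 + (m * δ) • c - z.1) * χ' ((1 - m * δ) • x.2 + (m * δ) • c' - z.2) = 1
    rw [h1, h2, one_mul]

variable [MeasureSpace E] 

/-- A contracted point stays in `U`, so its difference from `y ∈ U` has norm at most `L`, and the
tail bound of the peak, valid only up to radius `L`, suffices. -/
theorem IsCutoff.isSmoothingKernel {U : Set E} {c : E} {m δ D L M τ : ℝ} {K χ : E → ℝ}
    (h : IsCutoff U c m δ D χ) (hK : IsPeak δ L M τ K) (hδ : 0 < δ) (hδ1 : δ ≤ 1)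
    (hm : m * δ ≤ 1 / 2) (hD : D ≤ m) (hτ : τ ≤ δ ^ 2) (hL : ∀ x ∈ U, ∀ y ∈ U, ‖x - y‖ ≤ L) :
    IsSmoothingKernel U c m δ K χ := by
  refine ⟨hδ, hδ1, hm, h.isTest, h.abs_le, fun y => ?_, h.eq_one, hK.nonneg, hK.integral_eq, ?_⟩
  · exact (h.fderiv_le y).trans (by gcongr)
  · intro x hx y hy hxy
    refine (hK.tail _ hxy (hL _ ?_ _ hy)).trans hτ
    have := h.eq_one x hx 0 (by simpa using hδ.le)
    rw [sub_zero] at this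
    by_contra hn
    rw [h.isTest.eq_zero hn] at this
    exact zero_ne_one this

end Cutoff

/-! ### The width `δ ~ log N / N` -/

section Rate

/-- The width of the kernel made of exponentials of degree at most `N`. -/
noncomputable def width (L : ℝ) (N : ℕ) : ℝ := L * (20 * Real.log N / N)

theorem tendsto_width (L : ℝ) : Tendsto (width L) atTop (𝓝 0) := by
  have h : Tendsto (fun N : ℕ => Real.log N / (N : ℝ)) atTop (𝓝 0) := by
    have := (Real.isLittleO_log_id_atTop.tendsto_div_nhds_zero).comp tendsto_natCast_atTop_atTop
    exact this
  have := (h.const_mul 20).const_mul L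
  simp only [mul_zero] at this
  refine this.congr fun N => ?_
  rw [width]; ring

/-- The factor 20 in `width` makes `Y = e^{Nθ/4}` equal to `N⁵`. Then `η M² = 512 / (δ³ N⁵)`, which
is below `δ²` as soon as `(δN)⁵ ≥ 512`; here `δN ≥ 20`. The square of `M` serves threefold products,
where two coordinates may be at their peak. -/
theorem exists_isPeak_width {L : ℝ} (hL : 1 ≤ L) {N : ℕ} (hN : 3 ≤ N) (hw : width L N ≤ 1) :
    ∃ (w : Fin (2 * N + 1) → ℝ) (a : Fin (2 * N + 1) → ℝ →L[ℝ] ℝ) (M η : ℝ), 1 ≤ M ∧ 0 ≤ η ∧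
      η * M ^ 2 ≤ width L N ^ 2 ∧
      IsPeak (width L N) L M η (expSum w a) := by
  set δ := width L N with hδ
  have hN0 : (0 : ℝ) < N := by positivity
  have hlog : 1 ≤ Real.log N := by
    rw [Real.le_log_iff_exp_le hN0]
    have : (3 : ℝ) ≤ N := by exact_mod_cast hN
    linarith [Real.exp_one_lt_d9]
  have hδN : 20 ≤ δ * N := by
    have : δ * N = 20 * (L * Real.log N) := by rw [hδ, width]; field_simp
    rw [this]
    nlinarith
  have hδ0 : 0 < δ := by
    by_contra h
    nlinarith
  obtain ⟨w, a, h⟩ := exists_isPeak_real N hδ0 (hw.trans hL)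
  have hY : Real.exp (N * (δ / L) / 4) = (N : ℝ) ^ 5 := by
    have e : N * (δ / L) / 4 = (5 : ℕ) * Real.log N := by
      rw [hδ, width]; push_cast; field_simp; norm_num
    rw [e, Real.exp_nat_mul, Real.exp_log hN0]
  rw [hY] at h
  have hN1 : (1 : ℝ) ≤ N ^ 5 := one_le_pow₀ (by exact_mod_cast (by omega : 1 ≤ N))
  refine ⟨w, a, _, _, ?_, by positivity, ?_, h⟩
  · rw [le_div_iff₀ hδ0]; linarith
  · have h5 : (20 : ℝ) ^ 5 ≤ (δ * N) ^ 5 := pow_le_pow_left₀ (by norm_num) hδN 5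
    have e : 8 / (δ * ((N : ℝ) ^ 5) ^ 3) * (8 * (N : ℝ) ^ 5 / δ) ^ 2 = 512 / (δ ^ 3 * N ^ 5) := by
      field_simp; norm_num
    rw [e, div_le_iff₀ (by positivity)]
    calc (512 : ℝ) ≤ 20 ^ 5 := by norm_num
      _ ≤ (δ * N) ^ 5 := h5
      _ = _ := by ring

end Rate

end APNN

namespace APNN

/-! ### Smoothing kernels on boxes in two and three dimensions -/

section Box

theorem norm_sub_le_of_mem_Ioo {a b x y : ℝ} (hx : x ∈ Ioo a b) (hy : y ∈ Ioo a b) :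
    ‖x - y‖ ≤ b - a := by
  rw [Real.norm_eq_abs, abs_le]
  constructor <;> linarith [hx.1, hx.2, hy.1, hy.2]

theorem eventually_width {L m : ℝ} (hL : 1 ≤ L) :
    ∀ᶠ N : ℕ in atTop, 3 ≤ N ∧ 0 < width L N ∧ width L N ≤ 1 ∧ m * width L N ≤ 1 / 2 := by
  have h1 : Tendsto (fun N => m * width L N) atTop (𝓝 0) := by
    simpa using (tendsto_width L).const_mul m
  filter_upwards [eventually_ge_atTop 3, (tendsto_width L).eventually_le_const one_pos,
    h1.eventually_le_const (by norm_num : (0 : ℝ) < 1 / 2)] with N h3 h4 h5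
  refine ⟨h3, ?_, h4, h5⟩
  have : (1 : ℝ) < N := by exact_mod_cast (by omega : 1 < N)
  have := Real.log_pos this
  unfold width
  positivity

theorem exists_isSmoothingKernel₂ {a b a' b' : ℝ} (h : a < b) (h' : a' < b') :
    ∃ (c : ℝ × ℝ) (m L : ℝ), 0 ≤ m ∧ ∀ᶠ N : ℕ in atTop,
      ∃ (w : Fin (2 * N + 1) × Fin (2 * N + 1) → ℝ)
        (A : Fin (2 * N + 1) × Fin (2 * N + 1) → ℝ × ℝ →L[ℝ] ℝ) (χ : ℝ × ℝ → ℝ),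
        IsSmoothingKernel (Ioo a b ×ˢ Ioo a' b') c m (width L N) (expSum w A) χ := by
  obtain ⟨D, m₀, hD, H⟩ := exists_isCutoff_Ioo h
  obtain ⟨D', m₀', hD', H'⟩ := exists_isCutoff_Ioo h'
  set m := max (max m₀ m₀') (D + D') with hm
  set L := max 1 (max (b - a) (b' - a')) with hLdef
  have hL : 1 ≤ L := le_max_left _ _
  have hm0 : 0 ≤ m := (add_nonneg hD hD').trans (le_max_right _ _)
  refine ⟨((a + b) / 2, (a' + b') / 2), m, L, hm0, ?_⟩
  filter_upwards [eventually_width (m := m) hL] with N hN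
  obtain ⟨hN3, hδ0, hδ1, hmδ⟩ := hN
  obtain ⟨w, A, M, η, hM, hη, hηM, hP⟩ := exists_isPeak_width hL hN3 hδ1
  obtain ⟨χ, hχ⟩ := H m _ ((le_max_left _ _).trans (le_max_left _ _)) hδ0 hmδ
  obtain ⟨χ', hχ'⟩ := H' m _ ((le_max_right _ _).trans (le_max_left _ _)) hδ0 hmδ
  have hle : η * M ≤ width L N ^ 2 := by nlinarith [mul_nonneg hη (by linarith : 0 ≤ M)]
  have hPP := hP.prod hP (by linarith) hη hle ((mul_comm _ _).trans_le hle)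
  simp_rw [expSum_mul_expSum] at hPP
  refine ⟨_, _, _, (hχ.prod hχ').isSmoothingKernel hPP hδ0 hδ1 hmδ (le_max_right _ _) le_rfl ?_⟩
  intro x hx y hy
  rw [Prod.norm_def, max_le_iff]
  exact ⟨(norm_sub_le_of_mem_Ioo hx.1 hy.1).trans ((le_max_left _ _).trans (le_max_right _ _)),
    (norm_sub_le_of_mem_Ioo hx.2 hy.2).trans ((le_max_right _ _).trans (le_max_right _ _))⟩

theorem exists_isSmoothingKernel₃ {a b a' b' a'' b'' : ℝ} (h : a < b) (h' : a' < b')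
    (h'' : a'' < b'') :
    ∃ (c : ℝ × ℝ × ℝ) (m L : ℝ), 0 ≤ m ∧ ∀ᶠ N : ℕ in atTop,
      ∃ (w : Fin (2 * N + 1) × Fin (2 * N + 1) × Fin (2 * N + 1) → ℝ)
        (A : Fin (2 * N + 1) × Fin (2 * N + 1) × Fin (2 * N + 1) → ℝ × ℝ × ℝ →L[ℝ] ℝ)
        (χ : ℝ × ℝ × ℝ → ℝ),
        IsSmoothingKernel (Ioo a b ×ˢ Ioo a' b' ×ˢ Ioo a'' b'') c m (width L N) (expSum w A) χ := by
  obtain ⟨D, m₀, hD, H⟩ := exists_isCutoff_Ioo h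
  obtain ⟨D', m₀', hD', H'⟩ := exists_isCutoff_Ioo h'
  obtain ⟨D'', m₀'', hD'', H''⟩ := exists_isCutoff_Ioo h''
  set m := max (max m₀ (max m₀' m₀'')) (D + (D' + D'')) with hm
  set L := max 1 (max (b - a) (max (b' - a') (b'' - a''))) with hLdef
  have hL : 1 ≤ L := le_max_left _ _
  have hm0 : 0 ≤ m := (add_nonneg hD (add_nonneg hD' hD'')).trans (le_max_right _ _)
  refine ⟨((a + b) / 2, (a' + b') / 2, (a'' + b'') / 2), m, L, hm0, ?_⟩
  filter_upwards [eventually_width (m := m) hL] with N hN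
  obtain ⟨hN3, hδ0, hδ1, hmδ⟩ := hN
  obtain ⟨w, A, M, η, hM, hη, hηM, hP⟩ := exists_isPeak_width hL hN3 hδ1
  obtain ⟨χ, hχ⟩ := H m _ (by simp [hm]) hδ0 hmδ
  obtain ⟨χ', hχ'⟩ := H' m _ (by simp [hm]) hδ0 hmδ
  obtain ⟨χ'', hχ''⟩ := H'' m _ (by simp [hm]) hδ0 hmδ
  have hPP := hP.prod hP (τ := η * M) (by linarith) hη le_rfl (mul_comm _ _).le
  -- The mixed products are `η · M²` and `M · (η M)`, both equal to `η M²`.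
  have hPPP := hP.prod hPP (τ := width L N ^ 2) (by linarith) hη (by rwa [← sq])
    (by rwa [mul_left_comm, ← sq])
  simp_rw [expSum_mul_expSum] at hPPP
  refine ⟨_, _, _, (hχ.prod (hχ'.prod hχ'')).isSmoothingKernel hPPP hδ0 hδ1 hmδ
    (le_max_right _ _) le_rfl ?_⟩
  intro x hx y hy
  rw [Prod.norm_def, max_le_iff, Prod.norm_def, max_le_iff]
  exact ⟨(norm_sub_le_of_mem_Ioo hx.1 hy.1).trans (by simp [hLdef]),
    (norm_sub_le_of_mem_Ioo hx.2.1 hy.2.1).trans (by simp [hLdef]),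
    (norm_sub_le_of_mem_Ioo hx.2.2 hy.2.2).trans (by simp [hLdef])⟩

variable {E : Type*} [NormedAddCommGroup E] [NormedSpace ℝ E] [MeasureSpace E] [BorelSpace E]
  [FiniteDimensional ℝ E] [(volume : Measure E).IsAddHaarMeasure]

theorem exists_expSum_approx {U : Set E} (hU : IsOpen U) (hc : Convex ℝ U)
    (hb : Bornology.IsBounded U) {c : E} {m L : ℝ} (hm : 0 ≤ m) {J : ℕ → Type}
    [∀ N, Fintype (J N)] (hK : ∀ᶠ N in atTop, ∃ (w : J N → ℝ) (A : J N → E →L[ℝ] ℝ) (χ : E → ℝ),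
      IsSmoothingKernel U c m (width L N) (expSum w A) χ)
    {u u₁ u₂ : E → ℝ} (hu : MemH U 2 u) {e₁ e₂ : E} (h₁ : IsWeakDeriv U e₁ u u₁)
    (h₂ : IsWeakDeriv U e₂ u u₂) :
    MemLp u₁ 2 (volume.restrict U) ∧ MemLp u₂ 2 (volume.restrict U) ∧
    ∃ C : ℝ, ∀ᶠ N in atTop, ∃ (w : J N → ℝ) (A : J N → E →L[ℝ] ℝ),
      ∫ x in U, (u x - expSum w A x) ^ 2 ≤ C * width L N ^ 2 ∧
      ∫ x in U, (u₁ x - fderiv ℝ (expSum w A) x e₁) ^ 2 ≤ C * width L N ^ 2 ∧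
      ∫ x in U, (u₂ x - fderiv ℝ (expSum w A) x e₂) ^ 2 ≤ C * width L N ^ 2 := by
  obtain ⟨C₀, hC₀⟩ := exists_setIntegral_sub_smoothing_sq_le hU hc hb c hm hu.of_succ
  obtain ⟨hL₁, C₁, hC₁⟩ := exists_setIntegral_sub_fderiv_smoothing_sq_le hU hc hb c hm hu h₁
  obtain ⟨hL₂, C₂, hC₂⟩ := exists_setIntegral_sub_fderiv_smoothing_sq_le hU hc hb c hm hu h₂
  have hfin : IsFiniteMeasure (volume.restrict U) := ⟨by
    rw [Measure.restrict_apply_univ]; exact hb.measure_lt_top⟩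
  refine ⟨hL₁, hL₂, max C₀ (max C₁ C₂), ?_⟩
  filter_upwards [hK] with N ⟨w, A, χ, h⟩
  have hv : Integrable (fun y => u y * χ y) (volume.restrict U) :=
    (hu.1.integrable (by norm_num)).mul_bdd (c := 1) h.isTest.1.continuous.aestronglyMeasurable
      (Eventually.of_forall h.abs_le)
  obtain ⟨w', A', e⟩ : ∃ w' A', smoothing U (expSum w A) χ (m * width L N) c u =
      expSum (J := J N) w' A' := ⟨_, _, smoothing_expSum w A hU.measurableSet hb hv _ c⟩
  refine ⟨w', A', ?_, ?_, ?_⟩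
  · rw [← e]
    refine (hC₀ _ w A _ χ h).trans ?_
    gcongr
    exact le_max_left _ _
  · rw [← e]
    refine (hC₁ _ w A _ χ h).trans ?_
    gcongr
    exact (le_max_left _ _).trans (le_max_right _ _)
  · rw [← e]
    refine (hC₂ _ w A _ χ h).trans ?_
    gcongr
    exact (le_max_right _ _).trans (le_max_right _ _)

end Box

end APNN

namespace APNN

/-! ### Tanh networks converging to sums of exponentials -/

section Network

theorem hasDerivAt_tanh (x : ℝ) : HasDerivAt Real.tanh ((Real.cosh x ^ 2)⁻¹) x := by
  have h := (Real.hasDerivAt_sinh x).fun_div (Real.hasDerivAt_cosh x) (Real.cosh_pos x).ne'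
  have e : Real.tanh = fun x => Real.sinh x / Real.cosh x := by
    ext x; rw [Real.tanh_eq_sinh_div_cosh]
  rw [e]
  refine h.congr_deriv ?_
  have := Real.cosh_sq x
  have h0 := (Real.cosh_pos x).ne'
  field_simp
  linarith

theorem continuous_dslope_tanh : Continuous (dslope Real.tanh 0) := by
  have hd : Differentiable ℝ Real.tanh := fun x => (hasDerivAt_tanh x).differentiableAt
  rw [← continuousOn_univ, continuousOn_dslope univ_mem]
  exact ⟨hd.continuous.continuousOn, hd 0⟩

/-- Expressing `tanh (hz) / h` through `dslope` extends it continuously to `h = 0`, with value `z`.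
The limit network is then the member `h = 0` of a continuous family. -/
theorem tanh_mul_eq (h z : ℝ) : Real.tanh (h * z) = h * z * dslope Real.tanh 0 (h * z) := by
  have := sub_smul_dslope Real.tanh 0 (h * z)
  simp only [sub_zero, Real.tanh_zero, smul_eq_mul] at this
  exact this.symm

/-- A far shift into the left tail of `tanh`, rescaled, turns one neuron into an approximate
exponential: the right side tends to `e^s` as `h → 0`. -/
theorem one_add_tanh_eq {h : ℝ} (hh : 0 < h) (s : ℝ) :
    (1 + Real.tanh (s / 2 + Real.log h / 2)) / (2 * h) = Real.exp s / (1 + h * Real.exp s) := by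
  set p := Real.exp (s / 2) with hp
  set q := Real.exp (Real.log h / 2) with hq
  have hp0 : 0 < p := Real.exp_pos _
  have hq0 : 0 < q := Real.exp_pos _
  have e1 : Real.exp s = p ^ 2 := by rw [hp, ← Real.exp_nat_mul]; congr 1; push_cast; ring
  have e2 : h = q ^ 2 := by
    rw [hq, ← Real.exp_nat_mul]; push_cast
    rw [mul_div_cancel₀ _ (two_ne_zero), Real.exp_log hh]
  rw [Real.tanh_eq, Real.exp_neg, Real.exp_add, ← hp, ← hq, e1, e2]
  field_simp
  ring

variable {d m : ℕ}

/-- The values realized by `expNet` with parameter `h`. -/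
noncomputable def netFun (w : Fin m → ℝ) (A : Fin m → Fin d → ℝ) (h : ℝ) (z : Fin d → ℝ) : ℝ :=
  ∑ j, w j * (Real.exp (∑ i, A j i * (z i * dslope Real.tanh 0 (h * z i))) /
    (1 + h * Real.exp (∑ i, A j i * (z i * dslope Real.tanh 0 (h * z i)))))

/-- The derivative of `netFun`. -/
noncomputable def netDeriv (w : Fin m → ℝ) (A : Fin m → Fin d → ℝ) (h : ℝ) (z : Fin d → ℝ) :
    (Fin d → ℝ) →L[ℝ] ℝ :=
  ∑ j, (w j * (Real.exp (∑ i, A j i * (z i * dslope Real.tanh 0 (h * z i))) /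
    (1 + h * Real.exp (∑ i, A j i * (z i * dslope Real.tanh 0 (h * z i)))) ^ 2)) •
    ∑ i, (A j i * (Real.cosh (h * z i) ^ 2)⁻¹) • ContinuousLinearMap.proj i

theorem hasFDerivAt_netFun (w : Fin m → ℝ) (A : Fin m → Fin d → ℝ) {h : ℝ} (hh : 0 ≤ h)
    (z : Fin d → ℝ) : HasFDerivAt (netFun w A h) (netDeriv w A h z) z := by
  have h1 : ∀ i, HasFDerivAt (fun z : Fin d → ℝ => z i * dslope Real.tanh 0 (h * z i))
      ((Real.cosh (h * z i) ^ 2)⁻¹ • (ContinuousLinearMap.proj i : (Fin d → ℝ) →L[ℝ] ℝ)) z := by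
    intro i
    rcases hh.eq_or_lt with rfl | hh
    -- At `h = 0` the inner function is the coordinate `z i` itself; for `h > 0` it is `h⁻¹ tanh (h
    -- z i)`.
    · have : dslope Real.tanh 0 0 = 1 := by
        rw [dslope_same, (hasDerivAt_tanh 0).deriv]; simp
      simp only [zero_mul, this, mul_one, Real.cosh_zero, one_pow, inv_one, one_smul]
      exact (ContinuousLinearMap.proj (R := ℝ) (φ := fun _ : Fin d => ℝ) i).hasFDerivAt
    · have e : (fun z : Fin d → ℝ => z i * dslope Real.tanh 0 (h * z i))
          = fun z => h⁻¹ * Real.tanh (h * z i) := by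
        ext z; rw [tanh_mul_eq]; field_simp
      rw [e]
      have hp : HasFDerivAt (fun z : Fin d → ℝ => h * z i)
          (h • (ContinuousLinearMap.proj i : (Fin d → ℝ) →L[ℝ] ℝ)) z :=
        ((ContinuousLinearMap.proj (R := ℝ) (φ := fun _ : Fin d => ℝ) i).hasFDerivAt).const_mul h
      have := ((hasDerivAt_tanh (h * z i)).comp_hasFDerivAt z hp).const_mul h⁻¹
      refine this.congr_fderiv ?_
      rw [smul_smul, smul_smul]
      congr 1
      field_simp
  unfold netFun netDeriv
  refine HasFDerivAt.fun_sum fun j _ => ?_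
  have h2 : HasFDerivAt (fun z : Fin d → ℝ => ∑ i, A j i * (z i * dslope Real.tanh 0 (h * z i)))
      (∑ i, (A j i * (Real.cosh (h * z i) ^ 2)⁻¹) •
        (ContinuousLinearMap.proj i : (Fin d → ℝ) →L[ℝ] ℝ)) z := by
    refine HasFDerivAt.fun_sum fun i _ => ?_
    refine ((h1 i).const_mul (A j i)).congr_fderiv ?_
    rw [smul_smul]
  set s := ∑ i, A j i * (z i * dslope Real.tanh 0 (h * z i)) with hs
  have hpos : 0 < 1 + h * Real.exp s := by positivity
  have h3 : HasDerivAt (fun s => Real.exp s / (1 + h * Real.exp s))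
      (Real.exp s / (1 + h * Real.exp s) ^ 2) s := by
    refine ((Real.hasDerivAt_exp s).fun_div (((Real.hasDerivAt_exp s).const_mul h).const_add 1)
      hpos.ne').congr_deriv ?_
    congr 1
    ring
  refine ((h3.comp_hasFDerivAt z h2).const_mul (w j)).congr_fderiv ?_
  rw [smul_smul]

theorem continuousAt_netFun (w : Fin m → ℝ) (A : Fin m → Fin d → ℝ) {h : ℝ} (hh : 0 ≤ h)
    (z : Fin d → ℝ) : ContinuousAt (fun p : ℝ × (Fin d → ℝ) => netFun w A p.1 p.2) (h, z) := by
  have h1 := continuous_dslope_tanh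
  unfold netFun
  have h2 : ∀ j, 1 + h * Real.exp (∑ i, A j i * (z i * dslope Real.tanh 0 (h * z i))) ≠ 0 := by
    intro j; positivity
  refine tendsto_finsetSum _ fun j _ => ?_
  refine ContinuousAt.mul continuousAt_const (ContinuousAt.div ?_ ?_ (h2 j)) <;>
  exact Continuous.continuousAt (by fun_prop)

theorem continuousAt_netDeriv (w : Fin m → ℝ) (A : Fin m → Fin d → ℝ) {h : ℝ} (hh : 0 ≤ h)
    (z : Fin d → ℝ) : ContinuousAt (fun p : ℝ × (Fin d → ℝ) => netDeriv w A p.1 p.2) (h, z) := by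
  have h1 := continuous_dslope_tanh
  unfold netDeriv
  have h2 : ∀ j, (1 + h * Real.exp (∑ i, A j i * (z i * dslope Real.tanh 0 (h * z i)))) ^ 2 ≠ 0 := by
    intro j; positivity
  have h3 : ∀ x : ℝ, Real.cosh x ^ 2 ≠ 0 := fun x => by have := Real.cosh_pos x; positivity
  have h4 := Real.continuous_cosh
  have h5 : ∀ i, Continuous (fun p : ℝ × (Fin d → ℝ) => (Real.cosh (p.1 * p.2 i) ^ 2)⁻¹) :=
    fun i => Continuous.inv₀ (by fun_prop) fun _ => h3 _
  have h6 : ∀ j, Continuous (fun p : ℝ × (Fin d → ℝ) =>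
      ∑ i, (A j i * (Real.cosh (p.1 * p.2 i) ^ 2)⁻¹) •
        (ContinuousLinearMap.proj i : (Fin d → ℝ) →L[ℝ] ℝ)) := fun j =>
    continuous_finsetSum _ fun i _ => (continuous_const.mul (h5 i)).smul continuous_const
  have h7 : ∀ j, ContinuousAt (fun p : ℝ × (Fin d → ℝ) =>
      w j * (Real.exp (∑ i, A j i * (p.2 i * dslope Real.tanh 0 (p.1 * p.2 i))) /
        (1 + p.1 * Real.exp (∑ i, A j i * (p.2 i * dslope Real.tanh 0 (p.1 * p.2 i)))) ^ 2))
      (h, z) := fun j =>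
    continuousAt_const.mul (ContinuousAt.div (Continuous.continuousAt (by fun_prop))
      (Continuous.continuousAt (by fun_prop)) (h2 j))
  exact tendsto_finsetSum _ fun j _ => (h7 j).smul (h6 j).continuousAt

/-- A network realizing `netFun w A h` for `h > 0`. -/
noncomputable def expNet {m₁ : ℕ} (hd : d ≤ m₁) (w : Fin m → ℝ) (A : Fin m → Fin d → ℝ) (h : ℝ) :
    TanhNet d m₁ m where
  W₁ := fun k i => if k = Fin.castLE hd i then h else 0
  b₁ := 0
  W₂ := fun j => Function.extend (Fin.castLE hd) (fun i => A j i / (2 * h)) 0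
  b₂ := fun _ => Real.log h / 2
  W₃ := fun j => w j / (2 * h)
  b₃ := ∑ j, w j / (2 * h)

theorem eval_expNet {m₁ : ℕ} (hd : d ≤ m₁) (w : Fin m → ℝ) (A : Fin m → Fin d → ℝ) {h : ℝ}
    (hh : 0 < h) : (expNet hd w A h).eval = netFun w A h := by
  ext z
  have hinj := Fin.castLE_injective hd
  have h1 : ∀ i, (expNet hd w A h).hidden₁ z (Fin.castLE hd i) = Real.tanh (h * z i) := by
    intro i
    simp [TanhNet.hidden₁, expNet]
  have h2 : ∀ j, ∑ k, (expNet hd w A h).W₂ j k * (expNet hd w A h).hidden₁ z k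
      = (∑ i, A j i * (z i * dslope Real.tanh 0 (h * z i))) / 2 := by
    intro j
    rw [Finset.sum_div]
    symm
    refine Fintype.sum_of_injective _ hinj _ _ ?_ ?_
    · intro k hk
      have : (expNet hd w A h).W₂ j k = 0 :=
        Function.extend_apply' (fun i => A j i / (2 * h)) (0 : Fin m₁ → ℝ) k hk
      rw [this, zero_mul]
    · intro i
      rw [h1, tanh_mul_eq]
      have : (expNet hd w A h).W₂ j (Fin.castLE hd i) = A j i / (2 * h) :=
        hinj.extend_apply (fun i => A j i / (2 * h)) (0 : Fin m₁ → ℝ) i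
      rw [this]
      field_simp
  unfold TanhNet.eval netFun
  change (∑ j, w j / (2 * h) * Real.tanh ((∑ k, (expNet hd w A h).W₂ j k *
    (expNet hd w A h).hidden₁ z k) + Real.log h / 2)) + ∑ j, w j / (2 * h) = _
  rw [← Finset.sum_add_distrib]
  refine Finset.sum_congr rfl fun j _ => ?_
  rw [h2, ← one_add_tanh_eq hh]
  ring

variable {E : Type*} [NormedAddCommGroup E] [NormedSpace ℝ E]

/-- At `h = 0` the family `netFun` is the exponential sum. Values and derivatives are jointly
continuous at `h = 0`, so compactness of `K` yields one small `h > 0` that works on all of `K`. One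
first-layer neuron per variable and one second-layer neuron per exponential suffice. -/
theorem exists_tanhNet_approx (ℓ : E ≃L[ℝ] (Fin d → ℝ)) {m₁ : ℕ} (hd : d ≤ m₁) {J : Type*}
    [Fintype J] (hJ : Fintype.card J ≤ m) (w : J → ℝ) (a : J → E →L[ℝ] ℝ) {K : Set E}
    (hK : IsCompact K) {ε : ℝ} (hε : 0 < ε) :
    ∃ n : TanhNet d m₁ m, ∀ x ∈ K, |n.eval (ℓ x) - expSum w a x| ≤ ε ∧
      ‖fderiv ℝ (fun y => n.eval (ℓ y)) x - fderiv ℝ (expSum w a) x‖ ≤ ε := by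
  let ι : J → Fin m := Fin.castLE hJ ∘ Fintype.equivFin J
  have hι : Function.Injective ι := (Fin.castLE_injective hJ).comp (Fintype.equivFin J).injective
  -- Surplus neurons of the second layer receive output weight zero.
  let w' : Fin m → ℝ := Function.extend ι w 0
  let A' : Fin m → Fin d → ℝ := Function.extend ι
    (fun j i => a j (ℓ.symm (Pi.single i 1))) 0
  have hsum : ∀ x, netFun w' A' 0 (ℓ x) = expSum w a x := by
    intro x
    have h0 : dslope Real.tanh 0 0 = 1 := by
      rw [dslope_same, (hasDerivAt_tanh 0).deriv]; simp
    unfold netFun expSum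
    simp only [zero_mul, h0, mul_one, add_zero, div_one]
    symm
    refine Fintype.sum_of_injective ι hι _ _ ?_ ?_
    · intro k hk
      have : w' k = 0 := Function.extend_apply' _ _ _ hk
      rw [this, zero_mul]
    · intro j
      have e1 : w' (ι j) = w j := hι.extend_apply _ _ _
      have e2 : A' (ι j) = fun i => a j (ℓ.symm (Pi.single i 1)) := hι.extend_apply _ _ _
      rw [e1, e2]
      congr 2
      have e3 : x = ∑ i, (ℓ x i) • ℓ.symm (Pi.single i 1) := by
        apply ℓ.injective
        rw [map_sum]
        simp only [map_smul, ContinuousLinearEquiv.apply_symm_apply]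
        ext k
        simp [Finset.sum_apply, Pi.single_apply]
      conv_lhs => rw [e3]
      rw [map_sum]
      refine Finset.sum_congr rfl fun i _ => ?_
      rw [map_smul, smul_eq_mul, mul_comm]
  have hder : ∀ h, 0 ≤ h → ∀ x, HasFDerivAt (fun y => netFun w' A' h (ℓ y))
      ((netDeriv w' A' h (ℓ x)).comp (ℓ : E →L[ℝ] (Fin d → ℝ))) x := fun h hh x =>
    (hasFDerivAt_netFun w' A' hh (ℓ x)).comp x ℓ.hasFDerivAt
  have hK' : IsCompact (ℓ '' K) := hK.image ℓ.continuous
  have ev1 : ∀ᶠ h in 𝓝 (0 : ℝ), ∀ z ∈ ℓ '' K, |netFun w' A' h z - netFun w' A' 0 z| < ε := by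
    refine hK'.eventually_forall_of_forall_eventually fun z _ => ?_
    have c1 := continuousAt_netFun w' A' le_rfl z
    have c2 : ContinuousAt (fun p : ℝ × (Fin d → ℝ) => netFun w' A' 0 p.2) (0, z) :=
      (hasFDerivAt_netFun w' A' le_rfl z).continuousAt.comp_of_eq continuousAt_snd rfl
    have : Tendsto (fun p : ℝ × (Fin d → ℝ) => |netFun w' A' p.1 p.2 - netFun w' A' 0 p.2|)
      (𝓝 (0, z)) (𝓝 |netFun w' A' 0 z - netFun w' A' 0 z|) := (c1.sub c2).abs
    rw [sub_self, abs_zero] at this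
    exact this.eventually_lt_const hε
  have ev2 : ∀ᶠ h in 𝓝 (0 : ℝ), ∀ z ∈ ℓ '' K, ‖netDeriv w' A' h z - netDeriv w' A' 0 z‖ <
      ε / (‖(ℓ : E →L[ℝ] (Fin d → ℝ))‖ + 1) := by
    refine hK'.eventually_forall_of_forall_eventually fun z _ => ?_
    have c1 := continuousAt_netDeriv w' A' le_rfl z
    have c2 : ContinuousAt (fun p : ℝ × (Fin d → ℝ) => netDeriv w' A' 0 p.2) (0, z) := by
      have : ContinuousAt (fun z => netDeriv w' A' 0 z) z :=
        c1.comp_of_eq (f := fun z => ((0 : ℝ), z)) (by fun_prop) rfl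
      exact this.comp_of_eq continuousAt_snd rfl
    have : Tendsto (fun p : ℝ × (Fin d → ℝ) => ‖netDeriv w' A' p.1 p.2 - netDeriv w' A' 0 p.2‖)
      (𝓝 (0, z)) (𝓝 ‖netDeriv w' A' 0 z - netDeriv w' A' 0 z‖) := (c1.sub c2).norm
    rw [sub_self, norm_zero] at this
    exact this.eventually_lt_const (by positivity)
  obtain ⟨h, ⟨h1, h2⟩, hpos⟩ := (((ev1.and ev2).filter_mono nhdsWithin_le_nhds).and
    (self_mem_nhdsWithin : Ioi (0 : ℝ) ∈ 𝓝[>] 0)).exists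
  refine ⟨expNet hd w' A' h, fun x hx => ?_⟩
  have hx' : ℓ x ∈ ℓ '' K := mem_image_of_mem _ hx
  rw [eval_expNet hd w' A' hpos]
  have e0 : expSum w a = fun x => netFun w' A' 0 (ℓ x) := by ext x; rw [hsum]
  rw [e0, (hder h (le_of_lt hpos) x).fderiv, (hder 0 le_rfl x).fderiv]
  refine ⟨(h1 _ hx').le, ?_⟩
  rw [← ContinuousLinearMap.sub_comp]
  refine (ContinuousLinearMap.opNorm_comp_le _ _).trans ?_
  have h3 := (h2 _ hx').le
  rw [le_div_iff₀ (by positivity)] at h3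
  refine le_trans ?_ h3
  gcongr
  linarith

theorem contDiff_eval {m₁ m₂ : ℕ} (n : TanhNet d m₁ m₂) : ContDiff ℝ ∞ n.eval := by
  have ht : ContDiff ℝ ∞ Real.tanh := by
    have e : Real.tanh = fun x => Real.sinh x / Real.cosh x := by
      ext x; rw [Real.tanh_eq_sinh_div_cosh]
    rw [e]
    exact Real.contDiff_sinh.div Real.contDiff_cosh fun x => (Real.cosh_pos x).ne'
  unfold TanhNet.eval TanhNet.hidden₂ TanhNet.hidden₁
  fun_prop

end Network

end APNN

namespace APNN

/-! ### The approximation rate for networks in the Sobolev error -/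

section NetworkRate

variable {E : Type*} [NormedAddCommGroup E] [NormedSpace ℝ E] [MeasureSpace E]

/-- The squared `L²(U)` errors of `f` and of two of its directional derivatives, as approximations
of `u`, `u₁`, `u₂`. -/
noncomputable def sobolevError (U : Set E) (e₁ e₂ : E) (u u₁ u₂ f : E → ℝ) : ℝ :=
  (∫ x in U, (u x - f x) ^ 2) + ((∫ x in U, (u₁ x - fderiv ℝ f x e₁) ^ 2)
    + ∫ x in U, (u₂ x - fderiv ℝ f x e₂) ^ 2)

theorem le_sobolevError (U : Set E) (e₁ e₂ : E) (u u₁ u₂ f : E → ℝ) :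
    (∫ x in U, (u x - f x) ^ 2) ≤ sobolevError U e₁ e₂ u u₁ u₂ f ∧
    (∫ x in U, (u₁ x - fderiv ℝ f x e₁) ^ 2) ≤ sobolevError U e₁ e₂ u u₁ u₂ f ∧
    (∫ x in U, (u₂ x - fderiv ℝ f x e₂) ^ 2) ≤ sobolevError U e₁ e₂ u u₁ u₂ f := by
  have h0 : 0 ≤ ∫ x in U, (u x - f x) ^ 2 := integral_nonneg fun _ => sq_nonneg _
  have h1 : 0 ≤ ∫ x in U, (u₁ x - fderiv ℝ f x e₁) ^ 2 := integral_nonneg fun _ => sq_nonneg _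
  have h2 : 0 ≤ ∫ x in U, (u₂ x - fderiv ℝ f x e₂) ^ 2 := integral_nonneg fun _ => sq_nonneg _
  unfold sobolevError
  refine ⟨?_, ?_, ?_⟩ <;> linarith

variable [BorelSpace E] [FiniteDimensional ℝ E] [(volume : Measure E).IsAddHaarMeasure]

theorem setIntegral_sub_sq_le_of_abs_sub_le {U : Set E} (hUm : MeasurableSet U)
    (hb : Bornology.IsBounded U) {u f g : E → ℝ} (hu : MemLp u 2 (volume.restrict U))
    (hf : Continuous f) {ε : ℝ} (h : ∀ x ∈ U, |g x - f x| ≤ ε) :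
    ∫ x in U, (u x - g x) ^ 2 ≤ 2 * (∫ x in U, (u x - f x) ^ 2) + 2 * ε ^ 2 * volume.real U := by
  have hfin : IsFiniteMeasure (volume.restrict U) := ⟨by
    rw [Measure.restrict_apply_univ]; exact hb.measure_lt_top⟩
  have i1 := ((hu.sub (Continuous.memLp_of_isBounded hUm hb hf)).integrable_sq).const_mul 2
  have i2 : Integrable (fun _ => 2 * ε ^ 2) (volume.restrict U) := integrable_const _
  refine (integral_mono_of_nonneg (Eventually.of_forall fun _ => sq_nonneg _) (i1.add i2)
    ((ae_restrict_iff' hUm).2 (Eventually.of_forall fun x hx => ?_))).trans (le_of_eq ?_)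
  · have h1 : (g x - f x) ^ 2 ≤ ε ^ 2 := sq_le_sq' (abs_le.1 (h x hx)).1 (abs_le.1 (h x hx)).2
    simp only [Pi.add_apply, Pi.sub_apply]
    nlinarith [sq_nonneg ((u x - f x) + (g x - f x))]
  · have := integral_add i1 i2
    simp only [Pi.add_apply] at this ⊢
    rw [this, integral_const_mul, integral_const, measureReal_restrict_apply_univ, smul_eq_mul]
    simp only [Pi.sub_apply]
    ring

theorem exists_tanhNet_sobolevError_le {U : Set E} (hU : IsOpen U) (hc : Convex ℝ U)
    (hb : Bornology.IsBounded U) {c : E} {m L : ℝ} (hm : 0 ≤ m) {J : ℕ → Type}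
    [∀ N, Fintype (J N)] (hK : ∀ᶠ N in atTop, ∃ (w : J N → ℝ) (A : J N → E →L[ℝ] ℝ) (χ : E → ℝ),
      IsSmoothingKernel U c m (width L N) (expSum w A) χ)
    {d : ℕ} (ℓ : E ≃L[ℝ] (Fin d → ℝ)) {m₁ m₂ : ℕ → ℕ} (hm₁ : ∀ᶠ N in atTop, d ≤ m₁ N)
    (hm₂ : ∀ᶠ N in atTop, Fintype.card (J N) ≤ m₂ N)
    {u u₁ u₂ : E → ℝ} (hu : MemH U 2 u) {e₁ e₂ : E} (h₁ : IsWeakDeriv U e₁ u u₁)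
    (h₂ : IsWeakDeriv U e₂ u u₂) :
    MemLp u₁ 2 (volume.restrict U) ∧ MemLp u₂ 2 (volume.restrict U) ∧
    ∃ C : ℝ, ∀ᶠ N in atTop, ∃ n : TanhNet d (m₁ N) (m₂ N),
      sobolevError U e₁ e₂ u u₁ u₂ (fun x => n.eval (ℓ x)) ≤ C * width L N ^ 2 := by
  obtain ⟨hL₁, hL₂, C, hC⟩ := exists_expSum_approx hU hc hb hm hK hu h₁ h₂
  refine ⟨hL₁, hL₂, 6 * C + 2 * (1 + ‖e₁‖ ^ 2 + ‖e₂‖ ^ 2) * volume.real U, ?_⟩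
  filter_upwards [hC, hK, hm₁, hm₂] with N ⟨w, A, hC₀, hC₁, hC₂⟩ ⟨_, _, _, hk⟩ hd hJ
  -- The tolerance is `width L N` itself, so passing to the network preserves the order of the
  -- error.
  obtain ⟨n, hn⟩ := exists_tanhNet_approx ℓ hd hJ w A hb.isCompact_closure hk.pos
  refine ⟨n, ?_⟩
  have hE := contDiff_expSum w A
  have hE' : Continuous (fderiv ℝ (expSum w A)) := hE.continuous_fderiv (by simp)
  have k0 := setIntegral_sub_sq_le_of_abs_sub_le hU.measurableSet hb hu.1 hE.continuous
    fun x hx => (hn x (subset_closure hx)).1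
  have hder : ∀ e : E, ∀ x ∈ U, |fderiv ℝ (fun y => n.eval (ℓ y)) x e - fderiv ℝ (expSum w A) x e|
      ≤ width L N * ‖e‖ := by
    intro e x hx
    rw [← sub_apply, ← Real.norm_eq_abs]
    refine (ContinuousLinearMap.le_opNorm _ _).trans ?_
    gcongr
    exact (hn x (subset_closure hx)).2
  have k1 := setIntegral_sub_sq_le_of_abs_sub_le hU.measurableSet hb hL₁
    (f := fun x => fderiv ℝ (expSum w A) x e₁) (by fun_prop) (hder e₁)
  have k2 := setIntegral_sub_sq_le_of_abs_sub_le hU.measurableSet hb hL₂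
    (f := fun x => fderiv ℝ (expSum w A) x e₂) (by fun_prop) (hder e₂)
  unfold sobolevError
  rw [mul_pow] at k1 k2
  linarith

end NetworkRate

end APNN

namespace APNN

/-! ### The trace inequality on a flat face -/

section Trace

variable {E F : Type*} [NormedAddCommGroup E] [NormedSpace ℝ E] [MeasureSpace E]

theorem IsWeakDeriv.smul {U : Set E} {e : E} {f g : E → ℝ} (h : IsWeakDeriv U e f g) (σ : ℝ) :
    IsWeakDeriv U (σ • e) f (fun x => σ * g x) := by
  refine ⟨h.1, h.2.1.smul σ, fun φ h1 h2 h3 => ?_⟩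
  have := h.2.2 φ h1 h2 h3
  simp only [map_smul, smul_eq_mul, mul_left_comm _ σ, mul_assoc σ]
  rw [integral_const_mul, integral_const_mul, this]
  ring

variable [BorelSpace E] [NormedAddCommGroup F] [NormedSpace ℝ F] [MeasureSpace F] [BorelSpace F]
  [FiniteDimensional ℝ F] [(volume : Measure F).IsAddHaarMeasure]

theorem setIntegral_comp_snd_eq (e : E ≃L[ℝ] ℝ × F) (he : MeasurePreserving e volume volume)
    {S : Set F} {α β : ℝ} (hαβ : α < β) (k : F → ℝ) :
    ∫ z in e ⁻¹' (Ioo α β ×ˢ S), k (e z).2 = (β - α) * ∫ y in S, k y := by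
  rw [he.setIntegral_preimage_emb e.toHomeomorph.measurableEmbedding (fun p => k p.2),
    Measure.volume_eq_prod]
  have := setIntegral_prod_mul (μ := volume) (ν := volume) (fun _ : ℝ => (1 : ℝ)) k (Ioo α β) S
  simp only [one_mul] at this
  rw [this]
  simp [hαβ.le]

theorem setIntegral_fderiv_eq (e : E ≃L[ℝ] ℝ × F) (he : MeasurePreserving e volume volume)
    {S : Set F} {α β : ℝ} (hαβ : α < β) {e₁ : E} (he₁ : e e₁ = (1, 0))
    {G : E → ℝ} (hG : ContDiff ℝ ∞ G) (hGs : HasCompactSupport G) :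
    ∫ z in e ⁻¹' (Ioo α β ×ˢ S), fderiv ℝ G z e₁ =
      ∫ y in S, (G (e.symm (β, y)) - G (e.symm (α, y))) := by
  have hc : Continuous (fderiv ℝ G) := hG.continuous_fderiv (by simp)
  have h0 := he.setIntegral_preimage_emb e.toHomeomorph.measurableEmbedding
    (fun p => fderiv ℝ G (e.symm p) e₁) (Ioo α β ×ˢ S)
  simp only [ContinuousLinearEquiv.symm_apply_apply] at h0
  have hi : Integrable (fun p : ℝ × F => fderiv ℝ G (e.symm p) e₁)
      (volume.restrict (Ioo α β ×ˢ S)) := by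
    refine Integrable.restrict ?_
    refine Continuous.integrable_of_hasCompactSupport (by fun_prop) ?_
    have h1 : HasCompactSupport (fun z => fderiv ℝ G z e₁) := hGs.fderiv_apply (𝕜 := ℝ) e₁
    exact h1.comp_homeomorph e.symm.toHomeomorph
  rw [h0]
  rw [Measure.volume_eq_prod, ← Measure.prod_restrict] at hi ⊢
  rw [integral_prod_symm _ hi]
  congr 1
  ext y
  rw [← integral_Ioc_eq_integral_Ioo, ← intervalIntegral.integral_of_le hαβ.le]
  have hd : ∀ s : ℝ, HasDerivAt (fun s => G (e.symm (s, y))) (fderiv ℝ G (e.symm (s, y)) e₁) s := by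
    intro s
    have h1 : HasDerivAt (fun s : ℝ => e.symm (s, y)) e₁ s := by
      have h2 : HasDerivAt (fun s : ℝ => (s, y)) ((1 : ℝ), (0 : F)) s :=
        (hasDerivAt_id s).prodMk (hasDerivAt_const s y)
      have := (e.symm : ℝ × F →L[ℝ] E).hasFDerivAt.comp_hasDerivAt s h2
      have e2 : e.symm ((1 : ℝ), (0 : F)) = e₁ := by rw [← he₁, e.symm_apply_apply]
      exact this.congr_deriv e2
    exact (hG.differentiable (by simp) _).hasFDerivAt.comp_hasDerivAt s h1
  exact intervalIntegral.integral_eq_sub_of_hasDerivAt (fun s _ => hd s)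
    (Continuous.intervalIntegrable (by fun_prop) _ _)

variable [FiniteDimensional ℝ E] [(volume : Measure E).IsAddHaarMeasure]

/-- The map `e` straightens `U` so that the first coordinate is normal to the face. A test function
`ψ` on the face is extended inwards as `η(s - s₀) ψ(y)`. Subtracting Green's formula for `u`, which
is the definition of the trace, from the one for the smooth `f` expresses the pairing with `ψ`
through interior errors; Cauchy–Schwarz and duality on `S` conclude. -/
theorem exists_setIntegral_trace_sub_sq_le (e : E ≃L[ℝ] ℝ × F)
    (he : MeasurePreserving e volume volume)
    {S : Set F} (hS : IsOpen S) (hSb : Bornology.IsBounded S) {α β : ℝ} (hαβ : α < β)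
    {U : Set E} (hU : U = e ⁻¹' (Ioo α β ×ˢ S)) {e₁ : E} (he₁ : e e₁ = (1, 0)) {σ s₀ : ℝ}
    (hσ : (σ = -1 ∧ s₀ = α) ∨ (σ = 1 ∧ s₀ = β)) {γ : F → E} (hγ : ∀ y, e (γ y) = (s₀, y)) :
    ∃ C : ℝ, 0 ≤ C ∧ ∀ {u u₁ : E → ℝ} {g : F → ℝ}, MemLp u 2 (volume.restrict U) →
      MemLp u₁ 2 (volume.restrict U) → IsWeakDeriv U e₁ u u₁ → IsTrace U (σ • e₁) γ S u g →
      ∀ {f : E → ℝ}, ContDiff ℝ ∞ f →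
      MemLp (fun y => f (γ y) - g y) 2 (volume.restrict S) ∧
      ∫ y in S, (f (γ y) - g y) ^ 2 ≤
        C * ((∫ x in U, (u x - f x) ^ 2) + ∫ x in U, (u₁ x - fderiv ℝ f x e₁) ^ 2) := by
  have hba : 0 < β - α := sub_pos.2 hαβ
  -- The outer radius is below `β - α`, so the bump centred at one face vanishes at the opposite
  -- one.
  let η : ContDiffBump (0 : ℝ) := ⟨(β - α) / 3, (β - α) / 2, by positivity, by linarith⟩
  have hηc : ContDiff ℝ ∞ η := η.contDiff
  obtain ⟨B, hB⟩ := (hηc.continuous_deriv (by simp)).bounded_above_of_compact_support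
    (η.hasCompactSupport.deriv)
  have hB0 : 0 ≤ B := (norm_nonneg _).trans (hB 0)
  have hσ1 : |σ| = 1 := by rcases hσ with h | h <;> simp [h.1]
  have hUo : IsOpen U := by rw [hU]; exact (isOpen_Ioo.prod hS).preimage e.continuous
  have hUb : Bornology.IsBounded U := by
    rw [hU]
    have := (e.symm : ℝ × F →L[ℝ] E).lipschitz.isBounded_image ((Metric.isBounded_Ioo α β).prod hSb)
    refine this.subset fun z hz => ⟨e z, hz, by simp⟩
  refine ⟨2 * (B + 1) ^ 2 * (β - α), by positivity, fun {u u₁ g} hu hu₁ hw htr {f} hf => ?_⟩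
  obtain ⟨hg, u', hu', hgreen⟩ := htr
  have hγc : Continuous γ := by
    have : γ = fun y => e.symm (s₀, y) := by
      ext y; rw [← hγ, e.symm_apply_apply]
    rw [this]; fun_prop
  have hfc := hf.continuous
  have hfg : MemLp (fun y => f (γ y) - g y) 2 (volume.restrict S) :=
    (Continuous.memLp_of_isBounded hS.measurableSet hSb (hfc.comp hγc)).sub hg
  have hae : u' =ᵐ[volume.restrict U] fun x => σ * u₁ x := hu'.ae_eq hUo (hw.smul σ)
  have hcf : Continuous (fderiv ℝ f) := hf.continuous_fderiv (by simp)
  have m1 : MemLp (fun x => u x - f x) 2 (volume.restrict U) :=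
    hu.sub (Continuous.memLp_of_isBounded hUo.measurableSet hUb hfc)
  have m2 : MemLp (fun x => u₁ x - fderiv ℝ f x e₁) 2 (volume.restrict U) :=
    hu₁.sub (Continuous.memLp_of_isBounded hUo.measurableSet hUb (by fun_prop))
  set a := √(∫ x in U, (u x - f x) ^ 2) with ha
  set b := √(∫ x in U, (u₁ x - fderiv ℝ f x e₁) ^ 2) with hb
  refine ⟨hfg, ?_⟩
  have key : ∀ ψ, IsTest S ψ → ∫ y in S, (f (γ y) - g y) * ψ y
      ≤ (√(β - α) * ((B + 1) * (a + b))) * √(∫ y in S, ψ y ^ 2) := by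
    intro ψ hψ
    set φ : E → ℝ := fun z => η ((e z).1 - s₀) * ψ (e z).2 with hφ
    have hφc : ContDiff ℝ ∞ φ := by
      have h1 := hψ.1
      have h2 : ContDiff ℝ ∞ e := e.contDiff
      exact (hηc.comp (by fun_prop)).mul (h1.comp (by fun_prop))
    have hts : tsupport φ ⊆ e ⁻¹' (Metric.closedBall s₀ ((β - α) / 2) ×ˢ tsupport ψ) := by
      refine closure_minimal (fun z hz => ?_)
        ((Metric.isClosed_closedBall.prod (isClosed_tsupport _)).preimage e.continuous)
      refine ⟨?_, subset_tsupport _ (right_ne_zero_of_mul hz)⟩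
      have h1 : (e z).1 - s₀ ∈ Function.support η := left_ne_zero_of_mul hz
      rw [η.support_eq, mem_ball_zero_iff] at h1
      rw [mem_closedBall_iff_norm]
      exact h1.le
    have hφs : HasCompactSupport φ := by
      refine HasCompactSupport.of_support_subset_isCompact
        (K := e ⁻¹' (Metric.closedBall s₀ ((β - α) / 2) ×ˢ tsupport ψ)) ?_
        ((subset_tsupport _).trans hts)
      exact e.toHomeomorph.isCompact_preimage.2
        ((isCompact_closedBall _ _).prod hψ.2.1.isCompact)
    -- The support of `ψ` inside the open set `S` excludes the lateral boundary, and the bump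
    -- excludes the opposite face.
    have hfr : tsupport φ ∩ frontier U ⊆ γ '' S := by
      rintro z ⟨hz1, hz2⟩
      have h1 := hts hz1
      have h3 : (e z).2 ∈ S := hψ.2.2 h1.2
      have hz3 : e z ∈ frontier (Ioo α β ×ˢ S) := by
        have := e.toHomeomorph.preimage_frontier (Ioo α β ×ˢ S)
        rw [hU] at hz2
        change z ∈ frontier (e.toHomeomorph ⁻¹' (Ioo α β ×ˢ S)) at hz2
        rw [← this] at hz2
        exact hz2
      rw [frontier_prod_eq, frontier_Ioo hαβ, hS.frontier_eq] at hz3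
      rcases hz3 with hz3 | hz3
      · exact absurd h3 hz3.2.2
      · have h4 := hz3.1
        have h5 := abs_le.1 (mem_closedBall_iff_norm.1 h1.1)
        have h6 : (e z).1 = s₀ := by
          rcases h4 with h4 | h4 <;> rcases hσ with h | h
          · rw [h4, h.2]
          · rw [h4, h.2] at h5; linarith [h5.1]
          · rw [mem_singleton_iff] at h4; rw [h4, h.2] at h5; linarith [h5.2]
          · rw [mem_singleton_iff] at h4; rw [h4, h.2]
        refine ⟨(e z).2, h3, e.injective ?_⟩
        rw [hγ, ← h6]
    have hφγ : ∀ y, φ (γ y) = ψ y := by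
      intro y
      simp only [hφ, hγ, sub_self]
      rw [η.one_of_mem_closedBall (by simpa using η.rIn_pos.le), one_mul]
    have hcφ : Continuous (fderiv ℝ φ) := hφc.continuous_fderiv (by simp)
    have hφcc := hφc.continuous
    have g1 := hgreen φ hφc hφs hfr
    simp only [hφγ] at g1
    have g2 : ∫ y in S, f (γ y) * ψ y
        = ∫ z in U, (f z * fderiv ℝ φ z (σ • e₁) + (σ * fderiv ℝ f z e₁) * φ z) := by
      have h1 := setIntegral_fderiv_eq e he (S := S) hαβ he₁ (hf.mul hφc) (hφs.mul_left)
      rw [← hU] at h1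
      have h2 : ∀ z, f z * fderiv ℝ φ z (σ • e₁) + (σ * fderiv ℝ f z e₁) * φ z
          = σ * fderiv ℝ (fun y => f y * φ y) z e₁ := by
        intro z
        have := ((hf.differentiable (by simp) z).hasFDerivAt.fun_mul
          (hφc.differentiable (by simp) z).hasFDerivAt).fderiv
        rw [this]
        simp
        ring
      simp_rw [h2]
      rw [integral_const_mul, h1, ← integral_const_mul]
      have hsym : ∀ s y, φ (e.symm (s, y)) = η (s - s₀) * ψ y := by
        intro s y; simp [hφ]
      have hγs : ∀ y, γ y = e.symm (s₀, y) := fun y => by rw [← hγ, e.symm_apply_apply]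
      have hfar : ∀ s, β - α ≤ |s - s₀| → η (s - s₀) = 0 := by
        intro s hs
        refine η.zero_of_le_dist ?_
        rw [dist_zero_right, Real.norm_eq_abs]
        change (β - α) / 2 ≤ _
        linarith
      have h00 : η (s₀ - s₀) = 1 := by
        rw [sub_self, η.one_of_mem_closedBall (by simpa using η.rIn_pos.le)]
      congr 1
      ext y
      rw [hsym, hsym, hγs]
      rcases hσ with ⟨rfl, rfl⟩ | ⟨rfl, rfl⟩
      · rw [h00, hfar β (le_abs_self _)]; ring
      · rw [h00, hfar α (by rw [abs_sub_comm]; exact le_abs_self _)]; ring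
    have mφ : MemLp φ 2 (volume.restrict U) :=
      (hφcc.memLp_of_hasCompactSupport hφs).restrict U
    have mφ' : MemLp (fun z => fderiv ℝ φ z (σ • e₁)) 2 (volume.restrict U) :=
      Continuous.memLp_of_isBounded hUo.measurableSet hUb (by fun_prop)
    have mψ : MemLp (fun z => ψ (e z).2) 2 (volume.restrict U) := by
      have := hψ.1.continuous
      exact Continuous.memLp_of_isBounded hUo.measurableSet hUb (by fun_prop)
    have iψ : ∫ z in U, ψ (e z).2 ^ 2 = (β - α) * ∫ y in S, ψ y ^ 2 := by
      rw [hU]; exact setIntegral_comp_snd_eq e he hαβ (fun y => ψ y ^ 2)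
    have bφ : √(∫ z in U, φ z ^ 2) ≤ √(β - α) * √(∫ y in S, ψ y ^ 2) := by
      rw [← Real.sqrt_mul hba.le, ← iψ]
      refine Real.sqrt_le_sqrt (integral_mono mφ.integrable_sq mψ.integrable_sq fun z => ?_)
      simp only [hφ, mul_pow]
      have h1 : η ((e z).1 - s₀) ^ 2 ≤ 1 := pow_le_one₀ η.nonneg η.le_one
      exact mul_le_of_le_one_left (sq_nonneg _) h1
    have hd : ∀ z, fderiv ℝ φ z (σ • e₁) = σ * (deriv η ((e z).1 - s₀) * ψ (e z).2) := by
      intro z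
      have k1 : HasFDerivAt (fun z => (e z).1 - s₀)
          ((ContinuousLinearMap.fst ℝ ℝ F).comp (e : E →L[ℝ] ℝ × F)) z :=
        (((ContinuousLinearMap.fst ℝ ℝ F).comp (e : E →L[ℝ] ℝ × F)).hasFDerivAt).sub_const s₀
      have k2 : HasFDerivAt (fun z => (e z).2)
          ((ContinuousLinearMap.snd ℝ ℝ F).comp (e : E →L[ℝ] ℝ × F)) z :=
        (((ContinuousLinearMap.snd ℝ ℝ F).comp (e : E →L[ℝ] ℝ × F)).hasFDerivAt)
      have k3 := ((hηc.differentiable (by simp) _).hasDerivAt).comp_hasFDerivAt z k1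
      have k4 := ((hψ.1.differentiable (by simp) _).hasFDerivAt).comp z k2
      rw [map_smul, smul_eq_mul]
      have := (k3.mul k4).fderiv
      change σ * fderiv ℝ ((η ∘ fun z => (e z).1 - s₀) * (ψ ∘ fun z => (e z).2)) z e₁ = _
      rw [this]
      simp only [add_apply, smul_apply, ContinuousLinearMap.comp_apply, Function.comp_apply,
        ContinuousLinearEquiv.coe_coe, he₁, ContinuousLinearMap.coe_fst', ContinuousLinearMap.coe_snd',
        map_zero, smul_eq_mul]
      ring
    have bφ' : √(∫ z in U, fderiv ℝ φ z (σ • e₁) ^ 2)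
        ≤ B * (√(β - α) * √(∫ y in S, ψ y ^ 2)) := by
      have : B * (√(β - α) * √(∫ y in S, ψ y ^ 2))
          = √(∫ z in U, B ^ 2 * ψ (e z).2 ^ 2) := by
        rw [integral_const_mul, iψ, Real.sqrt_mul (sq_nonneg B), Real.sqrt_sq hB0,
          Real.sqrt_mul hba.le]
      rw [this]
      refine Real.sqrt_le_sqrt (integral_mono mφ'.integrable_sq (mψ.integrable_sq.const_mul _)
        fun z => ?_)
      simp only [hd, mul_pow]
      rw [← sq_abs σ, hσ1, one_pow, one_mul]
      refine mul_le_mul_of_nonneg_right ?_ (sq_nonneg _)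
      exact sq_le_sq' (abs_le.1 (hB _)).1 (abs_le.1 (hB _)).2
    have hdiff : ∫ y in S, (f (γ y) - g y) * ψ y
        = -(∫ z in U, (u z - f z) * fderiv ℝ φ z (σ • e₁))
          - σ * ∫ z in U, (u₁ z - fderiv ℝ f z e₁) * φ z := by
      have j1 : Integrable (fun y => f (γ y) * ψ y) (volume.restrict S) :=
        (Continuous.memLp_of_isBounded hS.measurableSet hSb (hfc.comp hγc)).integrable_mul
          (hψ.memLp 2)
      have j2 : Integrable (fun y => g y * ψ y) (volume.restrict S) := hg.integrable_mul (hψ.memLp 2)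
      have j3 : Integrable (fun z => (u z - f z) * fderiv ℝ φ z (σ • e₁)) (volume.restrict U) :=
        m1.integrable_mul mφ'
      have j4 : Integrable (fun z => (u₁ z - fderiv ℝ f z e₁) * φ z) (volume.restrict U) :=
        m2.integrable_mul mφ
      have j5 : Integrable (fun z => u z * fderiv ℝ φ z (σ • e₁) + u' z * φ z)
          (volume.restrict U) :=
        (hu.integrable_mul mφ').add
          ((((memLp_congr_ae hae).2 (hu₁.const_mul σ))).integrable_mul mφ)
      have j6 : Integrable (fun z => f z * fderiv ℝ φ z (σ • e₁) + (σ * fderiv ℝ f z e₁) * φ z)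
          (volume.restrict U) := by
        have : MemLp (fun z => f z * fderiv ℝ φ z (σ • e₁) + (σ * fderiv ℝ f z e₁) * φ z) 2
          (volume.restrict U) :=
          Continuous.memLp_of_isBounded hUo.measurableSet hUb (by fun_prop)
        have hfin : IsFiniteMeasure (volume.restrict U) := ⟨by
          rw [Measure.restrict_apply_univ]; exact hUb.measure_lt_top⟩
        exact this.integrable (by norm_num)
      have j3' : Integrable (fun z => -((u z - f z) * fderiv ℝ φ z (σ • e₁)))
        (volume.restrict U) := j3.neg
      simp_rw [sub_mul (f (γ _))]
      rw [integral_sub j1 j2, g2, ← g1, ← integral_sub j6 j5, ← integral_neg, ← integral_const_mul,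
        ← integral_sub j3' (j4.const_mul σ)]
      refine integral_congr_ae ?_
      filter_upwards [hae] with z hz
      rw [hz]
      ring
    rw [hdiff]
    have b1 := (integral_mul_le_sqrt_mul_sqrt m1 mφ')
    have b2 := (integral_mul_le_sqrt_mul_sqrt m2 mφ)
    rw [← ha] at b1
    rw [← hb] at b2
    have ha0 : 0 ≤ a := Real.sqrt_nonneg _
    have hb0 : 0 ≤ b := Real.sqrt_nonneg _
    set q := √(β - α) * √(∫ y in S, ψ y ^ 2) with hq
    have hq0 : 0 ≤ q := by positivity
    have c1 : -(∫ z in U, (u z - f z) * fderiv ℝ φ z (σ • e₁)) ≤ a * (B * q) :=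
      (neg_le_abs _).trans (b1.trans (by gcongr))
    have c2 : - (σ * ∫ z in U, (u₁ z - fderiv ℝ f z e₁) * φ z) ≤ b * q := by
      refine (neg_le_abs _).trans ?_
      rw [abs_mul, hσ1, one_mul]
      exact b2.trans (by gcongr)
    have c3 : √(β - α) * ((B + 1) * (a + b)) * √(∫ y in S, ψ y ^ 2) = (B + 1) * (a + b) * q := by
      rw [hq]; ring
    rw [c3]
    have d1 : 0 ≤ a * q := by positivity
    have d2 : 0 ≤ B * (b * q) := by positivity
    nlinarith
  refine (setIntegral_sq_le_of_forall_isTest hS hfg key).trans ?_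
  have ha2 : a ^ 2 = ∫ x in U, (u x - f x) ^ 2 :=
    Real.sq_sqrt (integral_nonneg fun _ => sq_nonneg _)
  have hb2 : b ^ 2 = ∫ x in U, (u₁ x - fderiv ℝ f x e₁) ^ 2 :=
    Real.sq_sqrt (integral_nonneg fun _ => sq_nonneg _)
  rw [← ha2, ← hb2, mul_pow, mul_pow, Real.sq_sqrt hba.le]
  have h1 : (a + b) ^ 2 ≤ 2 * (a ^ 2 + b ^ 2) := by nlinarith [sq_nonneg (a - b)]
  calc (β - α) * ((B + 1) ^ 2 * (a + b) ^ 2)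
      ≤ (β - α) * ((B + 1) ^ 2 * (2 * (a ^ 2 + b ^ 2))) := by gcongr
    _ = _ := by ring

end Trace

end APNN

namespace APNN

/-! ### The domains, velocity slices and classical derivatives -/

section Domains

instance : (volume : Measure (ℝ × ℝ)).IsAddHaarMeasure :=
  inferInstanceAs ((volume : Measure ℝ).prod (volume : Measure ℝ)).IsAddHaarMeasure

instance : (volume : Measure (ℝ × ℝ × ℝ)).IsAddHaarMeasure :=
  inferInstanceAs ((volume : Measure ℝ).prod (volume : Measure (ℝ × ℝ))).IsAddHaarMeasure

variable {T xL xR : ℝ}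

theorem isOpen_domTX : IsOpen (domTX T xL xR) := isOpen_Ioo.prod isOpen_Ioo

theorem isOpen_domTXV : IsOpen (domTXV T xL xR) := isOpen_Ioo.prod (isOpen_Ioo.prod isOpen_Ioo)

theorem isBounded_domTX : Bornology.IsBounded (domTX T xL xR) :=
  (Metric.isBounded_Ioo _ _).prod (Metric.isBounded_Ioo _ _)

theorem isBounded_domTXV : Bornology.IsBounded (domTXV T xL xR) :=
  (Metric.isBounded_Ioo _ _).prod ((Metric.isBounded_Ioo _ _).prod (Metric.isBounded_Ioo _ _))

theorem convex_domTX : Convex ℝ (domTX T xL xR) := (convex_Ioo _ _).prod (convex_Ioo _ _)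

theorem convex_domTXV : Convex ℝ (domTXV T xL xR) :=
  (convex_Ioo _ _).prod ((convex_Ioo _ _).prod (convex_Ioo _ _))

/-- Separation of the velocity variable. -/
def splitV : ℝ × ℝ × ℝ ≃ᵐ (ℝ × ℝ) × ℝ := MeasurableEquiv.prodAssoc.symm

theorem measurePreserving_splitV : MeasurePreserving splitV (volume.restrict (domTXV T xL xR))
    ((volume.restrict (domTX T xL xR)).prod (volume.restrict (Ioo (0 : ℝ) 1))) := by
  have h := (volume_preserving_prodAssoc (α₁ := ℝ) (β₁ := ℝ) (γ₁ := ℝ)).symm.restrict_preimage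
    (s := domTX T xL xR ×ˢ Ioo (0 : ℝ) 1) (isOpen_domTX.prod isOpen_Ioo).measurableSet
  rw [Measure.volume_eq_prod (ℝ × ℝ) ℝ, ← Measure.prod_restrict] at h
  have e : (MeasurableEquiv.prodAssoc (α := ℝ) (β := ℝ) (γ := ℝ)).symm ⁻¹'
      (domTX T xL xR ×ˢ Ioo (0 : ℝ) 1) = domTXV T xL xR := by
    ext ⟨t, x, v⟩
    simp [domTX, domTXV, MeasurableEquiv.prodAssoc, and_assoc]
  rw [e] at h
  exact h

theorem ae_domTXV_of_ae_domTX {p : ℝ × ℝ → Prop} (h : ∀ᵐ z ∂(volume.restrict (domTX T xL xR)), p z) :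
    ∀ᵐ z ∂(volume.restrict (domTXV T xL xR)), p (z.1, z.2.1) :=
  (Measure.quasiMeasurePreserving_fst.comp
    measurePreserving_splitV.quasiMeasurePreserving).ae h

theorem integrable_domTXV_of_domTX {k : ℝ × ℝ → ℝ}
    (hk : Integrable k (volume.restrict (domTX T xL xR))) :
    Integrable (fun z : ℝ × ℝ × ℝ => k (z.1, z.2.1)) (volume.restrict (domTXV T xL xR)) ∧
    ∫ z in domTXV T xL xR, k (z.1, z.2.1) = ∫ z in domTX T xL xR, k z := by
  have h := measurePreserving_splitV (T := T) (xL := xL) (xR := xR)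
  have h1 := hk.comp_fst (volume.restrict (Ioo (0 : ℝ) 1))
  refine ⟨h.integrable_comp_of_integrable h1, ?_⟩
  have h2 := h.integral_comp' (fun p : (ℝ × ℝ) × ℝ => k p.1)
  rw [integral_prod _ h1] at h2
  refine h2.trans ?_
  simp

theorem slices_of_memLp {a : ℝ × ℝ × ℝ → ℝ} (ha : MemLp a 2 (volume.restrict (domTXV T xL xR))) :
    (∀ᵐ z ∂(volume.restrict (domTX T xL xR)),
      MemLp (fun v => a (z.1, z.2, v)) 2 (volume.restrict (Ioo (0 : ℝ) 1))) ∧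
    Integrable (fun z : ℝ × ℝ => ∫ v in Ioo (0 : ℝ) 1, a (z.1, z.2, v) ^ 2)
      (volume.restrict (domTX T xL xR)) ∧
    ∫ z in domTX T xL xR, ∫ v in Ioo (0 : ℝ) 1, a (z.1, z.2, v) ^ 2
      = ∫ z in domTXV T xL xR, a z ^ 2 := by
  have h := (measurePreserving_splitV (T := T) (xL := xL) (xR := xR)).symm
  have h1 := h.integrable_comp_of_integrable ha.integrable_sq
  have h2 := ha.1.comp_measurePreserving h
  refine ⟨?_, h1.integral_prod_left, ?_⟩
  · filter_upwards [h1.prod_right_ae, h2.prodMk_left] with z h3 h4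
    exact (memLp_two_iff_integrable_sq h4).2 h3
  · exact (integral_prod _ h1).symm.trans (h.integral_comp' (fun z => a z ^ 2))

theorem sq_integral_velocity_mul_le {α : ℝ → ℝ} (hα : MemLp α 2 (volume.restrict (Ioo (0 : ℝ) 1))) :
    (∫ v in Ioo (0 : ℝ) 1, v * α v) ^ 2 ≤ ∫ v in Ioo (0 : ℝ) 1, α v ^ 2 := by
  have hb : Bornology.IsBounded (Ioo (0 : ℝ) 1) := Metric.isBounded_Ioo _ _
  have hv : MemLp (fun v : ℝ => v) 2 (volume.restrict (Ioo (0 : ℝ) 1)) :=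
    Continuous.memLp_of_isBounded measurableSet_Ioo hb continuous_id
  have h := integral_mul_le_sqrt_mul_sqrt hv hα
  have h1 : ∫ v in Ioo (0 : ℝ) 1, v ^ 2 ≤ 1 := by
    rw [← integral_Ioc_eq_integral_Ioo, ← intervalIntegral.integral_of_le zero_le_one, integral_pow]
    norm_num
  have h0 : 0 ≤ ∫ v in Ioo (0 : ℝ) 1, α v ^ 2 := integral_nonneg fun _ => sq_nonneg _
  have h2 : |∫ v in Ioo (0 : ℝ) 1, v * α v| ≤ √(∫ v in Ioo (0 : ℝ) 1, α v ^ 2) :=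
    h.trans (mul_le_of_le_one_left (Real.sqrt_nonneg _) (Real.sqrt_le_one.2 h1))
  rw [← sq_abs, ← Real.sq_sqrt h0]
  gcongr

theorem dt₂_eq {f : ℝ × ℝ → ℝ} (hf : Differentiable ℝ f) (z : ℝ × ℝ) :
    dt₂ f z = fderiv ℝ f z (1, 0) := by
  have h : HasDerivAt (fun s : ℝ => (s, z.2)) ((1 : ℝ), (0 : ℝ)) z.1 :=
    (hasDerivAt_id z.1).prodMk (hasDerivAt_const _ _)
  exact ((hf z).hasFDerivAt.comp_hasDerivAt z.1 h).deriv

theorem dx₂_eq {f : ℝ × ℝ → ℝ} (hf : Differentiable ℝ f) (z : ℝ × ℝ) :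
    dx₂ f z = fderiv ℝ f z (0, 1) := by
  have h : HasDerivAt (fun s : ℝ => (z.1, s)) ((0 : ℝ), (1 : ℝ)) z.2 :=
    (hasDerivAt_const _ _).prodMk (hasDerivAt_id z.2)
  exact ((hf z).hasFDerivAt.comp_hasDerivAt z.2 h).deriv

theorem dt₃_eq {f : ℝ × ℝ × ℝ → ℝ} (hf : Differentiable ℝ f) (z : ℝ × ℝ × ℝ) :
    dt₃ f z = fderiv ℝ f z (1, 0, 0) := by
  have h : HasDerivAt (fun s : ℝ => (s, z.2.1, z.2.2)) ((1 : ℝ), (0 : ℝ), (0 : ℝ)) z.1 :=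
    (hasDerivAt_id z.1).prodMk (hasDerivAt_const _ _)
  exact ((hf z).hasFDerivAt.comp_hasDerivAt z.1 h).deriv

theorem dx₃_eq {f : ℝ × ℝ × ℝ → ℝ} (hf : Differentiable ℝ f) (z : ℝ × ℝ × ℝ) :
    dx₃ f z = fderiv ℝ f z (0, 1, 0) := by
  have h : HasDerivAt (fun s : ℝ => (z.1, s, z.2.2)) ((0 : ℝ), (1 : ℝ), (0 : ℝ)) z.2.1 :=
    (hasDerivAt_const _ _).prodMk ((hasDerivAt_id z.2.1).prodMk (hasDerivAt_const _ _))
  exact ((hf z).hasFDerivAt.comp_hasDerivAt z.2.1 h).deriv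

theorem setAverage_le {α : Type*} [MeasureSpace α] {s : Set α} {f : α → ℝ} {B : ℝ}
    (h : ∫ x in s, f x ≤ B) : ⨍ x in s, f x ≤ (volume.real s)⁻¹ * B := by
  rw [setAverage_eq, smul_eq_mul]
  gcongr

end Domains

/-! ### The residual part of the loss -/

section Residual

variable {ε T xL xR : ℝ}

/-- The error of the approximation `f` of a function `u` of `(t, x)` with weak derivatives `ut`
and `ux`. -/
noncomputable def err₂ (T xL xR : ℝ) (u ut ux f : ℝ × ℝ → ℝ) : ℝ :=
  sobolevError (domTX T xL xR) (1, 0) (0, 1) u ut ux f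

/-- The error of the approximation `f` of a function `u` of `(t, x, v)` with weak derivatives `ut`
and `ux`. -/
noncomputable def err₃ (T xL xR : ℝ) (u ut ux f : ℝ × ℝ × ℝ → ℝ) : ℝ :=
  sobolevError (domTXV T xL xR) (1, 0, 0) (0, 1, 0) u ut ux f

theorem sq_add_four_le {e A B C D : ℝ} {b c : ℝ} (hB : B ^ 2 ≤ b) (hC : C ^ 2 ≤ (e ^ 2 + 1) * c) :
    (e * A + B + C + D) ^ 2 ≤ 4 * (e ^ 2 + 1) * (A ^ 2 + b + c + D ^ 2) := by
  have h1 : (e * A + B + C + D) ^ 2 ≤ 4 * ((e * A) ^ 2 + B ^ 2 + C ^ 2 + D ^ 2) := by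
    nlinarith [sq_nonneg (e * A - B), sq_nonneg (e * A - C), sq_nonneg (e * A - D),
      sq_nonneg (B - C), sq_nonneg (B - D), sq_nonneg (C - D)]
  have h2 : 0 ≤ e ^ 2 * b := mul_nonneg (sq_nonneg e) ((sq_nonneg B).trans hB)
  have h3 : 0 ≤ e ^ 2 * D ^ 2 := by positivity
  nlinarith [sq_nonneg A]

theorem mul_sq_le_sq {v B : ℝ} (hv : v ^ 2 ≤ 1) : (v * B) ^ 2 ≤ B ^ 2 := by
  rw [mul_pow]
  exact mul_le_of_le_one_left (sq_nonneg _) hv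

/-- Subtracting the equations satisfied by the solution turns each residual into minus the same
linear expression in the errors. The error of the flux is a velocity average; Cauchy–Schwarz in `v`
bounds its square by the slice integral `q`, and Fubini returns the error of `jx`. Elsewhere `v² ≤
1`. -/
theorem lossResidual_le {ρ ρt ρx : ℝ × ℝ → ℝ} {j jt jx w wt wx : ℝ × ℝ × ℝ → ℝ}
    (hρt : MemLp ρt 2 (volume.restrict (domTX T xL xR)))
    (hρx : MemLp ρx 2 (volume.restrict (domTX T xL xR)))
    (hj : MemLp j 2 (volume.restrict (domTXV T xL xR)))
    (hjt : MemLp jt 2 (volume.restrict (domTXV T xL xR)))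
    (hjx : MemLp jx 2 (volume.restrict (domTXV T xL xR)))
    (hw : MemLp w 2 (volume.restrict (domTXV T xL xR)))
    (hwt : MemLp wt 2 (volume.restrict (domTXV T xL xR)))
    (hwx : MemLp wx 2 (volume.restrict (domTXV T xL xR)))
    (s1 : ∀ᵐ z ∂(volume.restrict (domTX T xL xR)),
      ρt z + ∫ v in Ioo (0 : ℝ) 1, v * jx (z.1, z.2, v) = 0)
    (s2 : ∀ᵐ z ∂(volume.restrict (domTXV T xL xR)),
      ε ^ 2 * jt z + z.2.2 * ρx (z.1, z.2.1) + ε ^ 2 * (z.2.2 * wx z) + j z = 0)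
    (s3 : ∀ᵐ z ∂(volume.restrict (domTXV T xL xR)),
      ε ^ 2 * wt z + w z + z.2.2 * jx z
        - ∫ v in Ioo (0 : ℝ) 1, v * jx (z.1, z.2.1, v) = 0)
    {fρ : ℝ × ℝ → ℝ} {fj fw : ℝ × ℝ × ℝ → ℝ} (cρ : ContDiff ℝ ∞ fρ) (cj : ContDiff ℝ ∞ fj)
    (cw : ContDiff ℝ ∞ fw) :
    lossResidual ε T xL xR fρ fj fw ≤
      (2 * (volume.real (domTX T xL xR))⁻¹
        + 16 * ((ε ^ 2) ^ 2 + 1) * (volume.real (domTXV T xL xR))⁻¹) *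
      (err₂ T xL xR ρ ρt ρx fρ + err₃ T xL xR j jt jx fj + err₃ T xL xR w wt wx fw) := by
  have dρ := cρ.differentiable (by simp)
  have dj := cj.differentiable (by simp)
  have dw := cw.differentiable (by simp)
  have cρ' : Continuous (fderiv ℝ fρ) := cρ.continuous_fderiv (by simp)
  have cj' : Continuous (fderiv ℝ fj) := cj.continuous_fderiv (by simp)
  have cw' : Continuous (fderiv ℝ fw) := cw.continuous_fderiv (by simp)
  have m2 : ∀ {k g : ℝ × ℝ → ℝ}, MemLp k 2 (volume.restrict (domTX T xL xR)) → Continuous g →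
      MemLp (fun z => k z - g z) 2 (volume.restrict (domTX T xL xR)) := fun hk hg =>
    hk.sub (Continuous.memLp_of_isBounded isOpen_domTX.measurableSet isBounded_domTX hg)
  have m3 : ∀ {k g : ℝ × ℝ × ℝ → ℝ}, MemLp k 2 (volume.restrict (domTXV T xL xR)) → Continuous g →
      MemLp (fun z => k z - g z) 2 (volume.restrict (domTXV T xL xR)) := fun hk hg =>
    hk.sub (Continuous.memLp_of_isBounded isOpen_domTXV.measurableSet isBounded_domTXV hg)
  set a : ℝ × ℝ × ℝ → ℝ := fun z => jx z - fderiv ℝ fj z (0, 1, 0) with ha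
  have ma : MemLp a 2 (volume.restrict (domTXV T xL xR)) := m3 hjx (by fun_prop)
  obtain ⟨a1, a2, a3⟩ := slices_of_memLp ma
  obtain ⟨b1, -, -⟩ := slices_of_memLp hjx
  set q : ℝ × ℝ → ℝ := fun z => ∫ v in Ioo (0 : ℝ) 1, a (z.1, z.2, v) ^ 2 with hq
  have hvb : Bornology.IsBounded (Ioo (0 : ℝ) 1) := Metric.isBounded_Ioo _ _
  have hflux : ∀ᵐ z ∂(volume.restrict (domTX T xL xR)),
      ((∫ v in Ioo (0 : ℝ) 1, v * jx (z.1, z.2, v)) - flux fj z.1 z.2) ^ 2 ≤ q z := by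
    filter_upwards [a1, b1] with z h1 h2
    have h3 : (∫ v in Ioo (0 : ℝ) 1, v * jx (z.1, z.2, v)) - flux fj z.1 z.2
        = ∫ v in Ioo (0 : ℝ) 1, v * a (z.1, z.2, v) := by
      have hv : MemLp (fun v : ℝ => v) 2 (volume.restrict (Ioo (0 : ℝ) 1)) :=
        Continuous.memLp_of_isBounded measurableSet_Ioo hvb continuous_id
      have hd : MemLp (fun v : ℝ => dx₃ fj (z.1, z.2, v)) 2 (volume.restrict (Ioo (0 : ℝ) 1)) := by
        simp_rw [dx₃_eq dj]
        exact Continuous.memLp_of_isBounded measurableSet_Ioo hvb (by fun_prop)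
      have k1 : IntegrableOn (fun v : ℝ => v * jx (z.1, z.2, v)) (Ioo 0 1) := hv.integrable_mul h2
      have k2 : IntegrableOn (fun v : ℝ => v * dx₃ fj (z.1, z.2, v)) (Ioo 0 1) :=
        hv.integrable_mul hd
      rw [flux, ← integral_sub k1 k2]
      congr 1
      ext v
      simp only [ha, dx₃_eq dj]
      ring
    rw [h3]
    exact sq_integral_velocity_mul_le h1
  obtain ⟨l1, l2, l3⟩ := le_sobolevError (domTX T xL xR) (1, 0) (0, 1) ρ ρt ρx fρ
  obtain ⟨n1, n2, n3⟩ := le_sobolevError (domTXV T xL xR) (1, 0, 0) (0, 1, 0) j jt jx fj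
  obtain ⟨p1, p2, p3⟩ := le_sobolevError (domTXV T xL xR) (1, 0, 0) (0, 1, 0) w wt wx fw
  have pos2 : 0 ≤ err₂ T xL xR ρ ρt ρx fρ := (integral_nonneg fun _ => sq_nonneg _).trans l1
  have pos3 : 0 ≤ err₃ T xL xR j jt jx fj := (integral_nonneg fun _ => sq_nonneg _).trans n1
  have pos4 : 0 ≤ err₃ T xL xR w wt wx fw := (integral_nonneg fun _ => sq_nonneg _).trans p1
  set Eρ := err₂ T xL xR ρ ρt ρx fρ with hEρ
  set Ej := err₃ T xL xR j jt jx fj with hEj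
  set Ew := err₃ T xL xR w wt wx fw with hEw
  replace l2 : _ ≤ Eρ := l2
  replace l3 : _ ≤ Eρ := l3
  replace n1 : _ ≤ Ej := n1
  replace n2 : _ ≤ Ej := n2
  replace n3 : ∫ z in domTXV T xL xR, a z ^ 2 ≤ Ej := n3
  replace p1 : _ ≤ Ew := p1
  replace p2 : _ ≤ Ew := p2
  replace p3 : _ ≤ Ew := p3
  have iρt := (m2 hρt (g := fun z => fderiv ℝ fρ z (1, 0)) (by fun_prop)).integrable_sq
  have iρx := (m2 hρx (g := fun z => fderiv ℝ fρ z (0, 1)) (by fun_prop)).integrable_sq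
  have ij := (m3 hj (g := fj) cj.continuous).integrable_sq
  have ijt := (m3 hjt (g := fun z => fderiv ℝ fj z (1, 0, 0)) (by fun_prop)).integrable_sq
  have ija := ma.integrable_sq
  have iw := (m3 hw (g := fw) cw.continuous).integrable_sq
  have iwt := (m3 hwt (g := fun z => fderiv ℝ fw z (1, 0, 0)) (by fun_prop)).integrable_sq
  have iwx := (m3 hwx (g := fun z => fderiv ℝ fw z (0, 1, 0)) (by fun_prop)).integrable_sq
  have r1 : ∫ z in domTX T xL xR, |dt₂ fρ z + flux fj z.1 z.2| ^ 2 ≤ 2 * (Eρ + Ej) := by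
    refine (integral_mono_of_nonneg (Eventually.of_forall fun _ => sq_nonneg _)
      ((iρt.add a2).const_mul 2) ?_).trans ?_
    · filter_upwards [hflux, s1] with z h1 h2
      have : |dt₂ fρ z + flux fj z.1 z.2| ^ 2 = ((ρt z - fderiv ℝ fρ z (1, 0))
          + ((∫ v in Ioo (0 : ℝ) 1, v * jx (z.1, z.2, v)) - flux fj z.1 z.2)) ^ 2 := by
        rw [sq_abs, dt₂_eq dρ, ← neg_sq]
        congr 1
        linarith
      simp only [Pi.add_apply]
      rw [this]
      refine add_sq_le.trans ?_
      linarith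
    · have := integral_add iρt a2
      simp only [Pi.add_apply]
      rw [integral_const_mul, this, a3]
      linarith
  obtain ⟨t1, t2⟩ := integrable_domTXV_of_domTX iρx
  obtain ⟨t3, t4⟩ := integrable_domTXV_of_domTX a2
  have hv1 : ∀ z ∈ domTXV T xL xR, z.2.2 ^ 2 ≤ 1 := by
    rintro z ⟨-, -, h⟩
    exact pow_le_one₀ h.1.le h.2.le
  have r2 : ∫ z in domTXV T xL xR,
      |ε ^ 2 * dt₃ fj z + z.2.2 * dx₂ fρ (z.1, z.2.1) + ε ^ 2 * (z.2.2 * dx₃ fw z) + fj z| ^ 2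
      ≤ 4 * ((ε ^ 2) ^ 2 + 1) * (2 * Ej + Eρ + Ew) := by
    have i1 := ijt.add t1
    have i2 := i1.add iwx
    have i3 := i2.add ij
    refine (integral_mono_of_nonneg (Eventually.of_forall fun _ => sq_nonneg _)
      (i3.const_mul (4 * ((ε ^ 2) ^ 2 + 1))) ?_).trans ?_
    · filter_upwards [s2, ae_restrict_mem isOpen_domTXV.measurableSet] with z h1 hz
      have := sq_add_four_le (e := ε ^ 2) (A := jt z - fderiv ℝ fj z (1, 0, 0))
        (B := z.2.2 * (ρx (z.1, z.2.1) - fderiv ℝ fρ (z.1, z.2.1) (0, 1)))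
        (C := ε ^ 2 * (z.2.2 * (wx z - fderiv ℝ fw z (0, 1, 0))))
        (D := j z - fj z) (mul_sq_le_sq (hv1 z hz)) (c := (wx z - fderiv ℝ fw z (0, 1, 0)) ^ 2)
        (by
          rw [mul_pow]
          have := mul_sq_le_sq (B := wx z - fderiv ℝ fw z (0, 1, 0)) (hv1 z hz)
          gcongr
          linarith)
      simp only [Pi.add_apply]
      refine le_trans (le_of_eq ?_) this
      rw [sq_abs, dt₃_eq dj, dx₂_eq dρ, dx₃_eq dw, ← neg_sq]
      congr 1
      linarith
    · rw [integral_const_mul]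
      have e1 := integral_add ijt t1
      have e2 := integral_add i1 iwx
      have e3 := integral_add i2 ij
      simp only [Pi.add_apply] at e1 e2 e3 ⊢
      rw [e3, e2, e1, t2]
      refine mul_le_mul_of_nonneg_left ?_ (by positivity)
      linarith
  have r3 : ∫ z in domTXV T xL xR,
      |ε ^ 2 * dt₃ fw z + fw z + z.2.2 * dx₃ fj z - flux fj z.1 z.2.1| ^ 2
      ≤ 4 * ((ε ^ 2) ^ 2 + 1) * (2 * Ew + 2 * Ej) := by
    have i1 := iwt.add ija
    have i2 := i1.add t3
    have i3 := i2.add iw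
    refine (integral_mono_of_nonneg (Eventually.of_forall fun _ => sq_nonneg _)
      (i3.const_mul (4 * ((ε ^ 2) ^ 2 + 1))) ?_).trans ?_
    · filter_upwards [s3, ae_restrict_mem isOpen_domTXV.measurableSet,
        ae_domTXV_of_ae_domTX hflux] with z h1 hz h2
      set I := (∫ v in Ioo (0 : ℝ) 1, v * jx (z.1, z.2.1, v)) with hI
      have := sq_add_four_le (e := ε ^ 2) (A := wt z - fderiv ℝ fw z (1, 0, 0))
        (B := z.2.2 * a z) (C := flux fj z.1 z.2.1 - I) (D := w z - fw z)
        (mul_sq_le_sq (hv1 z hz)) (c := q (z.1, z.2.1))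
        (by
          rw [← neg_sq, neg_sub]
          exact h2.trans (le_mul_of_one_le_left ((sq_nonneg _).trans h2)
            (le_add_of_nonneg_left (sq_nonneg _))))
      simp only [Pi.add_apply]
      refine le_trans (le_of_eq ?_) this
      rw [sq_abs, dt₃_eq dw, dx₃_eq dj, ← neg_sq]
      congr 1
      simp only [ha]
      linarith
    · rw [integral_const_mul]
      have e1 := integral_add iwt ija
      have e2 := integral_add i1 t3
      have e3 := integral_add i2 iw
      simp only [Pi.add_apply] at e1 e2 e3 ⊢
      rw [e3, e2, e1, t4, a3]
      refine mul_le_mul_of_nonneg_left ?_ (by positivity)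
      linarith
  have q1 := setAverage_le r1
  have q2 := setAverage_le r2
  have q3 := setAverage_le r3
  unfold lossResidual
  refine (add_le_add (add_le_add q1 q2) q3).trans ?_
  have v1 : 0 ≤ (volume.real (domTX T xL xR))⁻¹ := by positivity
  have v2 : 0 ≤ (volume.real (domTXV T xL xR))⁻¹ * ((ε ^ 2) ^ 2 + 1) := by positivity
  have v3 := mul_nonneg v1 pos4
  have v4 := mul_nonneg v2 pos2
  have v5 := mul_nonneg v2 pos3
  have v6 := mul_nonneg v2 pos4
  nlinarith

end Residual

end APNN

namespace APNN

/-! ### Trace inequalities on the faces of the two domains -/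

section Faces

variable {ε T xL xR : ℝ}

/-- The exchange of the first two variables of `(t, x, v)`. -/
noncomputable def swapTX : (ℝ × ℝ × ℝ) ≃L[ℝ] ℝ × ℝ × ℝ :=
  LinearEquiv.toContinuousLinearEquiv
    { toFun := fun z => (z.2.1, z.1, z.2.2)
      invFun := fun z => (z.2.1, z.1, z.2.2)
      map_add' := fun _ _ => rfl
      map_smul' := fun _ _ => rfl
      left_inv := fun _ => rfl
      right_inv := fun _ => rfl }

theorem swapTX_apply (z : ℝ × ℝ × ℝ) : swapTX z = (z.2.1, z.1, z.2.2) := rfl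

/-- On the faces at `xL` and `xR` the normal variable is `x`; the exchange brings it to the first
place, as the general trace inequality requires. -/
theorem measurePreserving_swapTX : MeasurePreserving swapTX volume volume := by
  have h1 := volume_preserving_prodAssoc (α₁ := ℝ) (β₁ := ℝ) (γ₁ := ℝ)
  have h2 : MeasurePreserving (Prod.map Prod.swap id : (ℝ × ℝ) × ℝ → (ℝ × ℝ) × ℝ) volume volume :=
    (Measure.measurePreserving_swap (μ := (volume : Measure ℝ)) (ν := (volume : Measure ℝ))).prod
      (MeasurePreserving.id volume)
  exact h1.comp (h2.comp h1.symm)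

theorem exists_trace_t₂_le (hT : 0 < T) : ∃ C : ℝ, 0 ≤ C ∧ ∀ {u ut ux : ℝ × ℝ → ℝ} {g : ℝ → ℝ},
    MemLp u 2 (volume.restrict (domTX T xL xR)) → MemLp ut 2 (volume.restrict (domTX T xL xR)) →
    IsWeakDeriv (domTX T xL xR) (1, 0) u ut →
    IsTrace (domTX T xL xR) (-1, 0) (fun x : ℝ => (0, x)) (Ioo xL xR) u g →
    ∀ {f : ℝ × ℝ → ℝ}, ContDiff ℝ ∞ f →
    ∫ x in Ioo xL xR, (f (0, x) - g x) ^ 2 ≤ C * err₂ T xL xR u ut ux f := by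
  obtain ⟨C, hC, h⟩ := exists_setIntegral_trace_sub_sq_le (ContinuousLinearEquiv.refl ℝ (ℝ × ℝ))
    (MeasurePreserving.id _) (isOpen_Ioo (a := xL) (b := xR)) (Metric.isBounded_Ioo _ _) hT
    (U := domTX T xL xR) rfl (e₁ := (1, 0)) rfl (.inl ⟨rfl, rfl⟩) (γ := fun x => (0, x))
    (fun _ => rfl)
  refine ⟨C, hC, fun {u ut ux g} hu hut hw ht {f} hf => ?_⟩
  have e : ((-1 : ℝ) • ((1 : ℝ), (0 : ℝ))) = (-1, 0) := by simp
  refine (h hu hut hw (by rw [e]; exact ht) hf).2.trans ?_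
  gcongr
  have : 0 ≤ ∫ z in domTX T xL xR, (ux z - fderiv ℝ f z (0, 1)) ^ 2 :=
    integral_nonneg fun _ => sq_nonneg _
  unfold err₂ sobolevError
  linarith

theorem exists_trace_x₂_le (hx : xL < xR) {σ s₀ : ℝ} (hσ : (σ = -1 ∧ s₀ = xL) ∨ (σ = 1 ∧ s₀ = xR)) :
    ∃ C : ℝ, 0 ≤ C ∧ ∀ {u ut ux : ℝ × ℝ → ℝ} {g : ℝ → ℝ},
    MemLp u 2 (volume.restrict (domTX T xL xR)) → MemLp ux 2 (volume.restrict (domTX T xL xR)) →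
    IsWeakDeriv (domTX T xL xR) (0, 1) u ux →
    IsTrace (domTX T xL xR) (0, σ) (fun t : ℝ => (t, s₀)) (Ioo 0 T) u g →
    ∀ {f : ℝ × ℝ → ℝ}, ContDiff ℝ ∞ f →
    MemLp (fun t => f (t, s₀) - g t) 2 (volume.restrict (Ioo 0 T)) ∧
    ∫ t in Ioo 0 T, (f (t, s₀) - g t) ^ 2 ≤ C * err₂ T xL xR u ut ux f := by
  obtain ⟨C, hC, h⟩ := exists_setIntegral_trace_sub_sq_le (ContinuousLinearEquiv.prodComm ℝ ℝ ℝ)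
    Measure.measurePreserving_swap (isOpen_Ioo (a := 0) (b := T)) (Metric.isBounded_Ioo _ _) hx
    (U := domTX T xL xR) (by ext z; simp [domTX, and_comm]) (e₁ := (0, 1)) rfl hσ
    (γ := fun t => (t, s₀)) (fun _ => rfl)
  refine ⟨C, hC, fun {u ut ux g} hu hux hw ht {f} hf => ?_⟩
  have e : (σ • ((0 : ℝ), (1 : ℝ))) = (0, σ) := by simp
  obtain ⟨k1, k2⟩ := h hu hux hw (by rw [e]; exact ht) hf
  refine ⟨k1, k2.trans ?_⟩
  gcongr
  have : 0 ≤ ∫ z in domTX T xL xR, (ut z - fderiv ℝ f z (1, 0)) ^ 2 :=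
    integral_nonneg fun _ => sq_nonneg _
  unfold err₂ sobolevError
  linarith

theorem exists_trace_t₃_le (hT : 0 < T) :
    ∃ C : ℝ, 0 ≤ C ∧ ∀ {u ut ux : ℝ × ℝ × ℝ → ℝ} {g : ℝ × ℝ → ℝ},
    MemLp u 2 (volume.restrict (domTXV T xL xR)) → MemLp ut 2 (volume.restrict (domTXV T xL xR)) →
    IsWeakDeriv (domTXV T xL xR) (1, 0, 0) u ut → HasInitial₃ T xL xR u g →
    ∀ {f : ℝ × ℝ × ℝ → ℝ}, ContDiff ℝ ∞ f →
    MemLp (fun y => f (0, y) - g y) 2 (volume.restrict (Ioo xL xR ×ˢ Ioo (0 : ℝ) 1)) ∧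
    ∫ y in Ioo xL xR ×ˢ Ioo (0 : ℝ) 1, (f (0, y) - g y) ^ 2 ≤ C * err₃ T xL xR u ut ux f := by
  obtain ⟨C, hC, h⟩ := exists_setIntegral_trace_sub_sq_le
    (ContinuousLinearEquiv.refl ℝ (ℝ × ℝ × ℝ)) (MeasurePreserving.id _)
    ((isOpen_Ioo (a := xL) (b := xR)).prod (isOpen_Ioo (a := (0 : ℝ)) (b := 1)))
    ((Metric.isBounded_Ioo _ _).prod (Metric.isBounded_Ioo _ _)) hT
    (U := domTXV T xL xR) rfl (e₁ := (1, 0, 0)) rfl (.inl ⟨rfl, rfl⟩) (γ := fun y => (0, y))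
    (fun _ => rfl)
  refine ⟨C, hC, fun {u ut ux g} hu hut hw ht {f} hf => ?_⟩
  have e : ((-1 : ℝ) • ((1 : ℝ), (0 : ℝ), (0 : ℝ))) = (-1, 0, 0) := by simp
  obtain ⟨k1, k2⟩ := h hu hut hw (by rw [e]; exact ht) hf
  refine ⟨k1, k2.trans ?_⟩
  gcongr
  have : 0 ≤ ∫ z in domTXV T xL xR, (ux z - fderiv ℝ f z (0, 1, 0)) ^ 2 :=
    integral_nonneg fun _ => sq_nonneg _
  unfold err₃ sobolevError
  linarith

theorem exists_trace_x₃_le (hx : xL < xR) {σ s₀ : ℝ} (hσ : (σ = -1 ∧ s₀ = xL) ∨ (σ = 1 ∧ s₀ = xR)) :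
    ∃ C : ℝ, 0 ≤ C ∧ ∀ {u ut ux : ℝ × ℝ × ℝ → ℝ} {g : ℝ × ℝ → ℝ},
    MemLp u 2 (volume.restrict (domTXV T xL xR)) → MemLp ux 2 (volume.restrict (domTXV T xL xR)) →
    IsWeakDeriv (domTXV T xL xR) (0, 1, 0) u ux →
    IsTrace (domTXV T xL xR) (0, σ, 0) (fun y : ℝ × ℝ => (y.1, s₀, y.2)) (Ioo 0 T ×ˢ Ioo 0 1) u g →
    ∀ {f : ℝ × ℝ × ℝ → ℝ}, ContDiff ℝ ∞ f →
    MemLp (fun y : ℝ × ℝ => f (y.1, s₀, y.2) - g y) 2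
      (volume.restrict (Ioo 0 T ×ˢ Ioo (0 : ℝ) 1)) ∧
    ∫ y in Ioo 0 T ×ˢ Ioo (0 : ℝ) 1, (f (y.1, s₀, y.2) - g y) ^ 2
      ≤ C * err₃ T xL xR u ut ux f := by
  obtain ⟨C, hC, h⟩ := exists_setIntegral_trace_sub_sq_le swapTX measurePreserving_swapTX
    ((isOpen_Ioo (a := 0) (b := T)).prod (isOpen_Ioo (a := (0 : ℝ)) (b := 1)))
    ((Metric.isBounded_Ioo _ _).prod (Metric.isBounded_Ioo _ _)) hx
    (U := domTXV T xL xR) (by ext z; simp [domTXV, swapTX_apply]; tauto) (e₁ := (0, 1, 0)) rfl hσ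
    (γ := fun y => (y.1, s₀, y.2)) (fun _ => rfl)
  refine ⟨C, hC, fun {u ut ux g} hu hux hw ht {f} hf => ?_⟩
  have e : (σ • ((0 : ℝ), (1 : ℝ), (0 : ℝ))) = (0, σ, 0) := by simp
  obtain ⟨k1, k2⟩ := h hu hux hw (by rw [e]; exact ht) hf
  refine ⟨k1, k2.trans ?_⟩
  gcongr
  have : 0 ≤ ∫ z in domTXV T xL xR, (ut z - fderiv ℝ f z (1, 0, 0)) ^ 2 :=
    integral_nonneg fun _ => sq_nonneg _
  unfold err₃ sobolevError
  linarith

end Faces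

/-! ### The initial and boundary parts of the loss -/

section Loss

variable {ε T xL xR l₁ l₂ l₃ l₄ : ℝ}

theorem err₂_nonneg (T xL xR : ℝ) (u ut ux f : ℝ × ℝ → ℝ) : 0 ≤ err₂ T xL xR u ut ux f :=
  (integral_nonneg fun _ => sq_nonneg _).trans
    (le_sobolevError (domTX T xL xR) (1, 0) (0, 1) u ut ux f).1

theorem err₃_nonneg (T xL xR : ℝ) (u ut ux f : ℝ × ℝ × ℝ → ℝ) : 0 ≤ err₃ T xL xR u ut ux f :=
  (integral_nonneg fun _ => sq_nonneg _).trans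
    (le_sobolevError (domTXV T xL xR) (1, 0, 0) (0, 1, 0) u ut ux f).1

theorem exists_lossInitial_le (hT : 0 < T) (hl₁ : 0 ≤ l₁) (hl₂ : 0 ≤ l₂) {δ : SideData}
    {ρ ρt ρx : ℝ × ℝ → ℝ} {j jt jx w wt wx : ℝ × ℝ × ℝ → ℝ}
    (hρ : MemLp ρ 2 (volume.restrict (domTX T xL xR)))
    (hρt : MemLp ρt 2 (volume.restrict (domTX T xL xR)))
    (hj : MemLp j 2 (volume.restrict (domTXV T xL xR)))
    (hjt : MemLp jt 2 (volume.restrict (domTXV T xL xR)))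
    (hw : MemLp w 2 (volume.restrict (domTXV T xL xR)))
    (hwt : MemLp wt 2 (volume.restrict (domTXV T xL xR)))
    (dρt : IsWeakDeriv (domTX T xL xR) (1, 0) ρ ρt)
    (djt : IsWeakDeriv (domTXV T xL xR) (1, 0, 0) j jt)
    (dwt : IsWeakDeriv (domTXV T xL xR) (1, 0, 0) w wt)
    (hδ : AttainsData T xL xR δ ρ j w) :
    ∃ C : ℝ, 0 ≤ C ∧ ∀ {fρ : ℝ × ℝ → ℝ} {fj fw : ℝ × ℝ × ℝ → ℝ}, ContDiff ℝ ∞ fρ →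
      ContDiff ℝ ∞ fj → ContDiff ℝ ∞ fw → lossInitial ε xL xR l₁ l₂ δ fρ fj fw ≤
      C * (err₂ T xL xR ρ ρt ρx fρ + err₃ T xL xR j jt jx fj + err₃ T xL xR w wt wx fw) := by
  obtain ⟨tρ, tj, tw, -, -, -, -⟩ := hδ
  obtain ⟨C₂, hC₂, h₂⟩ := exists_trace_t₂_le (xL := xL) (xR := xR) hT
  obtain ⟨C₃, hC₃, h₃⟩ := exists_trace_t₃_le (xL := xL) (xR := xR) hT
  set V₁ := (volume.real (Ioo xL xR))⁻¹
  set V₂ := (volume.real (Ioo xL xR ×ˢ Ioo (0 : ℝ) 1))⁻¹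
  have hV₁ : 0 ≤ V₁ := by positivity
  have hV₂ : 0 ≤ V₂ := by positivity
  refine ⟨l₁ * (V₁ * C₂) + l₂ * (V₂ * ((ε ^ 2 + ε ^ 4) * C₃)), by positivity,
    fun {fρ fj fw} cρ cj cw => ?_⟩
  have q1 := h₂ (ux := ρx) hρ hρt dρt tρ cρ
  obtain ⟨m2, q2⟩ := h₃ (ux := jx) hj hjt djt tj cj
  obtain ⟨m3, q3⟩ := h₃ (ux := wx) hw hwt dwt tw cw
  have pρ := err₂_nonneg T xL xR ρ ρt ρx fρ
  have pj := err₃_nonneg T xL xR j jt jx fj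
  have pw := err₃_nonneg T xL xR w wt wx fw
  set Eρ := err₂ T xL xR ρ ρt ρx fρ
  set Ej := err₃ T xL xR j jt jx fj
  set Ew := err₃ T xL xR w wt wx fw
  have a1 := setAverage_le q1
  have a2 : ⨍ y in Ioo xL xR ×ˢ Ioo (0 : ℝ) 1,
      (ε ^ 2 * (fj (0, y) - δ.jIC y) ^ 2 + ε ^ 4 * (fw (0, y) - δ.wIC y) ^ 2)
      ≤ V₂ * (ε ^ 2 * (C₃ * Ej) + ε ^ 4 * (C₃ * Ew)) := by
    refine setAverage_le ?_
    rw [integral_add (m2.integrable_sq.const_mul _) (m3.integrable_sq.const_mul _),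
      integral_const_mul, integral_const_mul]
    gcongr
  have a3 : ε ^ 2 * (C₃ * Ej) + ε ^ 4 * (C₃ * Ew) ≤ (ε ^ 2 + ε ^ 4) * C₃ * (Eρ + Ej + Ew) := by
    have k1 : ε ^ 2 * (C₃ * Ej) ≤ ε ^ 2 * (C₃ * (Eρ + Ej + Ew)) := by gcongr; linarith
    have k2 : ε ^ 4 * (C₃ * Ew) ≤ ε ^ 4 * (C₃ * (Eρ + Ej + Ew)) := by gcongr; linarith
    linarith
  unfold lossInitial
  simp only [sq_abs]
  have b1 : l₁ * ⨍ x in Ioo xL xR, (fρ (0, x) - δ.ρIC x) ^ 2 ≤ l₁ * (V₁ * (C₂ * (Eρ + Ej + Ew))) := by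
    gcongr
    refine a1.trans ?_
    gcongr
    linarith
  have b2 := mul_le_mul_of_nonneg_left (a2.trans (mul_le_mul_of_nonneg_left a3 hV₂)) hl₂
  linarith

theorem exists_lossBoundary_le (hx : xL < xR) (hl₃ : 0 ≤ l₃) (hl₄ : 0 ≤ l₄) {δ : SideData}
    {ρ ρt ρx : ℝ × ℝ → ℝ} {j jt jx w wt wx : ℝ × ℝ × ℝ → ℝ}
    (hρ : MemLp ρ 2 (volume.restrict (domTX T xL xR)))
    (hρx : MemLp ρx 2 (volume.restrict (domTX T xL xR)))
    (hj : MemLp j 2 (volume.restrict (domTXV T xL xR)))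
    (hjx : MemLp jx 2 (volume.restrict (domTXV T xL xR)))
    (hw : MemLp w 2 (volume.restrict (domTXV T xL xR)))
    (hwx : MemLp wx 2 (volume.restrict (domTXV T xL xR)))
    (dρx : IsWeakDeriv (domTX T xL xR) (0, 1) ρ ρx)
    (djx : IsWeakDeriv (domTXV T xL xR) (0, 1, 0) j jx)
    (dwx : IsWeakDeriv (domTXV T xL xR) (0, 1, 0) w wx)
    (hδ : AttainsData T xL xR δ ρ j w) :
    ∃ C : ℝ, 0 ≤ C ∧ ∀ {fρ : ℝ × ℝ → ℝ} {fj fw : ℝ × ℝ × ℝ → ℝ}, ContDiff ℝ ∞ fρ →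
      ContDiff ℝ ∞ fj → ContDiff ℝ ∞ fw → lossBoundary T xL xR l₃ l₄ δ fρ fj fw ≤
      C * (err₂ T xL xR ρ ρt ρx fρ + err₃ T xL xR j jt jx fj + err₃ T xL xR w wt wx fw) := by
  obtain ⟨-, -, -, tρL, tρR, ⟨tjL, tjR⟩, ⟨twL, twR⟩⟩ := hδ
  obtain ⟨CL, hCL, hL⟩ := exists_trace_x₂_le (T := T) hx (.inl ⟨rfl, rfl⟩)
  obtain ⟨CR, hCR, hR⟩ := exists_trace_x₂_le (T := T) hx (.inr ⟨rfl, rfl⟩)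
  obtain ⟨DL, hDL, gL⟩ := exists_trace_x₃_le (T := T) hx (.inl ⟨rfl, rfl⟩)
  obtain ⟨DR, hDR, gR⟩ := exists_trace_x₃_le (T := T) hx (.inr ⟨rfl, rfl⟩)
  set V₁ := (volume.real (Ioo 0 T))⁻¹
  set V₂ := (volume.real (Ioo 0 T ×ˢ Ioo (0 : ℝ) 1))⁻¹
  have hV₁ : 0 ≤ V₁ := by positivity
  have hV₂ : 0 ≤ V₂ := by positivity
  refine ⟨l₃ * (V₁ * (CL + CR)) + l₄ * (V₂ * (DL + DR)), by positivity,
    fun {fρ fj fw} cρ cj cw => ?_⟩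
  obtain ⟨m1, q1⟩ := hL (ut := ρt) hρ hρx dρx tρL cρ
  obtain ⟨m2, q2⟩ := hR (ut := ρt) hρ hρx dρx tρR cρ
  obtain ⟨m3, q3⟩ := gL (ut := jt) hj hjx djx tjL cj
  obtain ⟨m4, q4⟩ := gR (ut := jt) hj hjx djx tjR cj
  obtain ⟨m5, q5⟩ := gL (ut := wt) hw hwx dwx twL cw
  obtain ⟨m6, q6⟩ := gR (ut := wt) hw hwx dwx twR cw
  have pρ := err₂_nonneg T xL xR ρ ρt ρx fρ
  have pj := err₃_nonneg T xL xR j jt jx fj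
  have pw := err₃_nonneg T xL xR w wt wx fw
  set Eρ := err₂ T xL xR ρ ρt ρx fρ
  set Ej := err₃ T xL xR j jt jx fj
  set Ew := err₃ T xL xR w wt wx fw
  have a1 : ⨍ t in Ioo 0 T, ((fρ (t, xL) - δ.ρBC (t, xL)) ^ 2
      + (fρ (t, xR) - δ.ρBC (t, xR)) ^ 2) / 2 ≤ V₁ * ((CL + CR) * (Eρ + Ej + Ew)) := by
    refine setAverage_le ?_
    rw [integral_div, integral_add m1.integrable_sq m2.integrable_sq]
    have k1 := mul_nonneg hCL (add_nonneg pj pw)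
    have k2 := mul_nonneg hCR (add_nonneg pj pw)
    have k3 := mul_nonneg hCL pρ
    have k4 := mul_nonneg hCR pρ
    linarith
  have a2 : ⨍ y in Ioo 0 T ×ˢ Ioo (0 : ℝ) 1,
      (((fw (y.1, xL, y.2) - δ.wBC (y.1, xL, y.2)) ^ 2
        + (fj (y.1, xL, y.2) - δ.jBC (y.1, xL, y.2)) ^ 2) +
      ((fw (y.1, xR, y.2) - δ.wBC (y.1, xR, y.2)) ^ 2
        + (fj (y.1, xR, y.2) - δ.jBC (y.1, xR, y.2)) ^ 2)) / 2
      ≤ V₂ * ((DL + DR) * (Eρ + Ej + Ew)) := by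
    refine setAverage_le ?_
    have e := integral_add (m5.integrable_sq.add m3.integrable_sq)
      (m6.integrable_sq.add m4.integrable_sq)
    simp only [Pi.add_apply] at e
    rw [integral_div, e, integral_add m5.integrable_sq m3.integrable_sq,
      integral_add m6.integrable_sq m4.integrable_sq]
    have k1 := mul_nonneg hDL pρ
    have k2 := mul_nonneg hDR pρ
    have k3 := mul_nonneg hDL (add_nonneg pj pw)
    have k4 := mul_nonneg hDR (add_nonneg pj pw)
    linarith
  unfold lossBoundary
  simp only [sq_abs]
  have b1 := mul_le_mul_of_nonneg_left a1 hl₃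
  have b2 := mul_le_mul_of_nonneg_left a2 hl₄
  linarith

theorem loss_nonneg (hl₁ : 0 ≤ l₁) (hl₂ : 0 ≤ l₂) (hl₃ : 0 ≤ l₃) (hl₄ : 0 ≤ l₄) (δ : SideData)
    (ρ : ℝ × ℝ → ℝ) (j w : ℝ × ℝ × ℝ → ℝ) : 0 ≤ loss ε T xL xR l₁ l₂ l₃ l₄ δ ρ j w := by
  unfold loss lossResidual lossInitial lossBoundary
  simp only [setAverage_eq, smul_eq_mul]
  have : ∀ (α : Type) [MeasureSpace α] (s : Set α) (f : α → ℝ), (∀ x, 0 ≤ f x) →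
      0 ≤ (volume.real s)⁻¹ * ∫ x in s, f x := fun α _ s f hf =>
    mul_nonneg (by positivity) (integral_nonneg hf)
  refine add_nonneg (add_nonneg (add_nonneg (add_nonneg ?_ ?_) ?_)
    (add_nonneg (mul_nonneg hl₁ ?_) (mul_nonneg hl₂ ?_)))
    (add_nonneg (mul_nonneg hl₃ ?_) (mul_nonneg hl₄ ?_)) <;>
  exact this _ _ _ fun _ => by positivity

end Loss

/-! ### Networks with the prescribed widths, and the rate for every `N` -/

section Rate

/-- The coordinates `(t, x)` as a vector. -/
noncomputable def coord₂ : (ℝ × ℝ) ≃L[ℝ] (Fin 2 → ℝ) :=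
  LinearEquiv.toContinuousLinearEquiv
    { toFun := fun z => ![z.1, z.2]
      invFun := fun y => (y 0, y 1)
      map_add' := fun _ _ => by ext i; fin_cases i <;> rfl
      map_smul' := fun _ _ => by ext i; fin_cases i <;> rfl
      left_inv := fun _ => rfl
      right_inv := fun y => by ext i; fin_cases i <;> rfl }

/-- The coordinates `(t, x, v)` as a vector. -/
noncomputable def coord₃ : (ℝ × ℝ × ℝ) ≃L[ℝ] (Fin 3 → ℝ) :=
  LinearEquiv.toContinuousLinearEquiv
    { toFun := fun z => ![z.1, z.2.1, z.2.2]
      invFun := fun y => (y 0, y 1, y 2)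
      map_add' := fun _ _ => by ext i; fin_cases i <;> rfl
      map_smul' := fun _ _ => by ext i; fin_cases i <;> rfl
      left_inv := fun _ => rfl
      right_inv := fun y => by ext i; fin_cases i <;> rfl }

theorem contDiff_toFun₂ {m₁ m₂ : ℕ} (n : TanhNet 2 m₁ m₂) : ContDiff ℝ ∞ n.toFun₂ :=
  (contDiff_eval n).comp coord₂.contDiff

theorem contDiff_toFun₃ {m₁ m₂ : ℕ} (n : TanhNet 3 m₁ m₂) : ContDiff ℝ ∞ n.toFun₃ :=
  (contDiff_eval n).comp coord₃.contDiff

/-- The rate `((1 + ln N) / N)²`. -/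
noncomputable def rate (N : ℕ) : ℝ := (1 + Real.log N) ^ 2 * ((N : ℝ) ^ 2)⁻¹

theorem rate_pos {N : ℕ} (hN : 0 < N) : 0 < rate N := by
  have : 0 ≤ Real.log N := Real.log_natCast_nonneg N
  have : (0 : ℝ) < N := by exact_mod_cast hN
  unfold rate
  positivity

theorem tendsto_rate : Tendsto rate atTop (𝓝 0) := by
  -- The parameter `1 / 20` cancels the factor 20, so that `width (1 / 20) N` is `log N / N`.
  have h := (tendsto_inv_atTop_nhds_zero_nat (𝕜 := ℝ)).add (tendsto_width (1 / 20))
  rw [add_zero] at h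
  have h2 := h.pow 2
  rw [zero_pow two_ne_zero] at h2
  refine h2.congr fun N => ?_
  rw [rate, width, ← inv_pow, ← mul_pow]
  ring

theorem width_sq_le (L : ℝ) (N : ℕ) : width L N ^ 2 ≤ (20 * L) ^ 2 * rate N := by
  have h : 0 ≤ Real.log N := Real.log_natCast_nonneg N
  have e : width L N ^ 2 = (20 * L) ^ 2 * (Real.log N ^ 2 * ((N : ℝ) ^ 2)⁻¹) := by
    rw [width, ← inv_pow]; ring
  rw [e, rate]
  gcongr
  linarith

theorem exists_net₂ {T xL xR : ℝ} (hT : 0 < T) (hx : xL < xR) {u ut ux : ℝ × ℝ → ℝ}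
    (hu : MemH (domTX T xL xR) 2 u) (ht : IsWeakDeriv (domTX T xL xR) (1, 0) u ut)
    (hx' : IsWeakDeriv (domTX T xL xR) (0, 1) u ux) :
    MemLp ut 2 (volume.restrict (domTX T xL xR)) ∧ MemLp ux 2 (volume.restrict (domTX T xL xR)) ∧
    ∃ C : ℝ, ∀ᶠ N in atTop, ∃ n : TanhNet 2 (27 * N) (27 * N ^ 2),
      err₂ T xL xR u ut ux n.toFun₂ ≤ C * rate N := by
  obtain ⟨c, m, L, hm, hK⟩ := exists_isSmoothingKernel₂ hT hx
  obtain ⟨k1, k2, C, hC⟩ := exists_tanhNet_sobolevError_le isOpen_domTX convex_domTX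
    isBounded_domTX hm hK coord₂ (m₁ := fun N => 27 * N) (m₂ := fun N => 27 * N ^ 2)
    (by filter_upwards [eventually_ge_atTop 1] with N hN; omega)
    (by
      filter_upwards [eventually_ge_atTop 1] with N hN
      simp only [Fintype.card_prod, Fintype.card_fin]
      nlinarith) hu ht hx'
  refine ⟨k1, k2, |C| * (20 * L) ^ 2, hC.mono fun N ⟨n, hn⟩ => ⟨n, hn.trans ?_⟩⟩
  calc C * width L N ^ 2 ≤ |C| * width L N ^ 2 := by gcongr; exact le_abs_self C
    _ ≤ |C| * ((20 * L) ^ 2 * rate N) := by gcongr; exact width_sq_le L N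
    _ = _ := by ring

theorem exists_net₃ {T xL xR : ℝ} (hT : 0 < T) (hx : xL < xR) {u ut ux : ℝ × ℝ × ℝ → ℝ}
    (hu : MemH (domTXV T xL xR) 2 u) (ht : IsWeakDeriv (domTXV T xL xR) (1, 0, 0) u ut)
    (hx' : IsWeakDeriv (domTXV T xL xR) (0, 1, 0) u ux) :
    MemLp ut 2 (volume.restrict (domTXV T xL xR)) ∧ MemLp ux 2 (volume.restrict (domTXV T xL xR)) ∧
    ∃ C : ℝ, ∀ᶠ N in atTop, ∃ n : TanhNet 3 (27 * N) (27 * N ^ 3),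
      err₃ T xL xR u ut ux n.toFun₃ ≤ C * rate N := by
  obtain ⟨c, m, L, hm, hK⟩ := exists_isSmoothingKernel₃ hT hx (zero_lt_one (α := ℝ))
  obtain ⟨k1, k2, C, hC⟩ := exists_tanhNet_sobolevError_le isOpen_domTXV convex_domTXV
    isBounded_domTXV hm hK coord₃ (m₁ := fun N => 27 * N) (m₂ := fun N => 27 * N ^ 3)
    (by filter_upwards [eventually_ge_atTop 1] with N hN; omega)
    (by
      filter_upwards [eventually_ge_atTop 1] with N hN
      simp only [Fintype.card_prod, Fintype.card_fin]
      calc (2 * N + 1) * ((2 * N + 1) * (2 * N + 1)) ≤ (3 * N) * ((3 * N) * (3 * N)) := by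
            gcongr <;> omega
        _ = 27 * N ^ 3 := by ring) hu ht hx'
  refine ⟨k1, k2, |C| * (20 * L) ^ 2, hC.mono fun N ⟨n, hn⟩ => ⟨n, hn.trans ?_⟩⟩
  calc C * width L N ^ 2 ≤ |C| * width L N ^ 2 := by gcongr; exact le_abs_self C
    _ ≤ |C| * ((20 * L) ^ 2 * rate N) := by gcongr; exact width_sq_le L N
    _ = _ := by ring

instance {d m₁ m₂ : ℕ} : Inhabited (TanhNet d m₁ m₂) := ⟨⟨0, 0, 0, 0, 0, 0⟩⟩

/-- The finitely many exceptional indices are absorbed by adding all their ratios `|f k / r k|` to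
the constant. The approximation theory may thus be asymptotic while the theorem covers every `N >
5`. -/
theorem exists_le_mul_of_eventually_le {f r : ℕ → ℝ} {C : ℝ} (h : ∀ᶠ N in atTop, f N ≤ C * r N)
    (hr : ∀ N, 0 < N → 0 < r N) : ∃ C', ∀ N, 0 < N → f N ≤ C' * r N := by
  obtain ⟨N₀, h0⟩ := eventually_atTop.1 h
  refine ⟨|C| + ∑ k ∈ Finset.range N₀, |f k / r k|, fun N hN => ?_⟩
  have hs : 0 ≤ ∑ k ∈ Finset.range N₀, |f k / r k| := Finset.sum_nonneg fun _ _ => abs_nonneg _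
  rcases le_or_gt N₀ N with h1 | h1
  · refine (h0 N h1).trans (mul_le_mul_of_nonneg_right ?_ (hr N hN).le)
    linarith [le_abs_self C]
  · rw [← div_le_iff₀ (hr N hN)]
    have := Finset.single_le_sum (f := fun k => |f k / r k|) (fun _ _ => abs_nonneg _)
      (Finset.mem_range.2 h1)
    linarith [le_abs_self (f N / r N), abs_nonneg C]

end Rate

end APNN

/-! ### The theorem -/

theorem mainTheorem6 :
    ∃ κ : ℕ, ∀ (ε T xL xR l₁ l₂ l₃ l₄ : ℝ), 0 < ε → 0 < T → xL < xR →
      0 ≤ l₁ → 0 ≤ l₂ → 0 ≤ l₃ → 0 ≤ l₄ →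
      ∀ (δ : APNN.SideData) (ρ : ℝ × ℝ → ℝ) (j w : ℝ × ℝ × ℝ → ℝ),
        APNN.MemH (APNN.domTX T xL xR) 2 ρ →
        APNN.MemH (APNN.domTXV T xL xR) 2 j →
        APNN.MemH (APNN.domTXV T xL xR) 2 w →
        APNN.IsSolution ε T xL xR ρ j w →
        APNN.AttainsData T xL xR δ ρ j w →
        ∃ (C : ℝ) (ρN : ∀ N : ℕ, APNN.TanhNet 2 (κ * N) (κ * N ^ 2))
          (jN wN : ∀ N : ℕ, APNN.TanhNet 3 (κ * N) (κ * N ^ 3)),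
          (∀ N : ℕ, 5 < N →
            APNN.loss ε T xL xR l₁ l₂ l₃ l₄ δ (ρN N).toFun₂ (jN N).toFun₃ (wN N).toFun₃
              ≤ C * (1 + Real.log N) ^ 2 * ((N : ℝ) ^ 2)⁻¹) ∧
          Filter.Tendsto (fun N : ℕ =>
            APNN.loss ε T xL xR l₁ l₂ l₃ l₄ δ (ρN N).toFun₂ (jN N).toFun₃ (wN N).toFun₃)
            Filter.atTop (nhds 0) := by
  -- `27 = 3³` comes from `(2N + 1)³ ≤ (3N)³` exponentials in three variables; it also covers two
  -- variables and the `d` neurons of the first layer.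
  refine ⟨27, fun ε T xL xR l₁ l₂ l₃ l₄ _ hT hx hl₁ hl₂ hl₃ hl₄ δ ρ j w hρ hj hw hsol hδ => ?_⟩
  obtain ⟨ρt, ρx, jt, jx, wt, wx, dρt, dρx, djt, djx, dwt, dwx, s1, s2, s3, -⟩ := hsol
  obtain ⟨mρt, mρx, Cρ, hCρ⟩ := APNN.exists_net₂ hT hx hρ dρt dρx
  obtain ⟨mjt, mjx, Cj, hCj⟩ := APNN.exists_net₃ hT hx hj djt djx
  obtain ⟨mwt, mwx, Cw, hCw⟩ := APNN.exists_net₃ hT hx hw dwt dwx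
  obtain ⟨CI, hCI, hI⟩ := APNN.exists_lossInitial_le (ε := ε) (ρx := ρx) (jx := jx) (wx := wx)
    hT hl₁ hl₂ hρ.1 mρt hj.1 mjt hw.1 mwt dρt djt dwt hδ
  obtain ⟨CB, hCB, hB⟩ := APNN.exists_lossBoundary_le (ρt := ρt) (jt := jt) (wt := wt)
    hx hl₃ hl₄ hρ.1 mρx hj.1 mjx hw.1 mwx dρx djx dwx hδ
  have key : ∃ K : ℝ, ∀ᶠ N in atTop, ∃ (a : APNN.TanhNet 2 (27 * N) (27 * N ^ 2))
      (b c : APNN.TanhNet 3 (27 * N) (27 * N ^ 3)),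
      APNN.loss ε T xL xR l₁ l₂ l₃ l₄ δ a.toFun₂ b.toFun₃ c.toFun₃ ≤ K * APNN.rate N := by
    set CR := 2 * (volume.real (APNN.domTX T xL xR))⁻¹
        + 16 * ((ε ^ 2) ^ 2 + 1) * (volume.real (APNN.domTXV T xL xR))⁻¹ with hCR
    have hCR0 : 0 ≤ CR := by positivity
    refine ⟨(CR + CI + CB) * (Cρ + Cj + Cw), ?_⟩
    filter_upwards [hCρ, hCj, hCw] with N ⟨a, ha⟩ ⟨b, hb⟩ ⟨c, hc⟩
    refine ⟨a, b, c, ?_⟩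
    have ca := APNN.contDiff_toFun₂ a
    have cb := APNN.contDiff_toFun₃ b
    have cc := APNN.contDiff_toFun₃ c
    have r := APNN.lossResidual_le (ρ := ρ) mρt mρx hj.1 mjt mjx hw.1 mwt mwx s1 s2 s3 ca cb cc
    rw [← hCR] at r
    refine (add_le_add (add_le_add r (hI ca cb cc)) (hB ca cb cc)).trans ?_
    rw [← add_mul, ← add_mul, mul_assoc]
    refine mul_le_mul_of_nonneg_left ?_ (by positivity)
    linarith
  obtain ⟨K, hK⟩ := key
  -- Networks are needed for every `N`, but good ones exist only eventually. Elsewhere the zero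
  -- network is taken, and its finite loss is absorbed into `C`.
  have hch : ∀ N : ℕ, ∃ (a : APNN.TanhNet 2 (27 * N) (27 * N ^ 2))
      (b c : APNN.TanhNet 3 (27 * N) (27 * N ^ 3)),
      (∃ (a' : APNN.TanhNet 2 (27 * N) (27 * N ^ 2)) (b' c' : APNN.TanhNet 3 (27 * N) (27 * N ^ 3)),
        APNN.loss ε T xL xR l₁ l₂ l₃ l₄ δ a'.toFun₂ b'.toFun₃ c'.toFun₃ ≤ K * APNN.rate N) →
      APNN.loss ε T xL xR l₁ l₂ l₃ l₄ δ a.toFun₂ b.toFun₃ c.toFun₃ ≤ K * APNN.rate N := by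
    intro N
    by_cases h : ∃ (a' : APNN.TanhNet 2 (27 * N) (27 * N ^ 2))
        (b' c' : APNN.TanhNet 3 (27 * N) (27 * N ^ 3)),
        APNN.loss ε T xL xR l₁ l₂ l₃ l₄ δ a'.toFun₂ b'.toFun₃ c'.toFun₃ ≤ K * APNN.rate N
    · obtain ⟨a, b, c, h⟩ := h
      exact ⟨a, b, c, fun _ => h⟩
    · exact ⟨default, default, default, fun h' => absurd h' h⟩
  choose a b c habc using hch
  have hev : ∀ᶠ N in atTop, APNN.loss ε T xL xR l₁ l₂ l₃ l₄ δ (a N).toFun₂ (b N).toFun₃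
      (c N).toFun₃ ≤ K * APNN.rate N := hK.mono fun N => habc N
  obtain ⟨C, hC⟩ := APNN.exists_le_mul_of_eventually_le hev fun N => APNN.rate_pos
  refine ⟨C, a, b, c, fun N hN => ?_, ?_⟩
  · rw [mul_assoc]
    exact hC N (by omega)
  · have h0 := APNN.tendsto_rate.const_mul K
    rw [mul_zero] at h0
    exact tendsto_of_tendsto_of_tendsto_of_le_of_le' tendsto_const_nhds h0
      (Eventually.of_forall fun _ => APNN.loss_nonneg hl₁ hl₂ hl₃ hl₄ _ _ _ _) hev
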